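/- Let $\Bbbk$ be $\mathbb R$ or $\mathbb C$ and let $n,a,b\ge 0$ be integers. Let $\widehat{\mathcal O}_{2n|a,b}=\Bbbk[[p_1,\dots,p_n,q_1,\dots,q_n,\theta_1,\dots,\theta_{a+b}]]$ ($p_i,q_i$ even, $\theta_j$ odd) be the Poisson superalgebra of functions on the formal super-disk, with $\{p_i,q_i\}=1$, $\{\theta_j,\theta_j\}=\varepsilon_j$ ($\varepsilon_j=1$ for $j\le a$, $\varepsilon_j=-1$ for $j>a$) and all other brackets of generators zero. Let $\mathrm{Aut}_{2n|a,b}$ be the pro-supergroup of filtration-preserving automorphisms of this Poisson superalgebra: its group of $A$-points, for a supercommutative superalgebra $A$, consists of the even $A$-linear automorphisms of $A\,\hat\otimes\,\widehat{\mathcal O}_{2n|a,b}$ that preserve the bracket and the filtration by powers of the ideal $(p,q,\theta)$. If $A$ is a topological superalgebra, $\mathrm{Aut}_{2n|a,b}(A)$ carries the inverse limit topology (coefficientwise convergence). Let $\mathrm{Sp}(2n|a,b)\subset \mathrm{Aut}_{2n|a,b}$ be the subgroup of linear automorphisms. (1) The space $\mathrm{Aut}_{2n|a,b}/\mathrm{Sp}(2n|a,b)$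 is contractible. More precisely, the quotient space of $\Bbbk$-points is contractible, and so is the quotient $\mathrm{Aut}_{2n|a,b}(A)/\mathrm{Sp}(2n|a,b)(A)$ for every topological supercommutative $\Bbbk$-superalgebra $A$. (2) Consequently formal exponentials always exist. That is, let $(\mathbb M,\omega)$ be a symplectic supermanifold of type $(2n|a,b)$, i.e. a (Hausdorff, second countable) supermanifold with an even closed nondegenerate 2-form that is locally isomorphic to $\sum_i dp_i\wedge dq_i+\sum_j\tfrac{\varepsilon_j}{2}(d\theta_j)^2$ on $\Bbbk$-valued functions on $\mathbb R^{2n|a+b}$. Let $\mathbb M^{\mathrm{coor}}\to\mathbb M$ be the bundle of formal symplectic coordinate systems, with fibre over $x$ the space of isomorphisms of Poisson superalgebras $\widehat{\mathcal O}_{\mathbb M,x}\cong\widehat{\mathcal O}_{2n|a,b}$. Then the bundle $\mathbb M^{\mathrm{coor}}/\mathrm{Sp}(2n|a,b)\to\mathbb M$ has a global section (as a bundle of pro-supermanifolds). -/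

import Mathlib

open TopologicalSpace

noncomputable section

namespace SuperGeom

/-- A supercommutative superalgebra over `𝕜` (where 2 will be invertible). The `ℤ/2`-grading is encoded by
its grading automorphism `parity`, which is `+1` on even and `-1` on odd elements. -/
class SuperAlgebra (𝕜 A : Type*) [CommRing 𝕜] [Ring A] [Algebra 𝕜 A] where
  parity : A →ₐ[𝕜] A
  parity_parity : ∀ a, parity (parity a) = a
  even_mul : ∀ a b, parity a = a → a * b = b * a
  odd_mul : ∀ a b, parity a = -a → a * b = parity b * a

section
variable (𝕜 : Type*) {A : Type*} [CommRing 𝕜] [Ring A] [Algebra 𝕜 A] [SuperAlgebra 𝕜 A]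

/-- `a ↦ (-1)^(k|a|) a`. -/
def twist (k : ℕ) : A →ₐ[𝕜] A := SuperAlgebra.parity ^ k

theorem twist_zero (a : A) : twist 𝕜 0 a = a := by simp [twist]
theorem twist_one (a : A) : twist 𝕜 1 a = SuperAlgebra.parity (𝕜 := 𝕜) a := by simp [twist]
theorem twist_add (k l : ℕ) (a : A) : twist 𝕜 (k + l) a = twist 𝕜 k (twist 𝕜 l a) := by
  simp [twist, pow_add]
theorem twist_comm (k l : ℕ) (a : A) : twist 𝕜 k (twist 𝕜 l a) = twist 𝕜 l (twist 𝕜 k a) := by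
  rw [← twist_add, add_comm, twist_add]
theorem twist_twist (k : ℕ) (a : A) : twist 𝕜 k (twist 𝕜 k a) = a := by
  induction k with
  | zero => simp [twist_zero]
  | succ k ih =>
    rw [add_comm, twist_add, twist_add, twist_comm 𝕜 k 1, ih, twist_one, twist_one, SuperAlgebra.parity_parity]

theorem twist_of_homog {k : ℕ} {a : A} (h : SuperAlgebra.parity (𝕜 := 𝕜) a = (-1 : ℤ) ^ k • a)
    (l : ℕ) : twist 𝕜 l a = (-1 : ℤ) ^ (l * k) • a := by
  induction l with
  | zero => simp [twist_zero]
  | succ l ih =>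
    rw [add_comm, twist_add, ih, twist_one, map_zsmul, h, smul_smul, ← pow_add]
    congr 2
    ring

theorem homog_mul {k : ℕ} {a : A} (h : SuperAlgebra.parity (𝕜 := 𝕜) a = (-1 : ℤ) ^ k • a) (b : A) :
    a * b = twist 𝕜 k b * a := by
  obtain ⟨m, rfl | rfl⟩ := Nat.even_or_odd' k
  · rw [two_mul, twist_add, twist_twist]
    exact SuperAlgebra.even_mul a b (by rw [h, pow_mul]; simp)
  · rw [add_comm, two_mul, twist_add, twist_add, twist_twist, twist_one]
    exact SuperAlgebra.odd_mul a b (by rw [h, pow_succ, pow_mul]; simp)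
end

/-- The sign in `θ^S θ^T = koszul S T • θ^(S ∪ T)` for disjoint `S`, `T`, where `θ^S` is the product of the
`θ_i`, `i ∈ S`, in increasing order. -/
def koszul {r : ℕ} (S T : Finset (Fin r)) : ℤ :=
  (-1) ^ ((S ×ˢ T).filter fun p => p.2 < p.1).card

theorem koszul_empty_left {r : ℕ} (T : Finset (Fin r)) : koszul ∅ T = 1 := by simp [koszul]
theorem koszul_empty_right {r : ℕ} (T : Finset (Fin r)) : koszul T ∅ = 1 := by simp [koszul]

theorem koszul_union_left {r : ℕ} {S S' : Finset (Fin r)} (T : Finset (Fin r))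
    (h : Disjoint S S') : koszul (S ∪ S') T = koszul S T * koszul S' T := by
  unfold koszul
  rw [← pow_add, Finset.union_product, Finset.filter_union, Finset.card_union_of_disjoint]
  exact Finset.disjoint_filter_filter (Finset.disjoint_product.2 (Or.inl h))

theorem koszul_union_right {r : ℕ} (S : Finset (Fin r)) {T T' : Finset (Fin r)}
    (h : Disjoint T T') : koszul S (T ∪ T') = koszul S T * koszul S T' := by
  unfold koszul
  rw [← pow_add, Finset.product_union, Finset.filter_union, Finset.card_union_of_disjoint]
  exact Finset.disjoint_filter_filter (Finset.disjoint_product.2 (Or.inr h))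

theorem koszul_swap {r : ℕ} {S T : Finset (Fin r)} (h : Disjoint S T) :
    koszul S T = (-1) ^ (S.card * T.card) * koszul T S := by
  have h1 : ((T ×ˢ S).filter fun p => p.2 < p.1).card
      = ((S ×ˢ T).filter fun p => p.1 < p.2).card := by
    refine Finset.card_bij' (fun p _ => p.swap) (fun p _ => p.swap) ?_ ?_ ?_ ?_ <;> simp <;> tauto
  have h2 : ((S ×ˢ T).filter fun p => p.2 < p.1).card
      + ((S ×ˢ T).filter fun p => p.1 < p.2).card = S.card * T.card := by
    rw [← Finset.card_product, ← Finset.card_union_of_disjoint]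
    · congr 1
      ext ⟨s, t⟩
      simp only [Finset.mem_union, Finset.mem_filter, Finset.mem_product]
      have : s ∈ S → t ∈ T → s ≠ t := fun hs ht e => Finset.disjoint_left.1 h hs (e ▸ ht)
      constructor
      · tauto
      · rintro ⟨hs, ht⟩
        rcases lt_or_gt_of_ne (this hs ht) with h | h <;> tauto
    · rw [Finset.disjoint_filter]
      intro p _ h1 h2
      exact lt_asymm h1 h2
  unfold koszul
  rw [h1, ← h2, ← pow_add, add_assoc, ← two_mul, pow_add, pow_mul]
  simp

theorem koszul_mul_self {r : ℕ} (S T : Finset (Fin r)) : koszul S T * koszul S T = 1 := by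
  unfold koszul
  rw [← pow_add, ← two_mul, pow_mul]; simp

/-- The superalgebra `A[θ_1, …, θ_r]` on odd generators over a superalgebra `A`: the element
`∑ f S θ^S` is stored as the function `f`, and `θ_i a = (-1)^|a| a θ_i` for `a` in `A`. -/
@[nolint unusedArguments]
def Gr (𝕜 A : Type*) (r : ℕ) : Type _ := Finset (Fin r) → A

namespace Gr
variable {𝕜 A : Type*} {r : ℕ} 

@[ext] theorem ext {f g : Gr 𝕜 A r} (h : ∀ S, f S = g S) : f = g := funext h

variable [CommRing 𝕜] [Ring A] [Algebra 𝕜 A] 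

instance : AddCommGroup (Gr 𝕜 A r) := inferInstanceAs (AddCommGroup (Finset (Fin r) → A))
instance : Module 𝕜 (Gr 𝕜 A r) := inferInstanceAs (Module 𝕜 (Finset (Fin r) → A))

/-- `a θ^S`. -/
def single (S : Finset (Fin r)) (a : A) : Gr 𝕜 A r := fun T => if T = S then a else 0

instance : One (Gr 𝕜 A r) := ⟨single ∅ 1⟩

theorem add_apply (f g : Gr 𝕜 A r) (S) : (f + g) S = f S + g S := rfl
theorem smul_apply (c : 𝕜) (f : Gr 𝕜 A r) (S) : (c • f) S = c • f S := rfl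
theorem neg_apply (f : Gr 𝕜 A r) (S) : (-f) S = - f S := rfl
theorem zero_apply (S) : (0 : Gr 𝕜 A r) S = 0 := rfl
theorem one_apply (S) : (1 : Gr 𝕜 A r) S = if S = ∅ then 1 else 0 := rfl

variable [SuperAlgebra 𝕜 A]

instance : Mul (Gr 𝕜 A r) :=
  ⟨fun f g T => ∑ S ∈ T.powerset, koszul S (T \ S) • (f S * twist 𝕜 S.card (g (T \ S)))⟩

theorem mul_apply (f g : Gr 𝕜 A r) (T) :
    (f * g) T = ∑ S ∈ T.powerset, koszul S (T \ S) • (f S * twist 𝕜 S.card (g (T \ S))) := rfl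

theorem mul_assoc_aux (f g h : Gr 𝕜 A r) : f * g * h = f * (g * h) := by
  ext T
  simp only [mul_apply, Finset.sum_mul, Finset.mul_sum, Finset.smul_sum, map_sum]
  rw [Finset.sum_sigma', Finset.sum_sigma']
  refine Finset.sum_bij' (fun p _ => ⟨p.2, p.1 \ p.2⟩) (fun p _ => ⟨p.1 ∪ p.2, p.1⟩) ?_ ?_ ?_ ?_ ?_
  · rintro ⟨U, S⟩ hp
    simp only [Finset.mem_sigma, Finset.mem_powerset] at hp ⊢
    exact ⟨hp.2.trans hp.1, Finset.sdiff_subset_sdiff hp.1 le_rfl⟩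
  · rintro ⟨S, V⟩ hp
    simp only [Finset.mem_sigma, Finset.mem_powerset] at hp ⊢
    exact ⟨Finset.union_subset hp.1 (hp.2.trans Finset.sdiff_subset), Finset.subset_union_left⟩
  · rintro ⟨U, S⟩ hp
    simp only [Finset.mem_sigma, Finset.mem_powerset] at hp ⊢
    simp [Finset.union_sdiff_of_subset hp.2]
  · rintro ⟨S, V⟩ hp
    simp only [Finset.mem_sigma, Finset.mem_powerset, Finset.subset_sdiff] at hp ⊢
    simp [Finset.union_sdiff_cancel_left hp.2.2.symm]
  · rintro ⟨U, S⟩ hp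
    simp only [Finset.mem_sigma, Finset.mem_powerset] at hp ⊢
    obtain ⟨hU, hS⟩ := hp
    have e1 : (T \ S) \ (U \ S) = T \ U := by
      ext x; simp only [Finset.mem_sdiff]; have := @hS x; tauto
    have e2 : T \ S = (U \ S) ∪ (T \ U) := by
      ext x; simp only [Finset.mem_sdiff, Finset.mem_union]; have := @hS x; have := @hU x; tauto
    have d1 : Disjoint S (U \ S) := Finset.disjoint_sdiff
    have d2 : Disjoint (U \ S) (T \ U) :=
      Finset.disjoint_of_subset_left Finset.sdiff_subset Finset.disjoint_sdiff
    have e3 : U = S ∪ (U \ S) := (Finset.union_sdiff_of_subset hS).symm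
    have e4 : U.card = S.card + (U \ S).card := by
      conv_lhs => rw [e3, Finset.card_union_of_disjoint d1]
    have k1 : koszul U (T \ U) = koszul S (T \ U) * koszul (U \ S) (T \ U) := by
      conv_lhs => rw [e3]
      rw [koszul_union_left _ d1, ← e3]
    have k2 : koszul S (T \ S) = koszul S (U \ S) * koszul S (T \ U) := by
      rw [e2, koszul_union_right _ d2]
    simp only [e1, k1, k2, e4, twist_add, map_zsmul, map_mul, smul_mul_assoc, mul_smul_comm, smul_smul, mul_assoc]
    congr 1
    ring

theorem mul_single_empty (a : A) (f : Gr 𝕜 A r) (T) : (f * (single ∅ a : Gr 𝕜 A r) : Gr 𝕜 A r) T = f T * twist 𝕜 T.card a := by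
  rw [mul_apply, Finset.sum_eq_single T]
  · simp [single, koszul_empty_right]
  · intro S hS hne
    have : T \ S ≠ ∅ := by
      rw [Ne, Finset.sdiff_eq_empty_iff_subset]
      exact fun h => hne (Finset.Subset.antisymm (Finset.mem_powerset.1 hS) h)
    simp [single, this]
  · simp

theorem single_empty_mul (a : A) (f : Gr 𝕜 A r) (T) : ((single ∅ a : Gr 𝕜 A r) * f : Gr 𝕜 A r) T = a * f T := by
  rw [mul_apply, Finset.sum_eq_single ∅]
  · simp [single, koszul_empty_left, twist_zero]
  · intro S hS hne
    simp [single, hne]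
  · simp

instance : Ring (Gr 𝕜 A r) :=
  { (inferInstance : AddCommGroup (Gr 𝕜 A r)) with
    mul := (· * ·)
    one := 1
    mul_assoc := mul_assoc_aux
    one_mul := fun f => by ext T; exact (single_empty_mul 1 f T).trans (one_mul _)
    mul_one := fun f => by ext T; exact (mul_single_empty 1 f T).trans (by simp)
    left_distrib := fun f g h => by
      ext T; simp only [mul_apply, add_apply, map_add, mul_add, smul_add, Finset.sum_add_distrib]
    right_distrib := fun f g h => by
      ext T; simp only [mul_apply, add_apply, add_mul, smul_add, Finset.sum_add_distrib]
    zero_mul := fun f => by ext T; simp [mul_apply, zero_apply]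
    mul_zero := fun f => by ext T; simp [mul_apply, zero_apply] }

instance : Algebra 𝕜 (Gr 𝕜 A r) :=
  Algebra.ofModule
    (fun c f g => by
      ext T
      simp only [mul_apply, smul_apply, Finset.smul_sum, smul_mul_assoc, smul_comm c])
    (fun c f g => by
      ext T
      simp only [mul_apply, smul_apply, Finset.smul_sum, map_smul, mul_smul_comm, smul_comm c])

theorem algebraMap_eq (c : 𝕜) : algebraMap 𝕜 (Gr 𝕜 A r) c = single ∅ (algebraMap 𝕜 A c) := by
  rw [Algebra.algebraMap_eq_smul_one]
  ext S
  rw [smul_apply, one_apply, single, Algebra.algebraMap_eq_smul_one]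
  split_ifs <;> simp

theorem sub_card {S T : Finset (Fin r)} (h : S ⊆ T) : T.card = S.card + (T \ S).card := by
  rw [← Finset.card_sdiff_add_card_eq_card h, add_comm]


/-- The grading automorphism of `A[θ_1, …, θ_r]`. -/
def conj (f : Gr 𝕜 A r) : Gr 𝕜 A r := fun S => (-1 : ℤ) ^ S.card • SuperAlgebra.parity (𝕜 := 𝕜) (f S)

theorem conj_apply (f : Gr 𝕜 A r) (S) :
    conj f S = (-1 : ℤ) ^ S.card • SuperAlgebra.parity (𝕜 := 𝕜) (f S) := rfl

theorem conj_mul (f g : Gr 𝕜 A r) : conj (f * g) = conj f * conj g := by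
  ext T
  simp only [conj_apply, mul_apply, map_sum, Finset.smul_sum]
  refine Finset.sum_congr rfl fun S hS => ?_
  simp only [sub_card (Finset.mem_powerset.1 hS), map_zsmul, map_mul, ← twist_one 𝕜,
    smul_mul_assoc, mul_smul_comm, smul_smul, twist_comm 𝕜 1]
  congr 1
  ring

theorem mul_of_homog {k : ℕ} {f : Gr 𝕜 A r}
    (h : ∀ S, SuperAlgebra.parity (𝕜 := 𝕜) (f S) = (-1 : ℤ) ^ (k + S.card) • f S)
    (g : Gr 𝕜 A r) :
    f * g = (show Gr 𝕜 A r from fun S => (-1 : ℤ) ^ (k * S.card) • twist 𝕜 k (g S)) * f := by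
  ext T
  simp only [mul_apply]
  refine Finset.sum_bij' (fun S _ => T \ S) (fun S _ => T \ S) ?_ ?_ ?_ ?_ ?_
  · intro S _; simp
  · intro S _; simp
  · intro S hS; simpa using Finset.mem_powerset.1 hS
  · intro S hS; simpa using Finset.mem_powerset.1 hS
  · intro S hS
    have e : T \ (T \ S) = S := by simpa using Finset.mem_powerset.1 hS
    rw [e, homog_mul 𝕜 (h S), twist_of_homog 𝕜 (h S), twist_add, twist_twist, koszul_swap Finset.disjoint_sdiff]
    simp only [smul_mul_assoc, mul_smul_comm, smul_smul]
    congr 1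
    have : (-1 : ℤ) ^ ((T \ S).card * (k + S.card)) * (-1) ^ (k * (T \ S).card)
        = (-1) ^ (S.card * (T \ S).card) := by
      rw [mul_add, pow_add, mul_comm k, mul_right_comm, ← pow_add, ← two_mul, pow_mul, mul_comm S.card]
      simp
    rw [← this]
    ring

instance : SuperAlgebra 𝕜 (Gr 𝕜 A r) where
  parity := AlgHom.ofLinearMap
    { toFun := conj
      map_add' := fun f g => by ext S; simp only [conj_apply, add_apply, map_add, smul_add]
      map_smul' := fun c f => by
        ext S; simp only [conj_apply, smul_apply, map_smul, smul_comm c, RingHom.id_apply] }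
    (by
      ext S
      change conj 1 S = _
      rw [conj_apply, one_apply]
      split_ifs with h <;> simp [h])
    conj_mul
  parity_parity := fun f => by
    ext S
    change conj (conj f) S = _
    simp only [conj_apply, map_zsmul, SuperAlgebra.parity_parity, smul_smul, ← mul_pow]
    simp
  even_mul := fun f g hf => by
    have h : ∀ S, SuperAlgebra.parity (𝕜 := 𝕜) (f S) = (-1 : ℤ) ^ (0 + S.card) • f S := fun S => by
      have := congrFun hf S
      change conj f S = _ at this
      rw [conj_apply] at this
      refine Eq.trans ?_ (congrArg ((-1 : ℤ) ^ (0 + S.card) • ·) this)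
      simp only [smul_smul, zero_add, ← mul_pow]
      simp
    rw [mul_of_homog h g]
    congr 1
    ext S
    simp [twist_zero]
  odd_mul := fun f g hf => by
    have h : ∀ S, SuperAlgebra.parity (𝕜 := 𝕜) (f S) = (-1 : ℤ) ^ (1 + S.card) • f S := fun S => by
      have := congrFun hf S
      change conj f S = - f S at this
      rw [conj_apply] at this
      rw [pow_add, mul_comm, mul_smul, pow_one, neg_one_zsmul]
      refine Eq.trans ?_ (congrArg ((-1 : ℤ) ^ S.card • ·) this)
      simp only [smul_smul, ← mul_pow]
      simp
    rw [mul_of_homog h g]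
    congr 1
    ext S
    change _ = conj g S
    rw [conj_apply, twist_one, one_mul]

end Gr

section
variable {𝕜 A : Type*} [CommRing 𝕜] [Ring A] [Algebra 𝕜 A]

/-- Power series in even variables: the grading is that of the coefficients. -/
instance [SuperAlgebra 𝕜 A] (ι : Type*) : SuperAlgebra 𝕜 (MvPowerSeries ι A) where
  parity :=
    { MvPowerSeries.map (SuperAlgebra.parity (𝕜 := 𝕜) : A →ₐ[𝕜] A).toRingHom with
      commutes' := fun c => by
        ext α
        classical
        change SuperAlgebra.parity (𝕜 := 𝕜) (MvPowerSeries.coeff α (algebraMap 𝕜 (MvPowerSeries ι A) c)) = _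
        rw [MvPowerSeries.algebraMap_apply, MvPowerSeries.coeff_C]
        split_ifs <;> simp }
  parity_parity := fun f => by
    ext α
    exact SuperAlgebra.parity_parity _
  even_mul := fun f g hf => by
    classical
    have h : ∀ α, SuperAlgebra.parity (𝕜 := 𝕜) (MvPowerSeries.coeff α f) = MvPowerSeries.coeff α f :=
      fun α => congrArg (MvPowerSeries.coeff α) hf
    ext α
    rw [MvPowerSeries.coeff_mul, MvPowerSeries.coeff_mul]
    refine Finset.sum_bij' (fun p _ => p.swap) (fun p _ => p.swap) ?_ ?_ ?_ ?_
      fun p _ => SuperAlgebra.even_mul _ _ (h _)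
    · intro p hp
      rw [Finset.HasAntidiagonal.mem_antidiagonal] at hp ⊢
      exact (add_comm _ _).trans hp
    · intro p hp
      rw [Finset.HasAntidiagonal.mem_antidiagonal] at hp ⊢
      exact (add_comm _ _).trans hp
    · intro p _
      rfl
    · intro p _
      rfl
  odd_mul := fun f g hf => by
    classical
    have h : ∀ α, SuperAlgebra.parity (𝕜 := 𝕜) (MvPowerSeries.coeff α f) = -MvPowerSeries.coeff α f :=
      fun α => congrArg (MvPowerSeries.coeff α) hf
    ext α
    rw [MvPowerSeries.coeff_mul, MvPowerSeries.coeff_mul]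
    refine Finset.sum_bij' (fun p _ => p.swap) (fun p _ => p.swap) ?_ ?_ ?_ ?_
      fun p _ => SuperAlgebra.odd_mul _ _ (h _)
    · intro p hp
      rw [Finset.HasAntidiagonal.mem_antidiagonal] at hp ⊢
      exact (add_comm _ _).trans hp
    · intro p hp
      rw [Finset.HasAntidiagonal.mem_antidiagonal] at hp ⊢
      exact (add_comm _ _).trans hp
    · intro p _
      rfl
    · intro p _
      rfl

end

/-- A commutative algebra, placed in even degree. -/
@[reducible] def SuperAlgebra.purelyEven (𝕜 A : Type*) [CommRing 𝕜] [CommRing A] [Algebra 𝕜 A] : SuperAlgebra 𝕜 A where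
  parity := AlgHom.id 𝕜 A
  parity_parity := fun _ => rfl
  even_mul := fun a b _ => mul_comm a b
  odd_mul := fun a b _ => mul_comm a b


instance {𝕜 : Type*} [CommRing 𝕜] : SuperAlgebra 𝕜 𝕜 := SuperAlgebra.purelyEven 𝕜 𝕜

/-! ### Homogeneous elements and superderivations -/

section
variable (𝕜 : Type*) {A : Type*} [CommRing 𝕜] [Ring A] [Algebra 𝕜 A] [SuperAlgebra 𝕜 A]

/-- `a` is homogeneous of parity `i`. -/
def HasParity (i : ZMod 2) (a : A) : Prop := SuperAlgebra.parity (𝕜 := 𝕜) a = (-1 : ℤ) ^ i.val • a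

variable (A) in
/-- Superderivations of parity `i`: `|D a| = i + |a|` and `D (a b) = D a b + (-1)^(i|a|) a D b`. For
`A = O(U)` these are the homogeneous vector fields on `U`. -/
def superDer (i : ZMod 2) : Submodule 𝕜 (Module.End 𝕜 A) where
  carrier := {D | (∀ a, SuperAlgebra.parity (𝕜 := 𝕜) (D a) = (-1 : ℤ) ^ i.val • D (SuperAlgebra.parity (𝕜 := 𝕜) a)) ∧
    ∀ a b, D (a * b) = D a * b + twist 𝕜 i.val a * D b}
  add_mem' := by
    rintro D E ⟨hD, hD'⟩ ⟨hE, hE'⟩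
    refine ⟨fun a => by simp only [LinearMap.add_apply, map_add, hD, hE, smul_add], fun a b => ?_⟩
    simp only [LinearMap.add_apply, hD', hE', add_mul, mul_add]
    abel
  zero_mem' := by constructor <;> simp
  smul_mem' := by
    rintro c D ⟨hD, hD'⟩
    refine ⟨fun a => by simp only [LinearMap.smul_apply, map_smul, hD, smul_comm c], fun a b => ?_⟩
    simp only [LinearMap.smul_apply, hD', smul_add, smul_mul_assoc, mul_smul_comm]

theorem neg_one_pow_val_add (i j : ZMod 2) : (-1 : ℤ) ^ (i + j).val = (-1) ^ i.val * (-1) ^ j.val := by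
  revert i j; decide

theorem twist_val_add (i j : ZMod 2) (a : A) : twist 𝕜 (i + j).val a = twist 𝕜 i.val (twist 𝕜 j.val a) := by
  rw [← twist_add]
  have : ∀ i j : ZMod 2, (i + j).val = i.val + j.val ∨ ((i + j).val = 0 ∧ i.val + j.val = 1 + 1) := by decide
  rcases this i j with h | ⟨h, h'⟩
  · rw [h]
  · rw [h, h', twist_add, twist_twist, twist_zero]

variable {𝕜}

/-- The superderivation `f X`. -/
def smulDer {k i : ZMod 2} (f : A) (hf : HasParity 𝕜 k f) (X : superDer 𝕜 A i) : superDer 𝕜 A (k + i) :=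
  ⟨LinearMap.mulLeft 𝕜 f ∘ₗ X.1, by
    refine ⟨fun a => ?_, fun a b => ?_⟩
    · simp only [LinearMap.comp_apply, LinearMap.mulLeft_apply, map_mul, X.2.1 a]
      rw [show SuperAlgebra.parity (𝕜 := 𝕜) f = _ from hf, neg_one_pow_val_add]
      simp only [smul_mul_assoc, mul_smul_comm, smul_smul, mul_comm]
    · simp only [LinearMap.comp_apply, LinearMap.mulLeft_apply, X.2.2 a b, mul_add, twist_val_add]
      have e : f * (twist 𝕜 i.val a * X.1 b) = twist 𝕜 k.val (twist 𝕜 i.val a) * (f * X.1 b) := by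
        rw [← mul_assoc, homog_mul 𝕜 hf, mul_assoc]
      rw [e, mul_assoc]⟩

/-- The supercommutator `[X, Y] = X Y - (-1)^(|X||Y|) Y X`. -/
def superBracket {i j : ZMod 2} (X : superDer 𝕜 A i) (Y : superDer 𝕜 A j) : superDer 𝕜 A (i + j) :=
  ⟨X.1 ∘ₗ Y.1 - (-1 : ℤ) ^ (i.val * j.val) • (Y.1 ∘ₗ X.1), by
    have key : ∀ {i j : ZMod 2} (X : superDer 𝕜 A i) (a : A),
        X.1 (twist 𝕜 j.val a) = (-1 : ℤ) ^ (i.val * j.val) • twist 𝕜 j.val (X.1 a) := by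
      intro i j X a
      have h : j = 0 ∨ j = 1 := by revert j; decide
      rcases h with rfl | rfl
      · simp [twist_zero]
      · rw [show (1 : ZMod 2).val = 1 from rfl, twist_one, twist_one, X.2.1 a, smul_smul, mul_one, ← mul_pow]
        simp
    refine ⟨fun a => ?_, fun a b => ?_⟩
    · simp only [LinearMap.sub_apply, LinearMap.comp_apply, LinearMap.smul_apply, map_sub, map_zsmul,
        X.2.1, Y.2.1, neg_one_pow_val_add, smul_sub, smul_smul]
      congr 2 <;> ring
    · simp only [LinearMap.sub_apply, LinearMap.comp_apply, LinearMap.smul_apply, X.2.2, Y.2.2, map_add,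
        key, twist_val_add, sub_mul, mul_sub, smul_add, smul_mul_assoc, mul_smul_comm, smul_smul]
      have e : (-1 : ℤ) ^ (i.val * j.val) * (-1 : ℤ) ^ (j.val * i.val) = 1 := by
        rw [mul_comm j.val, ← mul_pow]; simp
      rw [e, one_smul, twist_comm 𝕜 j.val i.val a]
      abel⟩

end

/-! ### Superspaces, charts, two-forms -/

section
universe u v w

/-- A space with a sheaf of supercommutative `𝕜`-superalgebras. -/
structure SuperSpace (𝕜 : Type u) [RCLike 𝕜] (X : Type v) [TopologicalSpace X] where
  O : Opens X → Type w
  [ring : ∀ U, Ring (O U)]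
  [algebra : ∀ U, Algebra 𝕜 (O U)]
  [super : ∀ U, SuperAlgebra 𝕜 (O U)]
  res : ∀ {U V : Opens X}, V ≤ U → O U →ₐ[𝕜] O V
  res_parity : ∀ {U V : Opens X} (h : V ≤ U) (f : O U),
    res h (SuperAlgebra.parity (𝕜 := 𝕜) f) = SuperAlgebra.parity (𝕜 := 𝕜) (res h f)
  res_self : ∀ {U : Opens X} (f : O U), res le_rfl f = f
  res_res : ∀ {U V W : Opens X} (h : V ≤ U) (h' : W ≤ V) (f : O U),
    res h' (res h f) = res (h'.trans h) f
  glue : ∀ (𝒰 : Set (Opens X)) (f : ∀ V ∈ 𝒰, O V),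
    (∀ V (hV : V ∈ 𝒰) W (hW : W ∈ 𝒰),
      res (inf_le_left : V ⊓ W ≤ V) (f V hV) = res (inf_le_right : V ⊓ W ≤ W) (f W hW)) →
    ∃! s : O (sSup 𝒰), ∀ V (hV : V ∈ 𝒰), res (le_sSup hV) s = f V hV

attribute [instance] SuperSpace.ring SuperSpace.algebra SuperSpace.super

/-- The algebra of smooth `𝕜`-valued functions on an open subset of `ℝ^ι`. -/
def smoothFun (𝕜 : Type*) [RCLike 𝕜] {ι : Type*} [Fintype ι] (V : Opens (ι → ℝ)) : Subalgebra 𝕜 (V → 𝕜) where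
  carrier := {f | ∃ F : (ι → ℝ) → 𝕜, ContDiffOn ℝ (⊤ : ℕ∞) F V ∧ ∀ x : V, f x = F x}
  mul_mem' := by
    rintro f g ⟨F, hF, hf⟩ ⟨G, hG, hg⟩
    exact ⟨fun x => F x * G x, hF.mul hG, fun x => by simp [hf, hg]⟩
  add_mem' := by
    rintro f g ⟨F, hF, hf⟩ ⟨G, hG, hg⟩
    exact ⟨fun x => F x + G x, hF.add hG, fun x => by simp [hf, hg]⟩
  algebraMap_mem' := fun c => ⟨fun _ => c, contDiffOn_const, fun _ => rfl⟩

instance (𝕜 : Type*) [RCLike 𝕜] {ι : Type*} [Fintype ι] (V : Opens (ι → ℝ)) :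
    SuperAlgebra 𝕜 (smoothFun 𝕜 V) := SuperAlgebra.purelyEven 𝕜 _

/-- The coordinate functions of `ℝ^ι`. -/
def coordFun (𝕜 : Type*) [RCLike 𝕜] {ι : Type*} [Fintype ι] (V : Opens (ι → ℝ)) (i : ι) : smoothFun 𝕜 V :=
  ⟨fun x => ((x.1 i : ℝ) : 𝕜), fun x => ((x i : ℝ) : 𝕜),
    ((RCLike.ofRealCLM (K := 𝕜)).contDiff.comp (contDiff_apply ℝ ℝ i)).contDiffOn, fun _ => rfl⟩

namespace SuperSpace
variable {𝕜 : Type u} [RCLike 𝕜] {X : Type v} [TopologicalSpace X]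

/-- A chart of dimension `|ι| | r`: a homeomorphism `body` of an open set with an open subset of `ℝ^ι`, and
over it an isomorphism of the structure sheaf with `C^∞ ⊗ Λ[θ_1, …, θ_r]`. -/
structure Chart (M : SuperSpace.{u, v, w} 𝕜 X) (ι : Type) [Fintype ι] (r : ℕ) where
  body : OpenPartialHomeomorph X (ι → ℝ)
  iso : ∀ (W : Opens X) (hW : (W : Set X) ⊆ body.source),
    M.O W ≃ₐ[𝕜] Gr 𝕜 (smoothFun 𝕜 ⟨body '' W, body.isOpen_image_of_subset_source W.2 hW⟩) r
  iso_parity : ∀ W hW f,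
    iso W hW (SuperAlgebra.parity (𝕜 := 𝕜) f) = SuperAlgebra.parity (𝕜 := 𝕜) (iso W hW f)
  iso_res : ∀ (W : Opens X) (hW : (W : Set X) ⊆ body.source) (W' : Opens X) (h : W' ≤ W) (f : M.O W)
    (S : Finset (Fin r)) (x : X) (hx : x ∈ W'),
    (iso W' (Set.Subset.trans h hW) (M.res h f) S).1 ⟨body x, Set.mem_image_of_mem body hx⟩ =
      (iso W hW f S).1 ⟨body x, Set.mem_image_of_mem body (h hx)⟩

/-- The coordinates of a chart, as even and odd sections of the structure sheaf. -/
def Chart.coord {M : SuperSpace.{u, v, w} 𝕜 X} {ι : Type} [Fintype ι] {r : ℕ} (c : M.Chart ι r)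
    (W : Opens X) (hW : (W : Set X) ⊆ c.body.source) : ι ⊕ Fin r → M.O W
  | .inl i => (c.iso W hW).symm (Gr.single ∅ (coordFun 𝕜 _ i))
  | .inr j => (c.iso W hW).symm (Gr.single {j} 1)

/-- An even 2-form: on each open set an `O`-bilinear, super-skew-symmetric, even pairing of vector fields,
compatible with restriction. The conventions are `w (f X, Y) = f w (X, Y)` and
`w (X, Y) = -(-1)^(|X||Y|) w (Y, X)`. -/
structure EvenTwoForm (M : SuperSpace.{u, v, w} 𝕜 X) where
  ev : ∀ (U : Opens X) (i j : ZMod 2),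
    superDer 𝕜 (M.O U) i →ₗ[𝕜] superDer 𝕜 (M.O U) j →ₗ[𝕜] M.O U
  parity_ev : ∀ U i j X Y, HasParity 𝕜 (i + j) (ev U i j X Y)
  skew : ∀ U i j X Y, ev U i j X Y = -((-1 : ℤ) ^ (i.val * j.val) • ev U j i Y X)
  smul_ev : ∀ U k i j (f : M.O U) (hf : HasParity 𝕜 k f) X Y,
    ev U (k + i) j (smulDer f hf X) Y = f * ev U i j X Y
  res_ev : ∀ (U V : Opens X) (h : V ≤ U) i j (X : superDer 𝕜 (M.O U) i) (Y : superDer 𝕜 (M.O U) j)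
    (X' : superDer 𝕜 (M.O V) i) (Y' : superDer 𝕜 (M.O V) j),
    (∀ f, X'.1 (M.res h f) = M.res h (X.1 f)) → (∀ f, Y'.1 (M.res h f) = M.res h (Y.1 f)) →
    ev V i j X' Y' = M.res h (ev U i j X Y)

namespace EvenTwoForm
variable {M : SuperSpace.{u, v, w} 𝕜 X}

/-- `dw = 0`, evaluated on homogeneous vector fields by the super version of Cartan's formula. -/
def IsClosed (w₂ : M.EvenTwoForm) : Prop :=
  ∀ U i j k (X : superDer 𝕜 (M.O U) i) (Y : superDer 𝕜 (M.O U) j) (Z : superDer 𝕜 (M.O U) k),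
    (-1 : ℤ) ^ (i.val * k.val) • (X.1 (w₂.ev U j k Y Z) - w₂.ev U (i + j) k (superBracket X Y) Z) +
    (-1 : ℤ) ^ (j.val * i.val) • (Y.1 (w₂.ev U k i Z X) - w₂.ev U (j + k) i (superBracket Y Z) X) +
    (-1 : ℤ) ^ (k.val * j.val) • (Z.1 (w₂.ev U i j X Y) - w₂.ev U (k + i) j (superBracket Z X) Y) = 0

/-- `Z ↦ w (-, Z)` is an isomorphism from vector fields to 1-forms over every open set. -/
def IsNondegenerate (w₂ : M.EvenTwoForm) : Prop :=
  ∀ U (j : ZMod 2) (l : ∀ i : ZMod 2, superDer 𝕜 (M.O U) i →ₗ[𝕜] M.O U),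
    (∀ i X, HasParity 𝕜 (i + j) (l i X)) →
    (∀ k i (f : M.O U) (hf : HasParity 𝕜 k f) X, l (k + i) (smulDer f hf X) = f * l i X) →
    ∃! Z : superDer 𝕜 (M.O U) j, ∀ i X, w₂.ev U i j X Z = l i X

/-- `Z` is the Hamiltonian vector field of `f`. The Poisson bracket is `{f, g} = Z g`; with these
conventions `{p_i, q_i} = 1` and `{θ_i, θ_i} = ε_i` in Darboux coordinates. -/
def IsHamiltonian (w₂ : M.EvenTwoForm) {U : Opens X} {j : ZMod 2} (f : M.O U) (Z : superDer 𝕜 (M.O U) j) : Prop :=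
  ∀ i (Y : superDer 𝕜 (M.O U) i), w₂.ev U i j Y Z = Y.1 f

end EvenTwoForm
end SuperSpace

/-- The signs `ε_j` of the quadratic form of signature `(a, b)`. -/
def quadSign (a b : ℕ) (j : Fin (a + b)) : ℤ := if j.val < a then 1 else -1

/-- The matrix of the form `∑ dp_i ∧ dq_i + ∑ (ε_j / 2) (dθ_j)²` in the coordinates `p`, `q`, `θ`. -/
def standardForm (n a b : ℕ) : ((Fin n ⊕ Fin n) ⊕ Fin (a + b)) → ((Fin n ⊕ Fin n) ⊕ Fin (a + b)) → ℤ
  | .inl (.inl i), .inl (.inr j) => if i = j then 1 else 0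
  | .inl (.inr i), .inl (.inl j) => if i = j then -1 else 0
  | .inr i, .inr j => if i = j then quadSign a b i else 0
  | _, _ => 0

/-- The parity of a coordinate, and of the coordinate vector field. -/
def coordParity {ι : Type} {r : ℕ} : ι ⊕ Fin r → ZMod 2
  | .inl _ => 0
  | .inr _ => 1

/-- In this chart the 2-form is the standard one: its values on the coordinate vector fields `∂_k`, `∂_l`
are the entries of `standardForm`. -/
def SuperSpace.Chart.IsDarboux {𝕜 : Type u} [RCLike 𝕜] {X : Type v} [TopologicalSpace X]
    {M : SuperSpace.{u, v, w} 𝕜 X} {n a b : ℕ} (c : M.Chart (Fin n ⊕ Fin n) (a + b)) (w₂ : M.EvenTwoForm) : Prop :=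
  ∀ (W : Opens X) (hW : (W : Set X) ⊆ c.body.source) (k l : (Fin n ⊕ Fin n) ⊕ Fin (a + b))
    (D : superDer 𝕜 (M.O W) (coordParity k)) (E : superDer 𝕜 (M.O W) (coordParity l)),
    (∀ m, D.1 (c.coord W hW m) = if m = k then 1 else 0) →
    (∀ m, E.1 (c.coord W hW m) = if m = l then 1 else 0) →
    w₂.ev W _ _ D E = (standardForm n a b k l : M.O W)

/-- A symplectic supermanifold of type `(2n | a, b)` on the space `X`: a supermanifold of dimension
`2n | a + b` with an even, closed, nondegenerate 2-form that is locally isomorphic to the standard one. -/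
structure SymplecticSupermanifold (𝕜 : Type u) [RCLike 𝕜] (n a b : ℕ) (X : Type v) [TopologicalSpace X]
    extends SuperSpace.{u, v, w} 𝕜 X where
  form : toSuperSpace.EvenTwoForm
  closed : form.IsClosed
  nondegenerate : form.IsNondegenerate
  darboux : ∀ x : X, ∃ c : toSuperSpace.Chart (Fin n ⊕ Fin n) (a + b),
    x ∈ c.body.source ∧ c.IsDarboux form

/-! ### The formal superdisk -/

/-- `A ⊗̂ 𝕜[[p, q, θ]]`: formal power series with coefficients in `A` (on the left) in the even variables
`p_i` (`inl i`), `q_i` (`inr i`) and the odd variables `θ_1, …, θ_r`. -/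
abbrev FormalFun (𝕜 A : Type*) (n r : ℕ) : Type _ := Gr 𝕜 (MvPowerSeries (Fin n ⊕ Fin n) A) r

namespace FormalFun
variable {𝕜 A : Type*} [CommRing 𝕜] [Ring A] [Algebra 𝕜 A] {n r : ℕ}

/-- The coefficient of `(p, q)^α θ^S`. -/
def coeff (S : Finset (Fin r)) (α : (Fin n ⊕ Fin n) →₀ ℕ) (f : FormalFun 𝕜 A n r) : A :=
  MvPowerSeries.coeff α (f S)

/-- Constants. -/
def const (c : A) : FormalFun 𝕜 A n r := Gr.single ∅ (MvPowerSeries.C c)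

/-- The partial derivative in an even variable. -/
def dEven (i : Fin n ⊕ Fin n) (f : FormalFun 𝕜 A n r) : FormalFun 𝕜 A n r :=
  fun S α => (α i + 1) • coeff S (α + Finsupp.single i 1) f

/-- The (left) partial derivative in an odd variable. -/
def dOdd [SuperAlgebra 𝕜 A] (j : Fin r) (f : FormalFun 𝕜 A n r) : FormalFun 𝕜 A n r :=
  fun S => if j ∈ S then 0 else koszul {j} S • SuperAlgebra.parity (𝕜 := 𝕜) (f (insert j S))

/-- The `A`-linear Poisson superbracket with `{p_i, q_i} = 1`, `{θ_j, θ_j} = ε_j`, and all other brackets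
of variables zero. -/
def bracket [SuperAlgebra 𝕜 A] (a b : ℕ) (f g : FormalFun 𝕜 A n (a + b)) : FormalFun 𝕜 A n (a + b) :=
  ∑ i : Fin n, (dEven (.inl i) f * dEven (.inr i) g - dEven (.inr i) f * dEven (.inl i) g) -
    ∑ j : Fin (a + b), quadSign a b j • (dOdd j (SuperAlgebra.parity (𝕜 := 𝕜) f) * dOdd j g)

/-- The `k`-th power of the ideal generated by the variables. -/
def filtration (k : ℕ) : Set (FormalFun 𝕜 A n r) :=
  {f | ∀ S α, α.degree + S.card < k → coeff S α f = 0}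

/-- Linear combinations of the variables. -/
def linearFun : Set (FormalFun 𝕜 A n r) :=
  {f | ∀ S α, α.degree + S.card ≠ 1 → coeff S α f = 0}

end FormalFun

section
variable (𝕜 A : Type*) [CommRing 𝕜] [Ring A] [Algebra 𝕜 A] [SuperAlgebra 𝕜 A] (n a b : ℕ)

/-- The group of `A`-points of `Aut_{2n | a, b}`: even, `A`-linear, filtration preserving automorphisms of
the Poisson superalgebra `A ⊗̂ 𝕜[[p, q, θ]]`. For `A = 𝕜` these are the filtration preserving automorphisms
of the Poisson superalgebra of formal functions. -/
def formalAut : Subgroup (FormalFun 𝕜 A n (a + b) ≃ₐ[𝕜] FormalFun 𝕜 A n (a + b)) where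
  carrier := {φ | (∀ c : A, φ (FormalFun.const c) = FormalFun.const c) ∧
    (∀ f, φ (SuperAlgebra.parity (𝕜 := 𝕜) f) = SuperAlgebra.parity (𝕜 := 𝕜) (φ f)) ∧
    (∀ f g, φ (FormalFun.bracket a b f g) = FormalFun.bracket a b (φ f) (φ g)) ∧
    ∀ k f, φ f ∈ FormalFun.filtration k ↔ f ∈ FormalFun.filtration k}
  mul_mem' := by
    rintro φ ψ ⟨h1, h2, h3, h4⟩ ⟨k1, k2, k3, k4⟩
    refine ⟨fun c => ?_, fun f => ?_, fun f g => ?_, fun k f => ?_⟩ <;> simp only [AlgEquiv.mul_apply]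
    · rw [k1, h1]
    · rw [k2, h2]
    · rw [k3, h3]
    · rw [h4, k4]
  one_mem' := ⟨fun _ => rfl, fun _ => rfl, fun _ _ => rfl, fun _ _ => Iff.rfl⟩
  inv_mem' := by
    rintro φ ⟨h1, h2, h3, h4⟩
    have e : ∀ f, φ (φ⁻¹ f) = f := fun f => φ.apply_symm_apply f
    refine ⟨fun c => ?_, fun f => ?_, fun f g => ?_, fun k f => ?_⟩
    · apply φ.injective; rw [e, h1]
    · apply φ.injective; rw [e, h2, e]
    · apply φ.injective; rw [e, h3, e, e]
    · rw [← h4, e]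

/-- The group of `A`-points of `Sp(2n | a, b)`: the linear symplectic automorphisms. -/
def linearAut : Subgroup (formalAut 𝕜 A n a b) where
  carrier := {φ | ∀ f, φ.1 f ∈ FormalFun.linearFun ↔ f ∈ FormalFun.linearFun}
  mul_mem' := fun {φ ψ} hφ hψ f => (hφ (ψ.1 f)).trans (hψ f)
  one_mem' := fun _ => Iff.rfl
  inv_mem' := fun {φ} hφ f => by
    rw [← hφ]
    exact Iff.of_eq (congrArg (· ∈ FormalFun.linearFun) (φ.1.apply_symm_apply f))

/-- The inverse limit topology: coefficientwise convergence of `φ f` for each `f`. -/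
instance [TopologicalSpace A] : TopologicalSpace (formalAut 𝕜 A n a b) :=
  TopologicalSpace.induced
    (fun φ (p : FormalFun 𝕜 A n (a + b) × Finset (Fin (a + b)) × ((Fin n ⊕ Fin n) →₀ ℕ)) =>
      FormalFun.coeff p.2.1 p.2.2 (φ.1 p.1)) inferInstance

end

/-! ### Formal exponentials -/

namespace SuperSpace
variable {𝕜 : Type u} [RCLike 𝕜] {X : Type v} [TopologicalSpace X]

/-- The functions on `V` that vanish at `x` (for a supermanifold and `x ∈ V`). -/
def vanishing (M : SuperSpace.{u, v, w} 𝕜 X) (V : Opens X) (x : X) : Submodule 𝕜 (M.O V) :=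
  Submodule.span 𝕜 {f | ∀ (W : Opens X) (h : W ≤ V), x ∈ W → ¬ IsUnit (M.res h f)}

end SuperSpace

namespace SymplecticSupermanifold
variable {𝕜 : Type u} [RCLike 𝕜] {X : Type v} [TopologicalSpace X] {n a b : ℕ}

/-- A section over `U` of the bundle `M^coor` of formal symplectic coordinate systems, as a morphism
`U × D̂ → M` that restricts to the inclusion `U → M` on the zero section (`map`, `coeff_zero`), that is, a map
of sheaves of superalgebras `O → O[[p, q, θ]]` over `U`. It has to respect the Poisson brackets, the one on
`O[[p, q, θ]]` being `O`-linear, and to be an isomorphism from the formal neighbourhood of each point `x` of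
`U` to the formal disk, `O(V)/m_x^(k+1) ≅ 𝕜[[p, q, θ]]/(p, q, θ)^(k+1)` for all `k`. -/
structure FormalCoordinates (M : SymplecticSupermanifold.{u, v, w} 𝕜 n a b X) (U : Opens X) where
  map : ∀ V ≤ U, M.O V →ₐ[𝕜] FormalFun 𝕜 (M.O V) n (a + b)
  map_parity : ∀ V hV f,
    map V hV (SuperAlgebra.parity (𝕜 := 𝕜) f) = SuperAlgebra.parity (𝕜 := 𝕜) (map V hV f)
  map_res : ∀ V hV V' (h : V' ≤ V) f S α,
    FormalFun.coeff S α (map V' (h.trans hV) (M.res h f)) = M.res h (FormalFun.coeff S α (map V hV f))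
  coeff_zero : ∀ V hV f, FormalFun.coeff ∅ 0 (map V hV f) = f
  map_bracket : ∀ V hV (j : ZMod 2) (f g : M.O V) (Z : superDer 𝕜 (M.O V) j), M.form.IsHamiltonian f Z →
    map V hV (Z.1 g) = FormalFun.bracket a b (map V hV f) (map V hV g)
  formal_injective : ∀ V hV, ∀ x ∈ V, ∀ k : ℕ, ∀ f : M.O V,
    (∀ S α, α.degree + S.card < k + 1 → FormalFun.coeff S α (map V hV f) ∈ M.vanishing V x) →
    f ∈ M.vanishing V x ^ (k + 1)
  formal_surjective : ∀ V hV, ∀ x ∈ V, ∀ k : ℕ, ∀ g : FormalFun 𝕜 𝕜 n (a + b), ∃ f : M.O V,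
    ∀ S α, α.degree + S.card < k + 1 →
      FormalFun.coeff S α (map V hV f) - algebraMap 𝕜 (M.O V) (FormalFun.coeff S α g) ∈ M.vanishing V x

/-- A formal exponential: a section over all of `M` of the quotient bundle `M^coor / Sp(2n | a, b)`. It is given
by local sections of `M^coor` on an open cover, any two of which differ, wherever both are defined, by a section
of `Sp(2n | a, b)`, which acts by post-composition. -/
structure FormalExponential (M : SymplecticSupermanifold.{u, v, w} 𝕜 n a b X) where
  nhd : X → Opens X
  mem_nhd : ∀ x, x ∈ nhd x
  coords : ∀ x, M.FormalCoordinates (nhd x)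
  compatible : ∀ x y V (hx : V ≤ nhd x) (hy : V ≤ nhd y), ∃ g ∈ linearAut 𝕜 (M.O V) n a b,
    ∀ f, (coords y).map V hy f = g.1 ((coords x).map V hx f)

end SymplecticSupermanifold
end

end SuperGeom

end

set_option linter.unusedSectionVars false
set_option linter.unusedVariables false
-- Coefficients, monomials and the filtration of formal functions
noncomputable section
namespace SuperGeom

/-! Contractibility is the Alexander trick. Conjugation of an automorphism `φ` by the homothety `t`
multiplies by `t^m` the part of `φ` that raises degrees by `m`. As `φ` preserves the filtration,
only `m ≥ 0` occurs, so the conjugate, `contract t φ`, makes sense for every even `t`, invertible or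
not: it is `φ` at `t = 1` and the linear part of `φ` at `t = 0`. The homothety changes the bracket
only by a constant factor, so the whole family is symplectic. For general `t` the identities are
checked on homogeneous components and extended by continuity (`contract_comp`, `contract_mul`,
`contract_bracket`). Contraction is compatible with composition and fixes every element of `Sp`
(`contractAut_mul`, `contractAut_of_linear`), so it descends to `Aut / Sp` and contracts it to the
base point. Every coefficient is a finite sum of powers of `t` times coefficients of values of `φ`,
which gives continuity over any topological `A`. It also allows `t` to be a function on an open set.

The second use of the trick is to patch sections. On a Darboux chart, Taylor expansion along the
coordinate vector fields is a section of `M^coor`. Two Darboux charts yield frames with the same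
Poisson bracket, because both brackets are computed by the intrinsic Hamiltonian vector fields
(`ham_eq`); hence their expansions differ by a section `CoordFrame.transAut` of the automorphism
group. Suppose that a section of `M^coor / Sp` is given by local representatives, and take a further
Darboux chart with a cutoff function `t`. The transformation from a given representative to the
chart is contracted with parameter `t` (`LocalCoords.combine`). Where `t = 1` the outcome is the
chart's own expansion, where `t = 0` it is the old representative up to `Sp`, and throughout it does
not depend on the representative chosen modulo `Sp` (`LocalCoords.combine_of_rel`). For a locally
finite sequence of cutoff functions these modifications stabilize near each point and produce a
global section.

What remains is that Taylor expansions behave as they should. Their algebraic identities all come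
from one uniqueness principle, `eq_zero_of_frame`: if a set of formal functions is closed under the
coordinate derivatives and all its constant terms vanish, it is zero. So multiplicativity,
naturality and the passage between frames are proved by differentiating the defect. That the
expansions are isomorphisms on formal neighbourhoods rests on Hadamard's lemma and on the Euler
vector field, which acts on `m^(k+1) / m^(k+2)` as multiplication by `k + 1` (`euler_sub_mem`). -/

theorem Gr.single_apply {𝕜 A : Type*} [CommRing 𝕜] [Ring A] [Algebra 𝕜 A] {r : ℕ} (S T : Finset (Fin r)) (a : A) :
    (Gr.single S a : Gr 𝕜 A r) T = if T = S then a else 0 := rfl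

section
variable {𝕜 A : Type*} [CommRing 𝕜] [Ring A] [Algebra 𝕜 A] [SuperAlgebra 𝕜 A]

theorem coeff_twist {ι : Type*} (k : ℕ) (α : ι →₀ ℕ) (F : MvPowerSeries ι A) :
    MvPowerSeries.coeff α (twist 𝕜 k F) = twist 𝕜 k (MvPowerSeries.coeff α F) := by
  induction k generalizing F with
  | zero => simp [twist_zero]
  | succ k ih =>
    rw [twist_add, twist_add, ih, twist_one, twist_one]
    rfl

theorem Gr.parity_apply {r : ℕ} (f : Gr 𝕜 A r) (S : Finset (Fin r)) :
    SuperAlgebra.parity (𝕜 := 𝕜) f S = (-1 : ℤ) ^ S.card • SuperAlgebra.parity (𝕜 := 𝕜) (f S) := rfl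

theorem Gr.sum_apply {r : ℕ} {ι : Type*} (s : Finset ι) (f : ι → Gr 𝕜 A r) (S : Finset (Fin r)) :
    (∑ i ∈ s, f i) S = ∑ i ∈ s, f i S := by
  classical
  induction s using Finset.induction_on with
  | empty => rfl
  | insert i s hi ih => rw [Finset.sum_insert hi, Finset.sum_insert hi, Gr.add_apply, ih]

theorem Gr.sub_apply {r : ℕ} (f g : Gr 𝕜 A r) (S : Finset (Fin r)) : (f - g) S = f S - g S := rfl

theorem Gr.zsmul_apply {r : ℕ} (m : ℤ) (f : Gr 𝕜 A r) (S : Finset (Fin r)) : (m • f) S = m • f S := rfl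

theorem Gr.eq_sum_single {r : ℕ} (f : Gr 𝕜 A r) : f = ∑ S, Gr.single S (f S) := by
  ext T
  rw [Gr.sum_apply, Finset.sum_eq_single T]
  · simp [Gr.single_apply]
  · intro S _ h
    simp [Gr.single_apply, h.symm]
  · simp

theorem Gr.single_mul_single {r : ℕ} (S T : Finset (Fin r)) (a b : A) :
    (Gr.single S a : Gr 𝕜 A r) * Gr.single T b =
      if Disjoint S T then koszul S T • Gr.single (S ∪ T) (a * twist 𝕜 S.card b) else 0 := by
  ext U
  rw [Gr.mul_apply]
  split_ifs with h
  · rw [Gr.zsmul_apply, Gr.single_apply]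
    by_cases hU : U = S ∪ T
    · subst hU
      rw [Finset.sum_eq_single S]
      · simp [Gr.single_apply, Finset.union_sdiff_cancel_left h]
      · intro S' _ hS'
        simp [Gr.single_apply, hS']
      · intro h'
        exact absurd (Finset.mem_powerset.2 Finset.subset_union_left) h'
    · rw [if_neg hU, smul_zero]
      refine Finset.sum_eq_zero fun S' hS' => ?_
      by_cases h1 : S' = S
      · subst h1
        have h2 : U \ S' ≠ T := by
          rintro rfl
          exact hU (Finset.union_sdiff_of_subset (Finset.mem_powerset.1 hS')).symm
        simp [Gr.single_apply, h2]
      · simp [Gr.single_apply, h1]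
  · rw [Gr.zero_apply]
    refine Finset.sum_eq_zero fun S' hS' => ?_
    by_cases h1 : S' = S
    · subst h1
      have h2 : U \ S' ≠ T := by
        rintro rfl
        exact h Finset.disjoint_sdiff
      simp [Gr.single_apply, h2]
    · simp [Gr.single_apply, h1]

theorem koszul_eq_one_of_lt {r : ℕ} {j : Fin r} {S : Finset (Fin r)} (h : ∀ i ∈ S, j < i) : koszul {j} S = 1 := by
  unfold koszul
  rw [Finset.card_eq_zero.2, pow_zero]
  rw [Finset.filter_eq_empty_iff]
  rintro ⟨a, b⟩ hp
  simp only [Finset.mem_product, Finset.mem_singleton] at hp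
  simpa [hp.1] using (h b hp.2).le

theorem koszul_singleton_of_lt {r : ℕ} {i j : Fin r} (h : i < j) : koszul {j} {i} = -1 := by
  simp [koszul, Finset.filter_singleton, h]

theorem Gr.single_insert {r : ℕ} {j : Fin r} {S : Finset (Fin r)} (h : ∀ i ∈ S, j < i) (a : A) :
    (Gr.single {j} 1 : Gr 𝕜 A r) * Gr.single S a = Gr.single (insert j S) (SuperAlgebra.parity (𝕜 := 𝕜) a) := by
  rw [Gr.single_mul_single, if_pos, koszul_eq_one_of_lt h, one_smul, one_mul, Finset.card_singleton, twist_one]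
  · rfl
  · rw [Finset.disjoint_singleton_left]
    exact fun hj => lt_irrefl _ (h j hj)

/-- Splitting off the smallest odd variable costs no Koszul sign, whence the induction on the
minimum. The coefficient picks up a parity each time it passes an odd variable, so the hypothesis
has to cover all its twists. -/
theorem Gr.single_mem_of_mem {r : ℕ} (R : Subring (Gr 𝕜 A r)) (hodd : ∀ j, (Gr.single {j} 1 : Gr 𝕜 A r) ∈ R)
    (S : Finset (Fin r)) : ∀ a : A, (∀ k, (Gr.single ∅ (twist 𝕜 k a) : Gr 𝕜 A r) ∈ R) → (Gr.single S a : Gr 𝕜 A r) ∈ R := by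
  induction S using Finset.induction_on_min with
  | empty => intro a ha; simpa [twist_zero] using ha 0
  | insert j S hj ih =>
    intro a ha
    have := Gr.single_insert (𝕜 := 𝕜) hj (SuperAlgebra.parity (𝕜 := 𝕜) a)
    rw [SuperAlgebra.parity_parity] at this
    rw [← this]
    refine R.mul_mem (hodd j) (ih _ fun k => ?_)
    rw [← twist_one 𝕜, ← twist_add]
    exact ha _

end

namespace FormalFun
variable {𝕜 A : Type*} [CommRing 𝕜] [Ring A] [Algebra 𝕜 A] {n r : ℕ}

@[ext] theorem coeff_ext {f g : FormalFun 𝕜 A n r} (h : ∀ S α, coeff S α f = coeff S α g) : f = g := by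
  funext S
  exact MvPowerSeries.ext fun α => h S α

@[simp] theorem coeff_add (S α) (f g : FormalFun 𝕜 A n r) : coeff S α (f + g) = coeff S α f + coeff S α g := rfl
@[simp] theorem coeff_sub (S α) (f g : FormalFun 𝕜 A n r) : coeff S α (f - g) = coeff S α f - coeff S α g := rfl
@[simp] theorem coeff_neg (S α) (f : FormalFun 𝕜 A n r) : coeff S α (-f) = -coeff S α f := rfl
@[simp] theorem coeff_zero (S α) : coeff S α (0 : FormalFun 𝕜 A n r) = 0 := rfl
@[simp] theorem coeff_smul (c : 𝕜) (S α) (f : FormalFun 𝕜 A n r) : coeff S α (c • f) = c • coeff S α f := rfl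
@[simp] theorem coeff_zsmul (c : ℤ) (S α) (f : FormalFun 𝕜 A n r) : coeff S α (c • f) = c • coeff S α f := rfl

/-- The coefficient as an additive map. -/
def coeffHom (S : Finset (Fin r)) (α : (Fin n ⊕ Fin n) →₀ ℕ) : FormalFun 𝕜 A n r →+ A where
  toFun := coeff S α
  map_zero' := rfl
  map_add' := fun _ _ => rfl

@[simp] theorem coeff_sum {ι : Type*} (s : Finset ι) (f : ι → FormalFun 𝕜 A n r) (S α) :
    coeff S α (∑ i ∈ s, f i) = ∑ i ∈ s, coeff S α (f i) := map_sum (coeffHom S α) f s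

/-- A formal function with given coefficients. -/
def mk (c : Finset (Fin r) → ((Fin n ⊕ Fin n) →₀ ℕ) → A) : FormalFun 𝕜 A n r := fun S α => c S α

@[simp] theorem coeff_mk (c : Finset (Fin r) → ((Fin n ⊕ Fin n) →₀ ℕ) → A) (S α) :
    coeff S α (mk c : FormalFun 𝕜 A n r) = c S α := rfl

/-- The monomial `c (p, q)^α θ^S`. -/
def mono (S : Finset (Fin r)) (α : (Fin n ⊕ Fin n) →₀ ℕ) (c : A) : FormalFun 𝕜 A n r :=
  Gr.single S (MvPowerSeries.monomial α c)

theorem coeff_mono (S α S' α') (c : A) :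
    coeff S' α' (mono S α c : FormalFun 𝕜 A n r) = if S' = S ∧ α' = α then c else 0 := by
  classical
  unfold coeff mono
  rw [Gr.single_apply]
  by_cases h : S' = S
  · rw [if_pos h, MvPowerSeries.coeff_monomial]
    simp [h]
  · simp [h]

theorem coeff_const (c : A) (S α) :
    coeff S α (const c : FormalFun 𝕜 A n r) = if S = ∅ ∧ α = 0 then c else 0 := coeff_mono _ _ _ _ c

theorem mono_add (S : Finset (Fin r)) (α) (c d : A) : (mono S α (c + d) : FormalFun 𝕜 A n r) = mono S α c + mono S α d := by
  ext S' α'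
  simp only [coeff_mono, coeff_add]
  split_ifs <;> simp

theorem const_add (c d : A) : (const (c + d) : FormalFun 𝕜 A n r) = const c + const d := mono_add _ _ _ _

/-- The variables. -/
def gen : (Fin n ⊕ Fin n) ⊕ Fin r → FormalFun 𝕜 A n r
  | .inl i => mono ∅ (Finsupp.single i 1) 1
  | .inr j => mono {j} 0 1

/-- The total degree of a monomial. -/
abbrev deg (S : Finset (Fin r)) (α : (Fin n ⊕ Fin n) →₀ ℕ) : ℕ := α.degree + S.card

variable [SuperAlgebra 𝕜 A]

theorem coeff_mul (f g : FormalFun 𝕜 A n r) (T α) :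
    coeff T α (f * g) = ∑ S ∈ T.powerset, ∑ p ∈ Finset.HasAntidiagonal.antidiagonal α,
      koszul S (T \ S) • (coeff S p.1 f * twist 𝕜 S.card (coeff (T \ S) p.2 g)) := by
  classical
  unfold coeff
  rw [Gr.mul_apply, map_sum]
  refine Finset.sum_congr rfl fun S _ => ?_
  rw [map_zsmul, MvPowerSeries.coeff_mul, Finset.smul_sum]
  refine Finset.sum_congr (by congr!) fun p _ => ?_
  rw [coeff_twist]

theorem coeff_parity (f : FormalFun 𝕜 A n r) (S α) :
    coeff S α (SuperAlgebra.parity (𝕜 := 𝕜) f) = (-1 : ℤ) ^ S.card • SuperAlgebra.parity (𝕜 := 𝕜) (coeff S α f) := by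
  unfold coeff
  rw [Gr.parity_apply, map_zsmul]
  rfl

theorem coeff_const_mul (c : A) (f : FormalFun 𝕜 A n r) (S α) :
    coeff S α (const c * f) = c * coeff S α f := by
  unfold const coeff
  rw [Gr.single_empty_mul, MvPowerSeries.coeff_C_mul]

theorem const_mul (c d : A) : (const (c * d) : FormalFun 𝕜 A n r) = const c * const d := by
  ext S α
  rw [coeff_const_mul, coeff_const, coeff_const]
  split_ifs <;> simp

theorem const_one : (const (1 : A) : FormalFun 𝕜 A n r) = 1 := rfl

/-- Constants, as a ring homomorphism. -/
def constHom : A →+* FormalFun 𝕜 A n r where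
  toFun := const
  map_one' := rfl
  map_mul' := const_mul
  map_zero' := by ext S α; rw [coeff_const]; simp
  map_add' := const_add

theorem const_zero : (const (0 : A) : FormalFun 𝕜 A n r) = 0 := map_zero constHom

theorem parity_const (c : A) :
    SuperAlgebra.parity (𝕜 := 𝕜) (const c : FormalFun 𝕜 A n r) = const (SuperAlgebra.parity (𝕜 := 𝕜) c) := by
  ext S α
  rw [coeff_parity, coeff_const, coeff_const]
  by_cases h : S = ∅ ∧ α = 0
  · simp [h.1, h.2]
  · simp [if_neg h]

theorem algebraMap_eq_const (c : 𝕜) : algebraMap 𝕜 (FormalFun 𝕜 A n r) c = const (algebraMap 𝕜 A c) := by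
  rw [Gr.algebraMap_eq, MvPowerSeries.algebraMap_apply]
  rfl

/-- The constant term as an algebra homomorphism. -/
def evalZero : FormalFun 𝕜 A n r →ₐ[𝕜] A := AlgHom.ofLinearMap
  { toFun := coeff ∅ 0
    map_add' := fun _ _ => rfl
    map_smul' := fun _ _ => rfl }
  (by
    change coeff ∅ 0 (const 1 : FormalFun 𝕜 A n r) = (1 : A)
    rw [coeff_const]; simp)
  (fun f g => by
    change coeff ∅ 0 (f * g) = coeff ∅ 0 f * coeff ∅ 0 g
    rw [coeff_mul]
    simp [koszul_empty_left, twist_zero])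

@[simp] theorem evalZero_apply (f : FormalFun 𝕜 A n r) : evalZero f = coeff ∅ 0 f := rfl

/-! #### The filtration -/

theorem add_mem_filtration {k : ℕ} {f g : FormalFun 𝕜 A n r} (hf : f ∈ filtration k) (hg : g ∈ filtration k) :
    f + g ∈ filtration k := fun S α h => by rw [coeff_add, hf S α h, hg S α h, add_zero]

theorem neg_mem_filtration {k : ℕ} {f : FormalFun 𝕜 A n r} (hf : f ∈ filtration k) :
    -f ∈ filtration k := fun S α h => by rw [coeff_neg, hf S α h, neg_zero]

theorem sub_mem_filtration {k : ℕ} {f g : FormalFun 𝕜 A n r} (hf : f ∈ filtration k) (hg : g ∈ filtration k) :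
    f - g ∈ filtration k := fun S α h => by rw [coeff_sub, hf S α h, hg S α h, sub_zero]

theorem zero_mem_filtration {k : ℕ} : (0 : FormalFun 𝕜 A n r) ∈ filtration k := fun _ _ _ => rfl

theorem sum_mem_filtration {k : ℕ} {ι : Type*} (s : Finset ι) (f : ι → FormalFun 𝕜 A n r)
    (h : ∀ i ∈ s, f i ∈ filtration k) : ∑ i ∈ s, f i ∈ filtration k := fun S α hd => by
  rw [coeff_sum]
  exact Finset.sum_eq_zero fun i hi => h i hi S α hd

theorem filtration_mono {k l : ℕ} (h : l ≤ k) {f : FormalFun 𝕜 A n r} (hf : f ∈ filtration k) : f ∈ filtration l :=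
  fun S α hd => hf S α (hd.trans_le h)

theorem mem_filtration_zero (f : FormalFun 𝕜 A n r) : f ∈ filtration 0 := fun _ _ h => absurd h (Nat.not_lt_zero _)

theorem deg_split {S T : Finset (Fin r)} (hS : S ⊆ T) {α : (Fin n ⊕ Fin n) →₀ ℕ} {p : ((Fin n ⊕ Fin n) →₀ ℕ) × ((Fin n ⊕ Fin n) →₀ ℕ)}
    (hp : p ∈ Finset.HasAntidiagonal.antidiagonal α) : deg T α = deg S p.1 + deg (T \ S) p.2 := by
  rw [Finset.HasAntidiagonal.mem_antidiagonal] at hp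
  simp only [deg]
  rw [Gr.sub_card hS, ← hp, map_add]
  ring

theorem mul_mem_filtration {k l : ℕ} {f g : FormalFun 𝕜 A n r} (hf : f ∈ filtration k) (hg : g ∈ filtration l) :
    f * g ∈ filtration (k + l) := fun T α h => by
  rw [coeff_mul]
  refine Finset.sum_eq_zero fun S hS => Finset.sum_eq_zero fun p hp => ?_
  have := deg_split (Finset.mem_powerset.1 hS) hp
  by_cases h1 : deg S p.1 < k
  · rw [hf _ _ h1, zero_mul, smul_zero]
  · rw [hg _ _ (by simp only [deg] at *; omega), map_zero, mul_zero, smul_zero]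

theorem mul_mem_filtration_left {k : ℕ} {f : FormalFun 𝕜 A n r} (hf : f ∈ filtration k) (g : FormalFun 𝕜 A n r) :
    f * g ∈ filtration k := mul_mem_filtration hf (mem_filtration_zero g)

theorem mul_mem_filtration_right {k : ℕ} {g : FormalFun 𝕜 A n r} (hg : g ∈ filtration k) (f : FormalFun 𝕜 A n r) :
    f * g ∈ filtration k := by simpa using mul_mem_filtration (mem_filtration_zero f) hg

/-- The filtration is separated: a coefficient of degree `d` is detected in step `d + 1`. -/
theorem eq_of_sub_mem_filtration {f g : FormalFun 𝕜 A n r} (h : ∀ k, f - g ∈ filtration k) : f = g := by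
  ext S α
  exact sub_eq_zero.1 (h (deg S α + 1) S α (Nat.lt_succ_self _))

theorem parity_mem_filtration {k : ℕ} {f : FormalFun 𝕜 A n r} (hf : f ∈ filtration k) :
    SuperAlgebra.parity (𝕜 := 𝕜) f ∈ filtration k := fun S α h => by
  rw [coeff_parity, hf S α h, map_zero, smul_zero]

/-- The homogeneous component of degree `k`. -/
def proj (k : ℕ) (f : FormalFun 𝕜 A n r) : FormalFun 𝕜 A n r :=
  mk fun S α => if deg S α = k then coeff S α f else 0

theorem coeff_proj (k : ℕ) (f : FormalFun 𝕜 A n r) (S α) :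
    coeff S α (proj k f) = if deg S α = k then coeff S α f else 0 := rfl

theorem proj_mem_filtration (k : ℕ) (f : FormalFun 𝕜 A n r) : proj k f ∈ filtration k := fun S α h => by
  rw [coeff_proj, if_neg h.ne]

theorem sub_sum_proj_mem (N : ℕ) (f : FormalFun 𝕜 A n r) : f - ∑ k ∈ Finset.range N, proj k f ∈ filtration N :=
  fun S α h => by
  rw [coeff_sub, coeff_sum]
  simp [coeff_proj, h]

theorem proj_add (k : ℕ) (f g : FormalFun 𝕜 A n r) : proj k (f + g) = proj k f + proj k g := by
  ext S α
  simp only [coeff_proj, coeff_add]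
  split_ifs <;> simp

/-! #### Monomials -/

/-- The monomials of degree less than `N`. -/
def monoIdx (n r N : ℕ) : Finset (Finset (Fin r) × ((Fin n ⊕ Fin n) →₀ ℕ)) :=
  Finset.univ ×ˢ (Finsupp.finite_of_degree_le (σ := Fin n ⊕ Fin n) N).toFinset

/-- Polynomials are dense for the filtration. The finite index set only has to contain the monomials
of degree below `N`; since it bounds the even degree alone, it contains others, which do no harm. -/
theorem sub_sum_mono_mem (N : ℕ) (f : FormalFun 𝕜 A n r) :
    f - ∑ p ∈ monoIdx n r N, mono p.1 p.2 (coeff p.1 p.2 f) ∈ filtration N := fun S α h => by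
  rw [coeff_sub, coeff_sum, Finset.sum_eq_single (S, α)]
  · rw [coeff_mono]; simp
  · rintro ⟨S', α'⟩ _ hne
    rw [coeff_mono, if_neg]
    rintro ⟨rfl, rfl⟩
    exact hne rfl
  · intro hn
    exfalso
    apply hn
    simp only [monoIdx, Finset.mem_product, Finset.mem_univ, true_and, Set.Finite.mem_toFinset, Set.mem_ofPred_eq]
    omega

theorem single_empty_monomial_mul (α β : (Fin n ⊕ Fin n) →₀ ℕ) (c d : A) :
    (mono ∅ α c : FormalFun 𝕜 A n r) * mono ∅ β d = mono ∅ (α + β) (c * d) := by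
  unfold mono
  rw [Gr.single_mul_single]
  simp [koszul_empty_left, twist_zero, MvPowerSeries.monomial_mul_monomial]

theorem mono_empty_mem (R : Subring (FormalFun 𝕜 A n r)) (hc : ∀ c, const c ∈ R) (hg : ∀ k, gen k ∈ R)
    (α : (Fin n ⊕ Fin n) →₀ ℕ) : ∀ c : A, mono ∅ α c ∈ R := by
  induction α using Finsupp.induction with
  | zero => exact hc
  | single_add i k α hi hk ih =>
    intro c
    have : ∀ m : ℕ, (mono ∅ (Finsupp.single i m) 1 : FormalFun 𝕜 A n r) ∈ R := by
      intro m
      induction m with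
      | zero => rw [Finsupp.single_zero]; exact hc 1
      | succ m ihm =>
        rw [Finsupp.single_add, ← one_mul (1 : A), ← single_empty_monomial_mul]
        exact R.mul_mem ihm (hg (.inl i))
    rw [← one_mul c, ← single_empty_monomial_mul]
    exact R.mul_mem (this k) (ih c)

/-- Constants and variables generate all monomials as a ring. Together with density this is how
homomorphisms and derivations are compared on formal functions. -/
theorem mono_mem (R : Subring (FormalFun 𝕜 A n r)) (hc : ∀ c, const c ∈ R) (hg : ∀ k, gen k ∈ R)
    (S : Finset (Fin r)) (α : (Fin n ⊕ Fin n) →₀ ℕ) (c : A) : mono S α c ∈ R := by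
  refine Gr.single_mem_of_mem R (fun j => hg (.inr j)) S _ fun k => ?_
  have : twist 𝕜 k (MvPowerSeries.monomial α c) = MvPowerSeries.monomial α (twist 𝕜 k c) := by
    classical
    ext β
    rw [coeff_twist, MvPowerSeries.coeff_monomial, MvPowerSeries.coeff_monomial]
    split_ifs <;> simp
  rw [this]
  exact mono_empty_mem R hc hg α _

/-- Filtered ring homomorphisms are determined by their values on constants and variables. -/
theorem ringHom_ext {𝕜' A' : Type*} [CommRing 𝕜'] [Ring A'] [Algebra 𝕜' A'] [SuperAlgebra 𝕜' A'] {n' r' : ℕ}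
    {Φ Ψ : FormalFun 𝕜 A n r →+* FormalFun 𝕜' A' n' r'}
    (hΦ : ∀ k, ∀ f ∈ filtration k, Φ f ∈ filtration k) (hΨ : ∀ k, ∀ f ∈ filtration k, Ψ f ∈ filtration k)
    (hc : ∀ c, Φ (const c) = Ψ (const c)) (hg : ∀ k, Φ (gen k) = Ψ (gen k)) : Φ = Ψ := by
  ext1 f
  apply eq_of_sub_mem_filtration
  intro N
  have hm : ∀ S α c, Φ (mono S α c) = Ψ (mono S α c) := fun S α c =>
    mono_mem (RingHom.eqLocus Φ Ψ) hc hg S α c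
  -- `Φ` and `Ψ` agree on the polynomial truncation, so their difference at `f` equals their
  -- difference at the remainder.
  have h1 := sub_mem_filtration (hΦ N _ (sub_sum_mono_mem N f)) (hΨ N _ (sub_sum_mono_mem N f))
  simpa only [map_sub, map_sum, hm, sub_sub_sub_cancel_right] using h1

end FormalFun
end SuperGeom
end

/-! ### Derivatives, rescaling by powers of an even parameter, and contraction of filtered maps -/

noncomputable section
namespace SuperGeom

section
variable {𝕜 A : Type*} [CommRing 𝕜] [Ring A] [Algebra 𝕜 A] [SuperAlgebra 𝕜 A]

theorem twist_of_even {t : A} (ht : SuperAlgebra.parity (𝕜 := 𝕜) t = t) (k : ℕ) : twist 𝕜 k t = t := by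
  induction k with
  | zero => exact twist_zero 𝕜 t
  | succ k ih => rw [twist_add, twist_one, ht, ih]

theorem parity_pow_of_even {t : A} (ht : SuperAlgebra.parity (𝕜 := 𝕜) t = t) (m : ℕ) :
    SuperAlgebra.parity (𝕜 := 𝕜) (t ^ m) = t ^ m := by rw [map_pow, ht]

end

namespace FormalFun
variable {𝕜 A : Type*} [CommRing 𝕜] [Ring A] [Algebra 𝕜 A] {n r : ℕ} [SuperAlgebra 𝕜 A]

theorem coeff_dEven (i : Fin n ⊕ Fin n) (f : FormalFun 𝕜 A n r) (S α) :
    coeff S α (dEven i f) = (α i + 1) • coeff S (α + Finsupp.single i 1) f := rfl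

theorem coeff_dOdd (j : Fin r) (f : FormalFun 𝕜 A n r) (S α) :
    coeff S α (dOdd j f) = if j ∈ S then 0 else koszul {j} S • SuperAlgebra.parity (𝕜 := 𝕜) (coeff (insert j S) α f) := by
  change MvPowerSeries.coeff α (if j ∈ S then 0 else koszul {j} S • SuperAlgebra.parity (𝕜 := 𝕜) (f (insert j S))) = _
  split_ifs with h
  · exact map_zero _
  · rw [map_zsmul]; rfl

theorem dEven_add (i : Fin n ⊕ Fin n) (f g : FormalFun 𝕜 A n r) : dEven i (f + g) = dEven i f + dEven i g := by
  ext S α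
  simp only [coeff_dEven, coeff_add, smul_add]

theorem dOdd_add (j : Fin r) (f g : FormalFun 𝕜 A n r) : dOdd j (f + g) = dOdd j f + dOdd j g := by
  ext S α
  simp only [coeff_dOdd, coeff_add, map_add, smul_add]
  split_ifs <;> simp

theorem dEven_mem_filtration {k : ℕ} {f : FormalFun 𝕜 A n r} (hf : f ∈ filtration (k + 1)) (i : Fin n ⊕ Fin n) :
    dEven i f ∈ filtration k := fun S α h => by
  rw [coeff_dEven, hf, smul_zero]
  rw [map_add, Finsupp.degree_single]
  omega

theorem dOdd_mem_filtration {k : ℕ} {f : FormalFun 𝕜 A n r} (hf : f ∈ filtration (k + 1)) (j : Fin r) :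
    dOdd j f ∈ filtration k := fun S α h => by
  rw [coeff_dOdd]
  split_ifs with hj
  · rfl
  · rw [hf, map_zero, smul_zero]
    rw [Finset.card_insert_of_notMem hj]
    omega

theorem dEven_const (i : Fin n ⊕ Fin n) (c : A) : dEven i (const c : FormalFun 𝕜 A n r) = 0 := by
  ext S α
  rw [coeff_dEven, coeff_const, if_neg, smul_zero, coeff_zero]
  rintro ⟨-, h⟩
  simpa using DFunLike.congr_fun h i

theorem dOdd_const (j : Fin r) (c : A) : dOdd j (const c : FormalFun 𝕜 A n r) = 0 := by
  ext S α
  rw [coeff_dOdd, coeff_const, coeff_zero]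
  simp

/-- An additive map that is continuous for the topology of the filtration. -/
def Cts (Φ : FormalFun 𝕜 A n r → FormalFun 𝕜 A n r) : Prop :=
  (∀ f g, Φ (f + g) = Φ f + Φ g) ∧ ∀ N, ∃ M, ∀ f ∈ filtration M, Φ f ∈ filtration N

theorem Cts.comp {Φ Ψ : FormalFun 𝕜 A n r → FormalFun 𝕜 A n r} (hΦ : Cts Φ) (hΨ : Cts Ψ) : Cts fun f => Φ (Ψ f) := by
  refine ⟨fun f g => by simp only [hΨ.1, hΦ.1], fun N => ?_⟩
  obtain ⟨M, hM⟩ := hΦ.2 N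
  obtain ⟨M', hM'⟩ := hΨ.2 M
  exact ⟨M', fun f hf => hM _ (hM' f hf)⟩

theorem Cts.add {Φ Ψ : FormalFun 𝕜 A n r → FormalFun 𝕜 A n r} (hΦ : Cts Φ) (hΨ : Cts Ψ) : Cts fun f => Φ f + Ψ f := by
  refine ⟨fun f g => by simp only [hΨ.1, hΦ.1]; abel, fun N => ?_⟩
  obtain ⟨M, hM⟩ := hΦ.2 N
  obtain ⟨M', hM'⟩ := hΨ.2 N
  exact ⟨max M M', fun f hf => add_mem_filtration (hM f (filtration_mono (le_max_left _ _) hf))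
    (hM' f (filtration_mono (le_max_right _ _) hf))⟩

theorem Cts.mul_left (g : FormalFun 𝕜 A n r) : Cts fun f => g * f :=
  ⟨fun _ _ => mul_add _ _ _, fun N => ⟨N, fun _ hf => mul_mem_filtration_right hf g⟩⟩

theorem Cts.mul_right (g : FormalFun 𝕜 A n r) : Cts fun f => f * g :=
  ⟨fun _ _ => add_mul _ _ _, fun N => ⟨N, fun _ hf => mul_mem_filtration_left hf g⟩⟩

/-- A continuous additive map is determined by its values on homogeneous elements. -/
theorem Cts.eq_of_proj {Φ Ψ : FormalFun 𝕜 A n r → FormalFun 𝕜 A n r} (hΦ : Cts Φ) (hΨ : Cts Ψ) (f : FormalFun 𝕜 A n r)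
    (h : ∀ k, Φ (proj k f) = Ψ (proj k f)) : Φ f = Ψ f := by
  apply eq_of_sub_mem_filtration
  intro N
  obtain ⟨M, hM⟩ := hΦ.2 N
  obtain ⟨M', hM'⟩ := hΨ.2 N
  let P := AddMonoidHom.mk' Φ hΦ.1
  let Q := AddMonoidHom.mk' Ψ hΨ.1
  have h1 : P (f - ∑ k ∈ Finset.range (max M M'), proj k f) ∈ filtration N :=
    hM _ (filtration_mono (le_max_left _ _) (sub_sum_proj_mem _ f))
  have h2 : Q (f - ∑ k ∈ Finset.range (max M M'), proj k f) ∈ filtration N :=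
    hM' _ (filtration_mono (le_max_right _ _) (sub_sum_proj_mem _ f))
  have h3 := sub_mem_filtration h1 h2
  have h4 : ∀ k, P (proj k f) = Q (proj k f) := h
  simp only [map_sub, map_sum, h4, sub_sub_sub_cancel_right] at h3
  exact h3

theorem Cts.parity : Cts fun f : FormalFun 𝕜 A n r => SuperAlgebra.parity (𝕜 := 𝕜) f :=
  ⟨fun f g => map_add _ f g, fun N => ⟨N, fun _ hf => parity_mem_filtration hf⟩⟩

/-! #### Rescaling -/

/-- Multiply the terms of degree `d` by `t^(d - k)`. -/
def rescale (t : A) (k : ℕ) (f : FormalFun 𝕜 A n r) : FormalFun 𝕜 A n r :=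
  mk fun S α => t ^ (deg S α - k) * coeff S α f

theorem coeff_rescale (t : A) (k : ℕ) (f : FormalFun 𝕜 A n r) (S α) :
    coeff S α (rescale t k f) = t ^ (deg S α - k) * coeff S α f := rfl

theorem rescale_add (t : A) (k : ℕ) (f g : FormalFun 𝕜 A n r) : rescale t k (f + g) = rescale t k f + rescale t k g := by
  ext S α
  simp only [coeff_rescale, coeff_add, mul_add]

theorem rescale_mem_filtration (t : A) (k : ℕ) {l : ℕ} {f : FormalFun 𝕜 A n r} (hf : f ∈ filtration l) :
    rescale t k f ∈ filtration l := fun S α h => by rw [coeff_rescale, hf S α h, mul_zero]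

theorem Cts.rescale (t : A) (k : ℕ) : Cts (rescale t k : FormalFun 𝕜 A n r → FormalFun 𝕜 A n r) :=
  ⟨rescale_add t k, fun N => ⟨N, fun _ hf => rescale_mem_filtration t k hf⟩⟩

section even
variable {t : A} (ht : SuperAlgebra.parity (𝕜 := 𝕜) t = t)
include ht

theorem pow_mul_comm_of_even (m : ℕ) (c : A) : t ^ m * c = c * t ^ m :=
  SuperAlgebra.even_mul _ _ (parity_pow_of_even ht m)

theorem parity_rescale (k : ℕ) (f : FormalFun 𝕜 A n r) :
    SuperAlgebra.parity (𝕜 := 𝕜) (rescale t k f) = rescale t k (SuperAlgebra.parity (𝕜 := 𝕜) f) := by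
  ext S α
  rw [coeff_parity, coeff_rescale, coeff_rescale, coeff_parity, map_mul, parity_pow_of_even ht, mul_smul_comm]

/-- Degrees add, but the exponents `d - k` are truncated at zero. The hypotheses kill precisely the
terms in which truncation would occur. Evenness of `t` moves its powers past the coefficients and
makes them insensitive to twists. -/
theorem rescale_mul {k l : ℕ} {f g : FormalFun 𝕜 A n r} (hf : f ∈ filtration k) (hg : g ∈ filtration l) :
    rescale t k f * rescale t l g = rescale t (k + l) (f * g) := by
  ext T α
  rw [coeff_rescale, coeff_mul, coeff_mul]
  simp only [Finset.mul_sum]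
  refine Finset.sum_congr rfl fun S hS => Finset.sum_congr rfl fun p hp => ?_
  have hd := deg_split (Finset.mem_powerset.1 hS) hp
  rw [coeff_rescale, coeff_rescale, map_mul, map_pow, twist_of_even ht, mul_smul_comm]
  congr 1
  by_cases h1 : deg S p.1 < k
  · rw [hf _ _ h1]; simp
  by_cases h2 : deg (T \ S) p.2 < l
  · rw [hg _ _ h2]; simp
  have e : deg T α - (k + l) = (deg S p.1 - k) + (deg (T \ S) p.2 - l) := by
    simp only [deg] at *
    omega
  rw [e, pow_add, mul_assoc, mul_assoc, ← mul_assoc (coeff S p.1 f), ← pow_mul_comm_of_even ht, mul_assoc]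

theorem dEven_rescale (k : ℕ) (i : Fin n ⊕ Fin n) (f : FormalFun 𝕜 A n r) :
    dEven i (rescale t (k + 1) f) = rescale t k (dEven i f) := by
  ext S α
  rw [coeff_dEven, coeff_rescale, coeff_rescale, coeff_dEven, mul_smul_comm]
  congr 3
  simp only [deg, map_add, Finsupp.degree_single]
  omega

theorem dOdd_rescale (k : ℕ) (j : Fin r) (f : FormalFun 𝕜 A n r) :
    dOdd j (rescale t (k + 1) f) = rescale t k (dOdd j f) := by
  ext S α
  rw [coeff_dOdd, coeff_rescale, coeff_rescale, coeff_dOdd]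
  split_ifs with hj
  · rw [mul_zero]
  · rw [map_mul, parity_pow_of_even ht, mul_smul_comm]
    congr 3
    simp only [deg, Finset.card_insert_of_notMem hj]
    omega

theorem rescale_neg (k : ℕ) (f : FormalFun 𝕜 A n r) : rescale t k (-f) = - rescale t k f := by
  ext S α
  simp only [coeff_rescale, coeff_neg, mul_neg]

theorem rescale_zsmul (k : ℕ) (m : ℤ) (f : FormalFun 𝕜 A n r) : rescale t k (m • f) = m • rescale t k f := by
  ext S α
  simp only [coeff_rescale, coeff_zsmul, mul_smul_comm]

theorem rescale_sum (k : ℕ) {ι : Type*} (s : Finset ι) (f : ι → FormalFun 𝕜 A n r) :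
    rescale t k (∑ i ∈ s, f i) = ∑ i ∈ s, rescale t k (f i) := by
  ext S α
  simp only [coeff_rescale, coeff_sum, Finset.mul_sum]

/-- The bracket lowers total degree by two, so the shifts `k + 1` and `l + 1` combine to `k + l`. -/
theorem bracket_rescale {a b k l : ℕ} {f g : FormalFun 𝕜 A n (a + b)} (hf : f ∈ filtration (k + 1)) (hg : g ∈ filtration (l + 1)) :
    bracket a b (rescale t (k + 1) f) (rescale t (l + 1) g) = rescale t (k + l) (bracket a b f g) := by
  unfold bracket
  simp only [sub_eq_add_neg, rescale_add, rescale_neg ht, rescale_sum ht, rescale_zsmul ht, parity_rescale ht,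
    dEven_rescale ht, dOdd_rescale ht]
  congr 1
  · refine Finset.sum_congr rfl fun i _ => ?_
    rw [rescale_mul ht (dEven_mem_filtration hf _) (dEven_mem_filtration hg _),
      rescale_mul ht (dEven_mem_filtration hf _) (dEven_mem_filtration hg _)]
  · congr 1
    refine Finset.sum_congr rfl fun i _ => ?_
    rw [rescale_mul ht (dOdd_mem_filtration (parity_mem_filtration hf) _) (dOdd_mem_filtration hg _)]

theorem rescale_const (c : A) : rescale t 0 (const c : FormalFun 𝕜 A n r) = const c := by
  ext S α
  rw [coeff_rescale, coeff_const]
  split_ifs with h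
  · simp [h.1, h.2, deg]
  · simp

end even

theorem bracket_add_left {a b : ℕ} (f f' g : FormalFun 𝕜 A n (a + b)) :
    bracket a b (f + f') g = bracket a b f g + bracket a b f' g := by
  unfold bracket
  simp only [dEven_add, dOdd_add, map_add, add_mul, smul_add, Finset.sum_add_distrib, Finset.sum_sub_distrib]
  abel

theorem bracket_add_right {a b : ℕ} (f g g' : FormalFun 𝕜 A n (a + b)) :
    bracket a b f (g + g') = bracket a b f g + bracket a b f g' := by
  unfold bracket
  simp only [dEven_add, dOdd_add, mul_add, smul_add, Finset.sum_add_distrib, Finset.sum_sub_distrib]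
  abel

theorem zsmul_mem_filtration {k : ℕ} {f : FormalFun 𝕜 A n r} (hf : f ∈ filtration k) (m : ℤ) : m • f ∈ filtration k :=
  fun S α h => by rw [coeff_zsmul, hf S α h, smul_zero]

theorem Cts.bracket_left {a b : ℕ} (g : FormalFun 𝕜 A n (a + b)) : Cts fun f => bracket a b f g := by
  refine ⟨fun f f' => bracket_add_left f f' g, fun N => ⟨N + 1, fun f hf => ?_⟩⟩
  refine sub_mem_filtration (sum_mem_filtration _ _ fun i _ => ?_) (sum_mem_filtration _ _ fun i _ => ?_)
  · exact sub_mem_filtration (mul_mem_filtration_left (dEven_mem_filtration hf _) _)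
      (mul_mem_filtration_left (dEven_mem_filtration hf _) _)
  · exact zsmul_mem_filtration (mul_mem_filtration_left (dOdd_mem_filtration (parity_mem_filtration hf) _) _) _

theorem Cts.bracket_right {a b : ℕ} (f : FormalFun 𝕜 A n (a + b)) : Cts fun g => bracket a b f g := by
  refine ⟨fun g g' => bracket_add_right f g g', fun N => ⟨N + 1, fun g hg => ?_⟩⟩
  refine sub_mem_filtration (sum_mem_filtration _ _ fun i _ => ?_) (sum_mem_filtration _ _ fun i _ => ?_)
  · exact sub_mem_filtration (mul_mem_filtration_right (dEven_mem_filtration hg _) _)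
      (mul_mem_filtration_right (dEven_mem_filtration hg _) _)
  · exact zsmul_mem_filtration (mul_mem_filtration_right (dOdd_mem_filtration hg _) _) _

theorem bracket_const_left {a b : ℕ} (c : A) (g : FormalFun 𝕜 A n (a + b)) : bracket a b (const c) g = 0 := by
  simp [bracket, dEven_const, dOdd_const, parity_const]

theorem bracket_const_right {a b : ℕ} (f : FormalFun 𝕜 A n (a + b)) (c : A) : bracket a b f (const c) = 0 := by
  simp [bracket, dEven_const, dOdd_const]

theorem proj_zero_eq (f : FormalFun 𝕜 A n r) : proj 0 f = const (coeff ∅ 0 f) := by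
  ext S α
  rw [coeff_proj, coeff_const]
  by_cases h : S = ∅ ∧ α = 0
  · rw [if_pos h, h.1, h.2]
    simp
  · rw [if_neg h, if_neg]
    intro h'
    apply h
    simp only [deg, Nat.add_eq_zero_iff, Finset.card_eq_zero, Finsupp.degree_eq_zero_iff] at h'
    exact ⟨h'.2, h'.1⟩

theorem proj_proj (k l : ℕ) (f : FormalFun 𝕜 A n r) : proj k (proj l f) = if k = l then proj l f else 0 := by
  ext S α
  rw [coeff_proj, coeff_proj]
  split_ifs <;> simp_all [coeff_proj]

theorem proj_eq_zero {k l : ℕ} (h : k < l) {f : FormalFun 𝕜 A n r} (hf : f ∈ filtration l) : proj k f = 0 := by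
  ext S α
  rw [coeff_proj]
  split_ifs with hd
  · exact hf S α (hd.trans_lt h)
  · rfl

theorem proj_const_mul (k : ℕ) (c : A) (f : FormalFun 𝕜 A n r) : proj k (const c * f) = const c * proj k f := by
  ext S α
  simp only [coeff_proj, coeff_const_mul]
  split_ifs <;> simp

/-! #### Contraction of filtered maps to their linear parts -/

/-- The family `φ_t` contracting `φ = φ_1` to its linear part `φ_0`. For invertible `t` it is the conjugate of `φ` by
the homothety `t`. -/
def contract (t : A) (φ : FormalFun 𝕜 A n r → FormalFun 𝕜 A n r) (f : FormalFun 𝕜 A n r) : FormalFun 𝕜 A n r :=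
  mk fun S α => ∑ k ∈ Finset.range (deg S α + 1), t ^ (deg S α - k) * coeff S α (φ (proj k f))

theorem coeff_contract (t : A) (φ : FormalFun 𝕜 A n r → FormalFun 𝕜 A n r) (f : FormalFun 𝕜 A n r) (S α) :
    coeff S α (contract t φ f) = ∑ k ∈ Finset.range (deg S α + 1), t ^ (deg S α - k) * coeff S α (φ (proj k f)) := rfl

/-- Additive maps that preserve the filtration. -/
structure Filtered (φ : FormalFun 𝕜 A n r → FormalFun 𝕜 A n r) : Prop where
  add : ∀ f g, φ (f + g) = φ f + φ g
  mem : ∀ k, ∀ f ∈ filtration k, φ f ∈ filtration k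

theorem Filtered.cts {φ : FormalFun 𝕜 A n r → FormalFun 𝕜 A n r} (h : Filtered φ) : Cts φ := ⟨h.add, fun N => ⟨N, h.mem N⟩⟩

theorem Filtered.zero {φ : FormalFun 𝕜 A n r → FormalFun 𝕜 A n r} (h : Filtered φ) : φ 0 = 0 :=
  map_zero (AddMonoidHom.mk' φ h.add)

/-- On a homogeneous argument a single summand survives. If its index lies outside the range of
summation, the coefficient vanishes anyway because `φ` is filtered. Every further property of
`contract` is checked through this formula and `Cts.eq_of_proj`. -/
theorem contract_proj (t : A) {φ : FormalFun 𝕜 A n r → FormalFun 𝕜 A n r} (h : Filtered φ) (k : ℕ) (f : FormalFun 𝕜 A n r) :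
    contract t φ (proj k f) = rescale t k (φ (proj k f)) := by
  ext S α
  rw [coeff_contract, coeff_rescale]
  simp only [proj_proj]
  by_cases hk : k < deg S α + 1
  · rw [Finset.sum_eq_single k]
    · rw [if_pos rfl]
    · intro m _ hm
      rw [if_neg hm, h.zero]; simp
    · simp only [Finset.mem_range]; tauto
  · rw [h.mem k _ (proj_mem_filtration k f) S α (by simp only [deg] at *; omega), mul_zero]
    refine Finset.sum_eq_zero fun m hm => ?_
    rw [if_neg, h.zero]
    · simp
    · rintro rfl
      exact hk (Finset.mem_range.1 hm)

theorem contract_filtered (t : A) {φ : FormalFun 𝕜 A n r → FormalFun 𝕜 A n r} (h : Filtered φ) : Filtered (contract t φ) where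
  add f g := by
    ext S α
    simp only [coeff_contract, coeff_add, proj_add, h.add, mul_add, Finset.sum_add_distrib]
  mem k f hf S α hd := by
    rw [coeff_contract]
    refine Finset.sum_eq_zero fun m hm => ?_
    rw [proj_eq_zero _ hf, h.zero]
    · simp
    · have := Finset.mem_range.1 hm
      simp only [deg] at *
      omega

theorem contract_one {φ : FormalFun 𝕜 A n r → FormalFun 𝕜 A n r} (h : Filtered φ) : contract 1 φ = φ := by
  funext f
  refine (contract_filtered 1 h).cts.eq_of_proj h.cts f fun k => ?_
  rw [contract_proj _ h]
  ext S α
  simp [coeff_rescale]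

theorem contract_id (t : A) : contract t (fun f : FormalFun 𝕜 A n r => f) = fun f => f := by
  have h : Filtered (fun f : FormalFun 𝕜 A n r => f) := ⟨fun _ _ => rfl, fun _ _ h => h⟩
  funext f
  refine (contract_filtered t h).cts.eq_of_proj h.cts f fun k => ?_
  rw [contract_proj _ h]
  ext S α
  rw [coeff_rescale, coeff_proj]
  split_ifs with hd
  · simp [hd]
  · simp

section even
variable {t : A} (ht : SuperAlgebra.parity (𝕜 := 𝕜) t = t) {φ ψ : FormalFun 𝕜 A n r → FormalFun 𝕜 A n r}
include ht

theorem contract_const_mul (hc : ∀ c f, φ (const c * f) = const c * φ f) (c : A) (f : FormalFun 𝕜 A n r) :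
    contract t φ (const c * f) = const c * contract t φ f := by
  ext S α
  simp only [coeff_contract, coeff_const_mul, proj_const_mul, hc, Finset.mul_sum]
  refine Finset.sum_congr rfl fun k _ => ?_
  rw [← mul_assoc, pow_mul_comm_of_even ht, mul_assoc]

/-- On a component of degree `m ≥ k` the rescaling is multiplication by the constant `t^(m - k)`,
which passes through `φ` by `A`-linearity. The exponents then add, `(m - k) + (d - m) = d - k`, and
terms with `d < m` do not occur. -/
theorem contract_rescale (h : Filtered φ) (hc : ∀ c f, φ (const c * f) = const c * φ f) {k : ℕ} {f : FormalFun 𝕜 A n r}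
    (hf : f ∈ filtration k) : contract t φ (rescale t k f) = rescale t k (φ f) := by
  refine ((contract_filtered t h).cts.comp (Cts.rescale t k)).eq_of_proj ((Cts.rescale t k).comp h.cts) f fun m => ?_
  rcases lt_or_ge m k with hm | hm
  · have e : rescale t k (0 : FormalFun 𝕜 A n r) = 0 := by ext S α; simp [coeff_rescale]
    rw [proj_eq_zero hm hf, h.zero, e, (contract_filtered t h).zero]
  · have e : rescale t k (proj m f) = const (t ^ (m - k)) * proj m f := by
      ext S α
      rw [coeff_rescale, coeff_const_mul, coeff_proj]
      split_ifs with hd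
      · rw [hd]
      · simp
    change contract t φ (rescale t k (proj m f)) = rescale t k (φ (proj m f))
    rw [e, contract_const_mul ht hc, contract_proj t h]
    ext S α
    rw [coeff_const_mul, coeff_rescale, coeff_rescale, ← mul_assoc, ← pow_add]
    by_cases hd : deg S α < m
    · rw [h.mem m _ (proj_mem_filtration m f) S α hd]; simp
    · congr 2
      omega

/-- For homogeneous `f` the inner contraction is a rescaling, which `contract_rescale` carries
through the outer one. Conjugation by the homothety would need an invertible `t`, and `t = 0` is the
case of interest. -/
theorem contract_comp (h : Filtered φ) (hc : ∀ c f, φ (const c * f) = const c * φ f) (h' : Filtered ψ) (f : FormalFun 𝕜 A n r) :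
    contract t φ (contract t ψ f) = contract t (fun f => φ (ψ f)) f := by
  have h2 : Filtered fun f => φ (ψ f) := ⟨fun f g => by rw [h'.add, h.add], fun k f hf => h.mem k _ (h'.mem k f hf)⟩
  refine ((contract_filtered t h).cts.comp (contract_filtered t h').cts).eq_of_proj (contract_filtered t h2).cts f fun k => ?_
  rw [contract_proj t h', contract_proj t h2, contract_rescale ht h hc (h'.mem k _ (proj_mem_filtration k f))]

theorem proj_parity (k : ℕ) (f : FormalFun 𝕜 A n r) :
    proj k (SuperAlgebra.parity (𝕜 := 𝕜) f) = SuperAlgebra.parity (𝕜 := 𝕜) (proj k f) := by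
  ext S α
  simp only [coeff_proj, coeff_parity]
  split_ifs <;> simp

theorem contract_parity (h : Filtered φ)
    (hp : ∀ f, φ (SuperAlgebra.parity (𝕜 := 𝕜) f) = SuperAlgebra.parity (𝕜 := 𝕜) (φ f)) (f : FormalFun 𝕜 A n r) :
    contract t φ (SuperAlgebra.parity (𝕜 := 𝕜) f) = SuperAlgebra.parity (𝕜 := 𝕜) (contract t φ f) := by
  refine ((contract_filtered t h).cts.comp Cts.parity).eq_of_proj (Cts.parity.comp (contract_filtered t h).cts) f fun k => ?_
  rw [← proj_parity ht, contract_proj t h, contract_proj t h, parity_rescale ht, proj_parity ht, hp]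

theorem contract_homog (h : Filtered φ) {k : ℕ} {f : FormalFun 𝕜 A n r} (hf : proj k f = f) :
    contract t φ f = rescale t k (φ f) := by
  have := contract_proj t h k f
  rwa [hf] at this

theorem contract_const (h : Filtered φ) (hc : ∀ c, φ (const c) = const c) (c : A) : contract t φ (const c) = const c := by
  have : proj 0 (const c : FormalFun 𝕜 A n r) = const c := by rw [proj_zero_eq, coeff_const]; simp
  rw [contract_homog ht h this, hc, rescale_const ht]

theorem proj_mul_proj (k l : ℕ) (f g : FormalFun 𝕜 A n r) : proj (k + l) (proj k f * proj l g) = proj k f * proj l g := by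
  ext T α
  rw [coeff_proj]
  split_ifs with h
  · rfl
  · rw [coeff_mul]
    refine (Finset.sum_eq_zero fun S hS => Finset.sum_eq_zero fun p hp => ?_).symm
    have hd := deg_split (Finset.mem_powerset.1 hS) hp
    rw [coeff_proj, coeff_proj]
    by_cases h1 : deg S p.1 = k
    · rw [if_neg (c := deg (T \ S) p.2 = l)]
      · simp
      · omega
    · rw [if_neg h1]; simp

theorem contract_mul (h : Filtered φ) (hm : ∀ f g, φ (f * g) = φ f * φ g) (f g : FormalFun 𝕜 A n r) :
    contract t φ (f * g) = contract t φ f * contract t φ g := by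
  have hC := (contract_filtered t h).cts
  -- Both sides are additive and continuous in each argument separately, so each argument in turn
  -- may be taken homogeneous.
  refine (hC.comp (Cts.mul_right g)).eq_of_proj ((Cts.mul_right (contract t φ g)).comp hC) f fun k => ?_
  refine (hC.comp (Cts.mul_left (proj k f))).eq_of_proj ((Cts.mul_left (contract t φ (proj k f))).comp hC) g fun l => ?_
  rw [contract_homog ht h (proj_mul_proj ht k l f g), contract_proj t h, contract_proj t h,
    rescale_mul ht (h.mem k _ (proj_mem_filtration k f)) (h.mem l _ (proj_mem_filtration l g)), hm]

theorem dEven_proj (k : ℕ) (i : Fin n ⊕ Fin n) (f : FormalFun 𝕜 A n r) : proj k (dEven i f) = dEven i (proj (k + 1) f) := by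
  ext S α
  simp only [coeff_proj, coeff_dEven, deg, map_add, Finsupp.degree_single, add_right_comm _ 1, add_left_inj]
  split_ifs <;> simp

theorem dOdd_proj (k : ℕ) (j : Fin r) (f : FormalFun 𝕜 A n r) : proj k (dOdd j f) = dOdd j (proj (k + 1) f) := by
  ext S α
  simp only [coeff_proj, coeff_dOdd]
  by_cases hj : j ∈ S
  · simp [hj]
  · simp only [hj, if_false, deg, Finset.card_insert_of_notMem hj, ← add_assoc, add_left_inj]
    split_ifs <;> simp

theorem proj_neg (k : ℕ) (f : FormalFun 𝕜 A n r) : proj k (-f) = -proj k f := by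
  ext S α
  simp only [coeff_proj, coeff_neg]
  split_ifs <;> simp

theorem proj_zsmul (k : ℕ) (m : ℤ) (f : FormalFun 𝕜 A n r) : proj k (m • f) = m • proj k f := by
  ext S α
  simp only [coeff_proj, coeff_zsmul]
  split_ifs <;> simp

theorem proj_sum (k : ℕ) {ι : Type*} (s : Finset ι) (f : ι → FormalFun 𝕜 A n r) :
    proj k (∑ i ∈ s, f i) = ∑ i ∈ s, proj k (f i) := by
  ext S α
  simp only [coeff_proj, coeff_sum]
  split_ifs <;> simp

theorem proj_bracket_proj {a b : ℕ} (k l : ℕ) (f g : FormalFun 𝕜 A n (a + b)) :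
    proj (k + l) (bracket a b (proj (k + 1) f) (proj (l + 1) g)) = bracket a b (proj (k + 1) f) (proj (l + 1) g) := by
  unfold bracket
  simp only [sub_eq_add_neg, proj_add, proj_neg ht, proj_sum ht, proj_zsmul ht, ← proj_parity ht, ← dEven_proj ht, ← dOdd_proj ht,
    proj_mul_proj ht]

/-- As for products, with one difference: components of degree zero are constants, whose brackets
vanish, and they are treated apart because the rescaling formula requires both degrees to be
positive. -/
theorem contract_bracket {a b : ℕ} {φ : FormalFun 𝕜 A n (a + b) → FormalFun 𝕜 A n (a + b)} (h : Filtered φ)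
    (hc : ∀ c, φ (const c) = const c)
    (hb : ∀ f g, φ (bracket a b f g) = bracket a b (φ f) (φ g)) (f g : FormalFun 𝕜 A n (a + b)) :
    contract t φ (bracket a b f g) = bracket a b (contract t φ f) (contract t φ g) := by
  have hC := (contract_filtered t h).cts
  refine (hC.comp (Cts.bracket_left g)).eq_of_proj ((Cts.bracket_left (contract t φ g)).comp hC) f fun k => ?_
  refine (hC.comp (Cts.bracket_right (proj k f))).eq_of_proj ((Cts.bracket_right (contract t φ (proj k f))).comp hC) g
    fun l => ?_
  rcases k with _ | k
  · rw [proj_zero_eq, contract_const ht h hc, bracket_const_left, bracket_const_left, (contract_filtered t h).zero]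
  rcases l with _ | l
  · rw [proj_zero_eq g, contract_const ht h hc, bracket_const_right, bracket_const_right, (contract_filtered t h).zero]
  rw [contract_homog ht h (proj_bracket_proj ht k l f g), contract_proj t h, contract_proj t h,
    bracket_rescale ht (h.mem _ _ (proj_mem_filtration _ f)) (h.mem _ _ (proj_mem_filtration _ g)), hb]

end even

end FormalFun
end SuperGeom
end

/-! ### Contraction of automorphisms and contractibility of `Aut / Sp` -/

noncomputable section
namespace SuperGeom
open FormalFun

section
variable {𝕜 A : Type*} [CommRing 𝕜] [Ring A] [Algebra 𝕜 A] [SuperAlgebra 𝕜 A] {n a b : ℕ}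

theorem formalAut.filtered (φ : formalAut 𝕜 A n a b) : Filtered (φ.1 : FormalFun 𝕜 A n (a + b) → FormalFun 𝕜 A n (a + b)) :=
  ⟨map_add φ.1, fun k f hf => (φ.2.2.2.2 k f).2 hf⟩

theorem formalAut.const_mul (φ : formalAut 𝕜 A n a b) (c : A) (f : FormalFun 𝕜 A n (a + b)) :
    φ.1 (const c * f) = const c * φ.1 f := by rw [map_mul, φ.2.1]

theorem formalAut.ext_gen {φ ψ : formalAut 𝕜 A n a b} (h : ∀ k, φ.1 (gen k) = ψ.1 (gen k)) : φ = ψ := by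
  apply Subtype.ext
  have := ringHom_ext (Φ := φ.1.toRingEquiv.toRingHom) (Ψ := ψ.1.toRingEquiv.toRingHom)
    (formalAut.filtered φ).mem (formalAut.filtered ψ).mem (fun c => (φ.2.1 c).trans (ψ.2.1 c).symm) h
  exact AlgEquiv.ext fun f => RingHom.congr_fun this f

/-- The contraction of an automorphism to its linear part. -/
def contractAut (t : A) (ht : SuperAlgebra.parity (𝕜 := 𝕜) t = t) (φ : formalAut 𝕜 A n a b) : formalAut 𝕜 A n a b :=
  ⟨AlgEquiv.ofRingEquiv (f := RingEquiv.mk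
    -- The inverse is the contraction of `φ⁻¹`, by compatibility with composition and `contract_id`;
    -- `t` need not be invertible.
    ⟨contract t φ.1, contract t φ⁻¹.1,
      fun f => by
        have h := contract_comp ht (formalAut.filtered φ⁻¹) (formalAut.const_mul _) (formalAut.filtered φ) f
        have e : (fun f => φ⁻¹.1 (φ.1 f)) = fun f => f := funext fun f => φ.1.symm_apply_apply f
        rw [h, e, contract_id],
      fun f => by
        have h := contract_comp ht (formalAut.filtered φ) (formalAut.const_mul _) (formalAut.filtered φ⁻¹) f
        have e : (fun f => φ.1 (φ⁻¹.1 f)) = fun f => f := funext fun f => φ.1.apply_symm_apply f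
        rw [h, e, contract_id]⟩
    (contract_mul ht (formalAut.filtered φ) (map_mul φ.1)) (contract_filtered t (formalAut.filtered φ)).add)
    (fun c => by
      rw [algebraMap_eq_const]
      exact contract_const ht (formalAut.filtered φ) φ.2.1 _),
  fun c => contract_const ht (formalAut.filtered φ) φ.2.1 _,
  contract_parity ht (formalAut.filtered φ) φ.2.2.1,
  contract_bracket ht (formalAut.filtered φ) φ.2.1 φ.2.2.2.1,
  fun k f => ⟨fun hf => by
      have h := (contract_filtered t (formalAut.filtered φ⁻¹)).mem k _ hf
      have h' := contract_comp ht (formalAut.filtered φ⁻¹) (formalAut.const_mul _) (formalAut.filtered φ) f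
      have e : (fun f => φ⁻¹.1 (φ.1 f)) = fun f => f := funext fun f => φ.1.symm_apply_apply f
      rw [e, contract_id] at h'
      have h2 : contract t (⇑φ⁻¹.1) (contract t (⇑φ.1) f) ∈ filtration k := h
      rw [h'] at h2
      exact h2,
    (contract_filtered t (formalAut.filtered φ)).mem k f⟩⟩

theorem contractAut_apply (t : A) (ht : SuperAlgebra.parity (𝕜 := 𝕜) t = t) (φ : formalAut 𝕜 A n a b) (f) :
    (contractAut t ht φ).1 f = contract t φ.1 f := rfl

theorem contractAut_mul (t : A) (ht : SuperAlgebra.parity (𝕜 := 𝕜) t = t) (φ ψ : formalAut 𝕜 A n a b) :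
    contractAut t ht (φ * ψ) = contractAut t ht φ * contractAut t ht ψ :=
  Subtype.ext <| AlgEquiv.ext fun f =>
    (contract_comp ht (formalAut.filtered φ) (formalAut.const_mul _) (formalAut.filtered ψ) f).symm

theorem contractAut_one_left (ht) (φ : formalAut 𝕜 A n a b) : contractAut 1 ht φ = φ :=
  Subtype.ext <| AlgEquiv.ext fun f => congrFun (contract_one (formalAut.filtered φ)) f

theorem gen_mem_linearFun {r : ℕ} (k) : (gen k : FormalFun 𝕜 A n r) ∈ linearFun := by
  intro S α h
  rcases k with i | j <;> · simp only [gen]; rw [coeff_mono, if_neg]; rintro ⟨rfl, rfl⟩; simp at h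

theorem mem_linearFun_iff {r : ℕ} (f : FormalFun 𝕜 A n r) : f ∈ linearFun ↔ proj 1 f = f := by
  constructor
  · intro h
    ext S α
    rw [coeff_proj]
    split_ifs with hd
    · rfl
    · exact (h S α hd).symm
  · intro h S α hd
    rw [← h, coeff_proj, if_neg hd]

/-- An automorphism is determined by its values on the variables. A linear one sends them to
elements of degree one, which rescaling with shift one leaves alone. -/
theorem contractAut_of_linear (t : A) (ht : SuperAlgebra.parity (𝕜 := 𝕜) t = t) {φ : formalAut 𝕜 A n a b}
    (hφ : φ ∈ linearAut 𝕜 A n a b) : contractAut t ht φ = φ := by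
  apply formalAut.ext_gen
  intro k
  have h1 := gen_mem_linearFun (𝕜 := 𝕜) (A := A) (n := n) k
  have h2 := (hφ (gen k)).2 h1
  rw [contractAut_apply, contract_homog ht (formalAut.filtered φ) ((mem_linearFun_iff _).1 h1)]
  ext S α
  rw [coeff_rescale]
  by_cases hd : α.degree + S.card = 1
  · simp [deg, hd]
  · rw [h2 S α hd, mul_zero]

/-- The factor `0^(d - 1)` removes all terms of degree above one from the image of a linear
function, and the filtration excludes those of degree zero. -/
theorem contractAut_zero_mem (φ : formalAut 𝕜 A n a b) : contractAut 0 (map_zero _) φ ∈ linearAut 𝕜 A n a b := by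
  have key : ∀ (φ : formalAut 𝕜 A n a b) f, f ∈ linearFun → (contractAut 0 (map_zero _) φ).1 f ∈ linearFun := by
    intro φ f hf S α hd
    rw [mem_linearFun_iff] at hf
    rw [contractAut_apply, contract_homog (map_zero _) (formalAut.filtered φ) hf, coeff_rescale]
    rcases Nat.lt_or_gt_of_ne hd with h | h
    · rw [(formalAut.filtered φ).mem 1 f (hf ▸ proj_mem_filtration 1 f) S α h, mul_zero]
    · rw [zero_pow, zero_mul]
      simp only [deg]
      omega
  intro f
  refine ⟨fun h => ?_, key φ f⟩
  -- For the converse inclusion, the contraction of `φ⁻¹` also preserves linear functions, and it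
  -- inverts the contraction of `φ`.
  have h2 := key φ⁻¹ _ h
  have h3 : contractAut 0 (map_zero _) φ⁻¹ * contractAut 0 (map_zero _) φ = (1 : formalAut 𝕜 A n a b) := by
    rw [← contractAut_mul, inv_mul_cancel]
    exact contractAut_of_linear _ _ (linearAut 𝕜 A n a b).one_mem
  have h4 : (contractAut 0 (map_zero _) φ⁻¹).1 ((contractAut 0 (map_zero _) φ).1 f) = f :=
    congrArg (fun χ : formalAut 𝕜 A n a b => χ.1 f) h3
  rwa [h4] at h2

end

section
variable {𝕜 A : Type*} [CommRing 𝕜] [Ring A] [Algebra 𝕜 A] [SuperAlgebra 𝕜 A] {n a b : ℕ} [TopologicalSpace A]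

theorem continuous_formalAut_rng {Y : Type*} [TopologicalSpace Y] {F : Y → formalAut 𝕜 A n a b}
    (h : ∀ f S α, Continuous fun y => coeff S α ((F y).1 f)) : Continuous F := by
  rw [continuous_induced_rng, continuous_pi_iff]
  rintro ⟨f, S, α⟩
  exact h f S α

theorem continuous_coeff_formalAut (f S α) : Continuous fun φ : formalAut 𝕜 A n a b => coeff S α (φ.1 f) := by
  have h : Continuous fun (φ : formalAut 𝕜 A n a b)
      (p : FormalFun 𝕜 A n (a + b) × Finset (Fin (a + b)) × ((Fin n ⊕ Fin n) →₀ ℕ)) => coeff p.2.1 p.2.2 (φ.1 p.1) :=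
    continuous_induced_dom
  exact (continuous_pi_iff.1 h) (f, S, α)

/-- Right translation by `γ` is continuous because it merely replaces evaluation at `f` by
evaluation at `γ f`; no continuity of the group law in both variables is needed. Openness matters
because open quotient maps remain quotient maps after a product with the interval. -/
theorem isOpenQuotientMap_linearAut :
    IsOpenQuotientMap (QuotientGroup.mk : formalAut 𝕜 A n a b → formalAut 𝕜 A n a b ⧸ linearAut 𝕜 A n a b) := by
  have : ContinuousConstSMul (linearAut 𝕜 A n a b).op (formalAut 𝕜 A n a b) :=
    ⟨fun γ => continuous_formalAut_rng fun f S α => continuous_coeff_formalAut (γ.1.unop.1 f) S α⟩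
  exact MulAction.isOpenQuotientMap_quotientMk

end

/-- `Aut_{2n|a,b}(A) / Sp(2n|a,b)(A)` is contractible. -/
theorem contractibleSpace_formalAut_quotient {𝕜 : Type*} [RCLike 𝕜] (A : Type*) [Ring A] [Algebra 𝕜 A] [SuperAlgebra 𝕜 A]
    [TopologicalSpace A] [IsTopologicalRing A] [ContinuousSMul 𝕜 A] (n a b : ℕ) :
    ContractibleSpace (formalAut 𝕜 A n a b ⧸ linearAut 𝕜 A n a b) := by
  let t : unitInterval → A := fun s => algebraMap 𝕜 A ((s : ℝ) : 𝕜)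
  have ht : ∀ s, SuperAlgebra.parity (𝕜 := 𝕜) (t s) = t s := fun s => AlgHom.commutes _ _
  have htc : Continuous t := (continuous_algebraMap 𝕜 A).comp (RCLike.continuous_ofReal.comp continuous_subtype_val)
  -- The contraction is well defined on cosets: if `ψ = φ h` with `h` linear, then the contractions
  -- satisfy `ψ_t = φ_t h`.
  let F : unitInterval × (formalAut 𝕜 A n a b ⧸ linearAut 𝕜 A n a b) → formalAut 𝕜 A n a b ⧸ linearAut 𝕜 A n a b := fun p =>
    Quotient.map' (contractAut (t p.1) (ht p.1)) (fun φ ψ h => by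
      rw [QuotientGroup.leftRel_apply] at h ⊢
      have e : ψ = φ * (φ⁻¹ * ψ) := by group
      rw [e, contractAut_mul, contractAut_of_linear _ _ h]
      simpa using h) p.2
  have hF : Continuous F := by
    -- Continuity is tested on the interval times the group, where each coefficient is a finite sum
    -- of powers of `t` times coefficients of `φ`.
    rw [← (IsOpenQuotientMap.id.prodMap isOpenQuotientMap_linearAut).continuous_comp_iff]
    change Continuous fun p : unitInterval × formalAut 𝕜 A n a b => (QuotientGroup.mk (contractAut (t p.1) (ht p.1) p.2))
    refine QuotientGroup.continuous_mk.comp (continuous_formalAut_rng fun f S α => ?_)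
    simp only [contractAut_apply, coeff_contract]
    refine continuous_finsetSum _ fun k _ => ?_
    exact ((htc.comp continuous_fst).pow _).mul ((continuous_coeff_formalAut _ S α).comp continuous_snd)
  rw [contractible_iff_id_nullhomotopic]
  -- The homotopy starts at the constant map (`t = 0`) and ends at the identity (`t = 1`), hence the
  -- reversal.
  refine ⟨QuotientGroup.mk 1, ContinuousMap.Homotopic.symm ⟨⟨⟨F, hF⟩, ?_, ?_⟩⟩⟩
  · intro q
    induction q using QuotientGroup.induction_on with | _ φ
    change QuotientGroup.mk (contractAut (t 0) (ht 0) φ) = QuotientGroup.mk 1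
    rw [eq_comm, QuotientGroup.eq]
    have h0 : t 0 = 0 := by simp [t]
    have := contractAut_zero_mem φ
    simpa [h0] using this
  · intro q
    induction q using QuotientGroup.induction_on with | _ φ
    change QuotientGroup.mk (contractAut (t 1) (ht 1) φ) = QuotientGroup.mk φ
    have h1 : t 1 = 1 := by simp [t]
    congr 1
    simp only [h1]
    exact contractAut_one_left _ φ

end SuperGeom
end

/-! ### Graded Leibniz rules and frames of supercommuting vector fields -/

noncomputable section
namespace SuperGeom
open FormalFun

section
variable {𝕜 A : Type*} [CommRing 𝕜] [Ring A] [Algebra 𝕜 A] [SuperAlgebra 𝕜 A]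

theorem parity_twist (k : ℕ) (a : A) :
    SuperAlgebra.parity (𝕜 := 𝕜) (twist 𝕜 k a) = twist 𝕜 k (SuperAlgebra.parity (𝕜 := 𝕜) a) := by
  rw [← twist_one 𝕜, ← twist_one 𝕜, twist_comm]

theorem koszul_singleton_swap {r : ℕ} {j : Fin r} {S : Finset (Fin r)} (h : j ∉ S) :
    koszul S {j} = (-1) ^ S.card * koszul {j} S := by
  rw [koszul_swap (Finset.disjoint_singleton_right.2 h), Finset.card_singleton, mul_one]

theorem koszul_insert_left {r : ℕ} {j : Fin r} {S : Finset (Fin r)} (h : j ∉ S) (U : Finset (Fin r)) :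
    koszul (insert j S) U = koszul {j} U * koszul S U :=
  koszul_union_left (S := {j}) U (Finset.disjoint_singleton_left.2 h)

theorem koszul_insert_right {r : ℕ} {j : Fin r} {S : Finset (Fin r)} (h : j ∉ S) (U : Finset (Fin r)) :
    koszul U (insert j S) = koszul U {j} * koszul U S :=
  koszul_union_right (T := {j}) U (Finset.disjoint_singleton_left.2 h)

/-- The left derivative in `θ_j`. -/
def Gr.deriv {r : ℕ} (j : Fin r) (f : Gr 𝕜 A r) : Gr 𝕜 A r :=
  fun S => if j ∈ S then 0 else koszul {j} S • SuperAlgebra.parity (𝕜 := 𝕜) (f (insert j S))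

theorem Gr.deriv_apply {r : ℕ} (j : Fin r) (f : Gr 𝕜 A r) (S) :
    Gr.deriv j f S = if j ∈ S then 0 else koszul {j} S • SuperAlgebra.parity (𝕜 := 𝕜) (f (insert j S)) := rfl

theorem Gr.deriv_add {r : ℕ} (j : Fin r) (f g : Gr 𝕜 A r) : Gr.deriv j (f + g) = Gr.deriv j f + Gr.deriv j g := by
  ext S
  simp only [Gr.deriv_apply, Gr.add_apply, map_add, smul_add]
  split_ifs <;> simp

theorem Gr.deriv_smul {r : ℕ} (j : Fin r) (c : 𝕜) (f : Gr 𝕜 A r) : Gr.deriv j (c • f) = c • Gr.deriv j f := by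
  ext S
  simp only [Gr.deriv_apply, Gr.smul_apply, map_smul]
  split_ifs <;> simp

theorem Gr.parity_deriv {r : ℕ} (j : Fin r) (f : Gr 𝕜 A r) :
    SuperAlgebra.parity (𝕜 := 𝕜) (Gr.deriv j f) = -Gr.deriv j (SuperAlgebra.parity (𝕜 := 𝕜) f) := by
  ext S
  rw [Gr.parity_apply, Gr.deriv_apply, Gr.neg_apply, Gr.deriv_apply]
  split_ifs with h
  · simp
  · rw [Gr.parity_apply, Finset.card_insert_of_notMem h]
    simp only [map_zsmul, smul_smul, pow_succ, ← neg_smul]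
    congr 1
    ring

/-- The coefficient at `T` is a sum over splittings of an index set, and the position of `j` decides
what happens. The signs are reconciled by `koszul_mul_self` and the bimultiplicativity of `koszul`.
-/
theorem Gr.deriv_mul {r : ℕ} (j : Fin r) (f g : Gr 𝕜 A r) :
    Gr.deriv j (f * g) = Gr.deriv j f * g + SuperAlgebra.parity (𝕜 := 𝕜) f * Gr.deriv j g := by
  ext T
  rw [Gr.deriv_apply, Gr.add_apply, Gr.mul_apply (Gr.deriv j f), Gr.mul_apply (SuperAlgebra.parity (𝕜 := 𝕜) f)]
  simp only [Gr.deriv_apply, Gr.parity_apply]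
  by_cases hj : j ∈ T
  -- Here the left side is zero. On the right, the term with `j` in the second factor of a splitting
  -- of `T \ {j}` cancels the term with `j` in the first.
  · rw [if_pos hj, ← Finset.insert_erase hj]
    set T' := T.erase j with hT'
    have hjT : j ∉ T' := Finset.notMem_erase j T
    rw [Finset.sum_powerset_insert hjT, Finset.sum_powerset_insert hjT]
    simp only [← Finset.sum_add_distrib]
    refine (Finset.sum_eq_zero fun S hS => ?_).symm
    rw [Finset.mem_powerset] at hS
    have hjS : j ∉ S := fun h => hjT (hS h)
    have hjU : j ∉ T' \ S := fun h => hjT (Finset.sdiff_subset h)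
    have e1 : insert j T' \ S = insert j (T' \ S) := Finset.insert_sdiff_of_notMem _ hjS
    have e2 : insert j T' \ insert j S = T' \ S := by
      rw [Finset.insert_sdiff_insert, Finset.sdiff_insert, Finset.erase_eq_of_notMem hjU]
    rw [e1, e2]
    simp only [hjS, hjU, if_false, Finset.mem_insert_self, if_true, map_zero, mul_zero, zero_mul, smul_zero, zero_add, add_zero,
      Finset.card_insert_of_notMem hjS, koszul_insert_left hjS, koszul_insert_right hjU, koszul_singleton_swap hjS, twist_add _ S.card 1,
      twist_one, map_zsmul, SuperAlgebra.parity_parity, smul_mul_assoc, mul_smul_comm, smul_smul]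
    rw [← add_smul]
    convert zero_smul ℤ _
    have h1 := koszul_mul_self {j} S
    have h2 := koszul_mul_self {j} (T' \ S)
    linear_combination (koszul S (T' \ S) * (-1) ^ S.card) * h1 - (koszul S (T' \ S) * (-1) ^ S.card) * h2
  -- Here the splittings of `T ∪ {j}` are sorted by the factor that contains `j`; the two kinds give
  -- the two summands of the rule.
  · rw [if_neg hj, Gr.mul_apply, Finset.sum_powerset_insert hj, ← Finset.sum_add_distrib, ← Finset.sum_add_distrib, map_sum, Finset.smul_sum]
    refine Finset.sum_congr rfl fun S hS => ?_
    rw [Finset.mem_powerset] at hS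
    have hjS : j ∉ S := fun h => hj (hS h)
    have hjU : j ∉ T \ S := fun h => hj (Finset.sdiff_subset h)
    have e1 : insert j T \ S = insert j (T \ S) := Finset.insert_sdiff_of_notMem _ hjS
    have e2 : insert j T \ insert j S = T \ S := by
      rw [Finset.insert_sdiff_insert, Finset.sdiff_insert, Finset.erase_eq_of_notMem hjU]
    have e3 : koszul {j} T = koszul {j} S * koszul {j} (T \ S) := by
      conv_lhs => rw [← Finset.union_sdiff_of_subset hS]
      exact koszul_union_right _ Finset.disjoint_sdiff
    rw [e1, e2, e3, add_comm]
    simp only [hjS, hjU, if_false, map_add, smul_add, map_mul, parity_twist,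
      Finset.card_insert_of_notMem hjS, koszul_insert_left hjS, koszul_insert_right hjU, koszul_singleton_swap hjS, twist_add _ S.card 1,
      twist_one, map_zsmul, SuperAlgebra.parity_parity, smul_mul_assoc, mul_smul_comm, smul_smul]
    have h1 := koszul_mul_self {j} S
    have h2 := koszul_mul_self {j} (T \ S)
    congr 2
    · linear_combination (koszul S (T \ S) * koszul {j} S) * h2
    · linear_combination (koszul S (T \ S) * koszul {j} (T \ S) * (-1) ^ S.card) * h1

theorem Gr.deriv_deriv {r : ℕ} (j l : Fin r) (f : Gr 𝕜 A r) : Gr.deriv j (Gr.deriv l f) = -Gr.deriv l (Gr.deriv j f) := by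
  ext S
  simp only [Gr.deriv_apply, Gr.neg_apply, Finset.mem_insert]
  by_cases hj : j ∈ S
  · simp [hj]
  by_cases hl : l ∈ S
  · simp [hl]
  by_cases hjl : j = l
  · simp [hjl]
  have hjl' : l ≠ j := fun h => hjl h.symm
  have h1 : koszul {l} {j} = -koszul {j} {l} := by
    rw [koszul_swap (by simpa using hjl')]; simp
  simp only [hj, hl, hjl, hjl', if_false, or_self, map_zsmul, SuperAlgebra.parity_parity, smul_smul, koszul_insert_right hj,
    koszul_insert_right hl, h1, Finset.insert_comm l j, ← neg_smul]
  congr 1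
  ring

end

section
variable (𝕜 A : Type*) [CommRing 𝕜] [Ring A] [Algebra 𝕜 A] [SuperAlgebra 𝕜 A] (n r : ℕ)

/-- A family of supercommuting superderivations, of the parities of the coordinate vector fields. -/
structure Frame where
  D : (Fin n ⊕ Fin n) ⊕ Fin r → Module.End 𝕜 A
  der : ∀ k, D k ∈ superDer 𝕜 A (coordParity k)
  comm : ∀ k l a, D k (D l a) = (-1 : ℤ) ^ ((coordParity k).val * (coordParity l).val) • D l (D k a)

end

section
variable {𝕜 A : Type*} [CommRing 𝕜] [Ring A] [Algebra 𝕜 A] [SuperAlgebra 𝕜 A] {n r : ℕ}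

theorem Frame.even_even (F : Frame 𝕜 A n r) (i j : Fin n ⊕ Fin n) (a : A) : F.D (.inl i) (F.D (.inl j) a) = F.D (.inl j) (F.D (.inl i) a) := by
  simpa [coordParity] using F.comm (.inl i) (.inl j) a

theorem Frame.odd_even (F : Frame 𝕜 A n r) (j : Fin r) (i : Fin n ⊕ Fin n) (a : A) : F.D (.inr j) (F.D (.inl i) a) = F.D (.inl i) (F.D (.inr j) a) := by
  simpa [coordParity] using F.comm (.inr j) (.inl i) a

theorem Frame.odd_odd (F : Frame 𝕜 A n r) (j l : Fin r) (a : A) : F.D (.inr j) (F.D (.inr l) a) = -F.D (.inr l) (F.D (.inr j) a) := by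
  have h : (1 : ZMod 2).val = 1 := rfl
  simpa [coordParity, h] using F.comm (.inr j) (.inr l) a

theorem Frame.leibniz (F : Frame 𝕜 A n r) (k) (a b : A) :
    F.D k (a * b) = F.D k a * b + twist 𝕜 (coordParity k).val a * F.D k b := (F.der k).2 a b

theorem Frame.D_parity (F : Frame 𝕜 A n r) (k) (a : A) :
    SuperAlgebra.parity (𝕜 := 𝕜) (F.D k a) = (-1 : ℤ) ^ (coordParity k).val • F.D k (SuperAlgebra.parity (𝕜 := 𝕜) a) := (F.der k).1 a

namespace FormalFun

/-- This is the Leibniz rule at the level of exponents. If `p + q` is `α` plus one unit at `i`, then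
`α i + 1 = p i + q i`. In the sum weighted by `p i` the terms with `p i = 0` drop out, and the
others are reindexed by raising `p` at `i`; likewise for `q`. -/
theorem sum_antidiagonal_deriv {ι M : Type*} [AddCommMonoid M] [DecidableEq ι] (i : ι) (α : ι →₀ ℕ)
    (H : (ι →₀ ℕ) → (ι →₀ ℕ) → M) :
    (α i + 1) • ∑ p ∈ Finset.HasAntidiagonal.antidiagonal (α + Finsupp.single i 1), H p.1 p.2 =
      ∑ p ∈ Finset.HasAntidiagonal.antidiagonal α, (p.1 i + 1) • H (p.1 + Finsupp.single i 1) p.2 +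
      ∑ p ∈ Finset.HasAntidiagonal.antidiagonal α, (p.2 i + 1) • H p.1 (p.2 + Finsupp.single i 1) := by
  have key : ∀ G : (ι →₀ ℕ) → (ι →₀ ℕ) → M, ∑ p ∈ Finset.HasAntidiagonal.antidiagonal α, ((p.1 : ι →₀ ℕ) i + 1) • G (p.1 + Finsupp.single i 1) p.2 =
      ∑ p ∈ Finset.HasAntidiagonal.antidiagonal (α + Finsupp.single i 1), (p.1 : ι →₀ ℕ) i • G p.1 p.2 := by
    intro G
    refine Finset.sum_of_injOn (fun p => (p.1 + Finsupp.single i 1, p.2)) ?_ ?_ ?_ ?_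
    · rintro ⟨a, b⟩ _ ⟨c, d⟩ _ h
      simpa using h
    · rintro ⟨a, b⟩ h
      simp only [Finset.mem_coe, Finset.HasAntidiagonal.mem_antidiagonal] at h ⊢
      rw [← h, add_right_comm]
    · rintro ⟨a, b⟩ h hn
      rw [Finset.HasAntidiagonal.mem_antidiagonal] at h
      by_cases ha : a i = 0
      · simp [ha]
      · exfalso
        have hs : Finsupp.single i 1 ≤ a := by
          rw [Finsupp.single_le_iff]; omega
        refine hn ⟨(a - Finsupp.single i 1, b), ?_, ?_⟩
        · simp only [Finset.mem_coe, Finset.HasAntidiagonal.mem_antidiagonal]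
          apply add_right_cancel (b := Finsupp.single i 1)
          rw [← h, add_right_comm, tsub_add_cancel_of_le hs]
        · simp [tsub_add_cancel_of_le hs]
    · rintro ⟨a, b⟩ _
      simp
  have key2 : ∑ p ∈ Finset.HasAntidiagonal.antidiagonal α, (p.2 i + 1) • H p.1 (p.2 + Finsupp.single i 1) =
      ∑ p ∈ Finset.HasAntidiagonal.antidiagonal (α + Finsupp.single i 1), (p.2 : ι →₀ ℕ) i • H p.1 p.2 := by
    have sw : ∀ (β : ι →₀ ℕ) (G : (ι →₀ ℕ) × (ι →₀ ℕ) → M),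
        ∑ p ∈ Finset.HasAntidiagonal.antidiagonal β, G p = ∑ p ∈ Finset.HasAntidiagonal.antidiagonal β, G p.swap := fun β G =>
      Finset.sum_equiv (Equiv.prodComm _ _)
        (fun p => by simp [Finset.HasAntidiagonal.mem_antidiagonal, add_comm p.2]) fun p _ => by simp
    rw [sw, sw (α + _)]
    exact key fun a b => H b a
  rw [key, key2, ← Finset.sum_add_distrib, Finset.smul_sum]
  refine Finset.sum_congr rfl fun p hp => ?_
  rw [Finset.HasAntidiagonal.mem_antidiagonal] at hp
  rw [← add_smul]
  congr 1
  have := DFunLike.congr_fun hp i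
  simpa using this.symm

theorem dEven_mul (i : Fin n ⊕ Fin n) (f g : FormalFun 𝕜 A n r) : dEven i (f * g) = dEven i f * g + f * dEven i g := by
  classical
  ext T α
  rw [coeff_dEven, coeff_add, coeff_mul, coeff_mul, coeff_mul, ← Finset.sum_add_distrib, Finset.smul_sum]
  refine Finset.sum_congr rfl fun S _ => ?_
  have := sum_antidiagonal_deriv i α fun p q => koszul S (T \ S) • (coeff S p f * twist 𝕜 S.card (coeff (T \ S) q g))
  rw [this]
  congr 1
  · refine Finset.sum_congr rfl fun p _ => ?_
    rw [coeff_dEven, smul_mul_assoc, smul_comm]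
  · refine Finset.sum_congr rfl fun p _ => ?_
    rw [coeff_dEven, map_nsmul, mul_smul_comm, smul_comm]

theorem dOdd_mul (j : Fin r) (f g : FormalFun 𝕜 A n r) :
    dOdd j (f * g) = dOdd j f * g + SuperAlgebra.parity (𝕜 := 𝕜) f * dOdd j g := Gr.deriv_mul j f g

theorem dOdd_dOdd (j l : Fin r) (f : FormalFun 𝕜 A n r) : dOdd j (dOdd l f) = -dOdd l (dOdd j f) := Gr.deriv_deriv j l f

theorem parity_dOdd (j : Fin r) (f : FormalFun 𝕜 A n r) :
    SuperAlgebra.parity (𝕜 := 𝕜) (dOdd j f) = -dOdd j (SuperAlgebra.parity (𝕜 := 𝕜) f) := Gr.parity_deriv j f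

theorem parity_dEven (i : Fin n ⊕ Fin n) (f : FormalFun 𝕜 A n r) :
    SuperAlgebra.parity (𝕜 := 𝕜) (dEven i f) = dEven i (SuperAlgebra.parity (𝕜 := 𝕜) f) := by
  ext S α
  rw [coeff_parity, coeff_dEven, coeff_dEven, coeff_parity, map_nsmul, smul_comm]

theorem dEven_dEven (i j : Fin n ⊕ Fin n) (f : FormalFun 𝕜 A n r) : dEven i (dEven j f) = dEven j (dEven i f) := by
  ext S α
  simp only [coeff_dEven, smul_smul, add_right_comm α (Finsupp.single i 1)]
  congr 1
  by_cases h : i = j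
  · rw [h]
  · simp [h, Ne.symm h, mul_comm]

theorem dOdd_dEven (j : Fin r) (i : Fin n ⊕ Fin n) (f : FormalFun 𝕜 A n r) : dOdd j (dEven i f) = dEven i (dOdd j f) := by
  ext S α
  simp only [coeff_dOdd, coeff_dEven]
  split_ifs
  · simp
  · rw [map_nsmul, smul_comm]

theorem dEven_smul (i : Fin n ⊕ Fin n) (c : 𝕜) (f : FormalFun 𝕜 A n r) : dEven i (c • f) = c • dEven i f := by
  ext S α
  rw [coeff_dEven, coeff_smul, coeff_smul, coeff_dEven, smul_comm]

variable (𝕜 A n r) in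
/-- The coordinate vector fields of the formal disk. -/
def frame : Frame 𝕜 (FormalFun 𝕜 A n r) n r where
  D
    | .inl i => { toFun := dEven i, map_add' := dEven_add i, map_smul' := dEven_smul i }
    | .inr j => { toFun := dOdd j, map_add' := dOdd_add j, map_smul' := fun c f => Gr.deriv_smul j c f }
  der
    | .inl i => ⟨fun f => by
        change SuperAlgebra.parity (𝕜 := 𝕜) (dEven i f) = (-1 : ℤ) ^ 0 • dEven i (SuperAlgebra.parity (𝕜 := 𝕜) f)
        rw [parity_dEven, pow_zero, one_smul], fun f g => by
        change dEven i (f * g) = dEven i f * g + twist 𝕜 0 f * dEven i g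
        rw [twist_zero, dEven_mul]⟩
    | .inr j => ⟨fun f => by
        change SuperAlgebra.parity (𝕜 := 𝕜) (dOdd j f) = (-1 : ℤ) ^ 1 • dOdd j (SuperAlgebra.parity (𝕜 := 𝕜) f)
        rw [parity_dOdd, pow_one, neg_one_smul], fun f g => by
        change dOdd j (f * g) = dOdd j f * g + twist 𝕜 1 f * dOdd j g
        rw [twist_one, dOdd_mul]⟩
  comm
    | .inl i, .inl j, f => by
        change dEven i (dEven j f) = (-1 : ℤ) ^ 0 • dEven j (dEven i f)
        rw [pow_zero, one_smul, dEven_dEven]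
    | .inl i, .inr j, f => by
        change dEven i (dOdd j f) = (-1 : ℤ) ^ 0 • dOdd j (dEven i f)
        rw [pow_zero, one_smul, dOdd_dEven]
    | .inr j, .inl i, f => by
        change dOdd j (dEven i f) = (-1 : ℤ) ^ 0 • dEven i (dOdd j f)
        rw [pow_zero, one_smul, dOdd_dEven]
    | .inr j, .inr l, f => by
        change dOdd j (dOdd l f) = (-1 : ℤ) ^ 1 • dOdd l (dOdd j f)
        rw [pow_one, neg_one_smul, dOdd_dOdd]

theorem frame_inl (i) (f : FormalFun 𝕜 A n r) : (frame 𝕜 A n r).D (.inl i) f = dEven i f := rfl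
theorem frame_inr (j) (f : FormalFun 𝕜 A n r) : (frame 𝕜 A n r).D (.inr j) f = dOdd j f := rfl

theorem frame_mem_filtration {k : ℕ} {f : FormalFun 𝕜 A n r} (hf : f ∈ filtration (k + 1)) (l) :
    (frame 𝕜 A n r).D l f ∈ filtration k := by
  rcases l with i | j
  · exact dEven_mem_filtration hf i
  · exact dOdd_mem_filtration hf j

theorem frame_const (l) (c : A) : (frame 𝕜 A n r).D l (const c : FormalFun 𝕜 A n r) = 0 := by
  rcases l with i | j
  · exact dEven_const i c
  · exact dOdd_const j c

theorem frame_gen (l m) : (frame 𝕜 A n r).D l (gen m) = if m = l then 1 else 0 := by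
  rw [← const_one]
  rcases l with i | j <;> rcases m with i' | j'
  · rw [frame_inl]
    by_cases h : i' = i
    · subst h
      rw [if_pos rfl]
      ext S α
      rw [coeff_dEven, gen, coeff_mono, coeff_const]
      by_cases hα : α = 0
      · simp [hα]
      · simp [hα]
    · rw [if_neg (by simpa using h)]
      ext S α
      rw [coeff_dEven, gen, coeff_mono, if_neg, smul_zero, coeff_zero]
      rintro ⟨-, h'⟩
      have := DFunLike.congr_fun h' i
      rw [Finsupp.add_apply, Finsupp.single_eq_same, Finsupp.single_apply, if_neg h] at this
      omega
  · rw [frame_inl, if_neg (by simp)]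
    ext S α
    rw [coeff_dEven, gen, coeff_mono, if_neg, smul_zero, coeff_zero]
    rintro ⟨-, h'⟩
    simpa using DFunLike.congr_fun h' i
  · rw [frame_inr, if_neg (by simp)]
    ext S α
    rw [coeff_dOdd, gen, coeff_zero]
    split_ifs with h
    · rfl
    · rw [coeff_mono, if_neg, map_zero, smul_zero]
      rintro ⟨h', -⟩
      exact Finset.insert_ne_empty _ _ h'
  · rw [frame_inr]
    by_cases h : j' = j
    · subst h
      rw [if_pos rfl]
      ext S α
      rw [coeff_dOdd, gen, coeff_const]
      by_cases hS : S = ∅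
      · subst hS
        by_cases hα : α = 0
        · simp [hα, coeff_mono, koszul_empty_right]
        · simp [hα, coeff_mono]
      · rw [if_neg (c := S = ∅ ∧ α = 0) (fun h' => hS h'.1)]
        split_ifs with hj
        · rfl
        · rw [coeff_mono, if_neg, map_zero, smul_zero]
          rintro ⟨h', -⟩
          apply hS
          rw [← Finset.erase_insert hj, h', Finset.erase_singleton]
    · rw [if_neg (by simpa using h)]
      ext S α
      rw [coeff_dOdd, gen, coeff_zero]
      split_ifs with hj
      · rfl
      · rw [coeff_mono, if_neg, map_zero, smul_zero]
        rintro ⟨h', -⟩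
        have : j ∈ ({j'} : Finset (Fin r)) := h' ▸ Finset.mem_insert_self j S
        exact h (Finset.mem_singleton.1 this).symm

end FormalFun
end

end SuperGeom
end

/-! ### Taylor expansion along a frame -/

noncomputable section
namespace SuperGeom
open FormalFun

section
variable {𝕜 A : Type*} [Field 𝕜] [CharZero 𝕜] [Ring A] [Algebra 𝕜 A] [SuperAlgebra 𝕜 A] {n r : ℕ}

/-- Any coefficient other than the constant term can be read off from a first derivative: an even
variable contributes a nonzero integer factor, invertible in characteristic zero, and an odd one
only a sign and a parity. -/
theorem FormalFun.mem_filtration_succ_of_frame {N : ℕ} {z : FormalFun 𝕜 A n r} (h0 : coeff ∅ 0 z = 0)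
    (hD : ∀ k, (frame 𝕜 A n r).D k z ∈ filtration N) : z ∈ filtration (N + 1) := by
  intro S α hd
  by_cases hS : S = ∅
  · by_cases hα : α = 0
    · rw [hS, hα, h0]
    obtain ⟨i, hi⟩ := Finsupp.ne_iff.1 hα
    have hs : Finsupp.single i 1 ≤ α := by
      rw [Finsupp.single_le_iff]
      exact Nat.one_le_iff_ne_zero.2 hi
    have e := tsub_add_cancel_of_le hs
    have h := hD (.inl i) S (α - Finsupp.single i 1) (by
      have h2 := congrArg Finsupp.degree e
      rw [map_add, Finsupp.degree_single] at h2
      omega)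
    rw [frame_inl, coeff_dEven, e, ← Nat.cast_smul_eq_nsmul 𝕜] at h
    exact (smul_eq_zero_iff_right (Nat.cast_ne_zero.2 (Nat.succ_ne_zero _))).1 h
  · obtain ⟨j, hj⟩ := Finset.nonempty_iff_ne_empty.2 hS
    have h := hD (.inr j) (S.erase j) α (by
      have := Finset.card_erase_add_one hj
      omega)
    rw [frame_inr, coeff_dOdd, if_neg (Finset.notMem_erase j S), Finset.insert_erase hj] at h
    have h2 := congrArg (fun x => SuperAlgebra.parity (𝕜 := 𝕜) (koszul {j} (S.erase j) • x)) h
    simpa only [map_zsmul, SuperAlgebra.parity_parity, smul_smul, koszul_mul_self, one_smul, smul_zero, map_zero] using h2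

/-- A formal function all of whose iterated derivatives have zero constant term vanishes. -/
theorem FormalFun.eq_zero_of_frame (Z : AddSubgroup (FormalFun 𝕜 A n r)) (h0 : ∀ z ∈ Z, coeff ∅ 0 z = 0)
    (hD : ∀ k, ∀ z ∈ Z, (frame 𝕜 A n r).D k z ∈ Z) (z : FormalFun 𝕜 A n r) (hz : z ∈ Z) : z = 0 := by
  have key : ∀ N, ∀ z ∈ Z, z ∈ filtration N := by
    intro N
    induction N with
    | zero => exact fun z _ => mem_filtration_zero z
    | succ N ih => exact fun z hz => mem_filtration_succ_of_frame (h0 z hz) fun k => ih _ (hD k z hz)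
  ext S α
  exact key (deg S α + 1) z hz S α (Nat.lt_succ_self _)

namespace Frame
variable (F : Frame 𝕜 A n r)

/-- Commutation makes the unordered product of powers of the even fields meaningful in the
noncommutative ring of endomorphisms. -/
theorem pairwise_commute_even : Pairwise fun i j : Fin n ⊕ Fin n => ∀ x y : Multiplicative ℕ,
    Commute (powersHom (Module.End 𝕜 A) (F.D (.inl i)) x) (powersHom (Module.End 𝕜 A) (F.D (.inl j)) y) := fun i j _ x y =>
  (show Commute (F.D (.inl i)) (F.D (.inl j)) from LinearMap.ext (F.even_even i j)).pow_pow _ _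

/-- The iterated even derivative `D^α`. -/
def evenPow (α : (Fin n ⊕ Fin n) →₀ ℕ) : Module.End 𝕜 A :=
  MonoidHom.noncommPiCoprod (fun i => powersHom (Module.End 𝕜 A) (F.D (.inl i))) F.pairwise_commute_even
    (fun i => Multiplicative.ofAdd (α i))

theorem evenPow_zero : F.evenPow 0 = 1 := by
  unfold evenPow
  exact map_one _

theorem evenPow_add_single (α : (Fin n ⊕ Fin n) →₀ ℕ) (i : Fin n ⊕ Fin n) :
    F.evenPow (α + Finsupp.single i 1) = F.evenPow α * F.D (.inl i) := by
  unfold evenPow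
  have e : (fun j => Multiplicative.ofAdd ((α + Finsupp.single i 1 : (Fin n ⊕ Fin n) →₀ ℕ) j)) =
      (fun j => Multiplicative.ofAdd (α j)) * Pi.mulSingle i (Multiplicative.ofAdd 1) := by
    funext j
    rw [Pi.mul_apply, Finsupp.add_apply, ofAdd_add]
    congr 1
    by_cases h : j = i
    · subst h; simp
    · simp [h]
  rw [e, map_mul, MonoidHom.noncommPiCoprod_mulSingle]
  simp

theorem commute_evenPow {X : Module.End 𝕜 A} (h : ∀ i, Commute X (F.D (.inl i))) (α) : Commute X (F.evenPow α) :=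
  MonoidHom.commute_noncommPiCoprod _ (fun i x => (h i).pow_right _) _

/-- The coefficient of `θ_{s_1} ⋯ θ_{s_k}` in the odd Taylor expansion, as a differential operator. -/
def oddList : List (Fin r) → Module.End 𝕜 A
  | [] => 1
  | s :: l => (SuperAlgebra.parity (𝕜 := 𝕜) : A →ₐ[𝕜] A).toLinearMap ∘ₗ oddList l ∘ₗ F.D (.inr s)

/-- The coefficient of `θ^S` in the odd Taylor expansion. -/
def oddPow (S : Finset (Fin r)) : Module.End 𝕜 A := F.oddList (S.sort (· ≤ ·))

theorem oddPow_insert_of_lt {j : Fin r} {S : Finset (Fin r)} (h : ∀ i ∈ S, j < i) (f : A) :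
    F.oddPow (insert j S) f = SuperAlgebra.parity (𝕜 := 𝕜) (F.oddPow S (F.D (.inr j) f)) := by
  unfold oddPow
  rw [Finset.sort_insert (· ≤ ·) (fun b hb => (h b hb).le) (fun hj => lt_irrefl _ (h j hj))]
  rfl

/-- The definition by sorted lists covers only an index below all others. Elsewhere `j` has to be
moved past smaller indices, and each anticommutation of odd fields matches one factor of the Koszul
sign. -/
theorem oddPow_insert {j : Fin r} (S : Finset (Fin r)) : j ∉ S → ∀ f : A,
    F.oddPow (insert j S) f = koszul {j} S • SuperAlgebra.parity (𝕜 := 𝕜) (F.oddPow S (F.D (.inr j) f)) := by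
  induction S using Finset.induction_on_min with
  | empty =>
    intro _ f
    rw [oddPow_insert_of_lt _ (by simp), koszul_empty_right, one_smul]
  | insert m S hm ih =>
    intro hj f
    rw [Finset.mem_insert, not_or] at hj
    have hmS : m ∉ S := fun h => lt_irrefl _ (hm m h)
    rcases lt_or_gt_of_ne hj.1 with h | h
    · have hlt : ∀ i ∈ insert m S, j < i := by
        intro i hi
        rcases Finset.mem_insert.1 hi with rfl | hi
        · exact h
        · exact h.trans (hm i hi)
      rw [oddPow_insert_of_lt _ hlt, koszul_eq_one_of_lt hlt, one_smul]
    · have hlt : ∀ i ∈ insert j S, m < i := by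
        intro i hi
        rcases Finset.mem_insert.1 hi with rfl | hi
        · exact h
        · exact hm i hi
      rw [Finset.insert_comm, oddPow_insert_of_lt _ hlt, ih hj.2, oddPow_insert_of_lt _ hm, F.odd_odd m j,
        koszul_insert_right hmS, koszul_singleton_of_lt h]
      simp only [map_neg, map_zsmul, neg_one_mul, neg_smul, smul_neg, neg_neg]

/-- `α!`. -/
def fact (α : (Fin n ⊕ Fin n) →₀ ℕ) : ℕ := ∏ i, (α i).factorial

theorem fact_add_single (α : (Fin n ⊕ Fin n) →₀ ℕ) (i) : fact (α + Finsupp.single i 1) = (α i + 1) * fact α := by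
  unfold fact
  rw [← Finset.mul_prod_erase _ _ (Finset.mem_univ i), ← Finset.mul_prod_erase _ (fun j => (α j).factorial) (Finset.mem_univ i),
    ← mul_assoc]
  congr 1
  · simp [Nat.factorial_succ]
  · refine Finset.prod_congr rfl fun j hj => ?_
    simp [(Finset.ne_of_mem_erase hj).symm]

theorem fact_ne_zero (α : (Fin n ⊕ Fin n) →₀ ℕ) : (fact α : 𝕜) ≠ 0 :=
  Nat.cast_ne_zero.2 (Finset.prod_ne_zero_iff.2 fun i _ => Nat.factorial_ne_zero _)

/-- The Taylor expansion, as a linear map. -/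
def taylorLin : A →ₗ[𝕜] FormalFun 𝕜 A n r where
  toFun f := FormalFun.mk fun S α => (fact α : 𝕜)⁻¹ • F.oddPow S (F.evenPow α f)
  map_add' f g := by ext S α; simp only [coeff_mk, coeff_add, map_add, smul_add]
  map_smul' c f := by ext S α; simp only [coeff_mk, coeff_smul, map_smul, RingHom.id_apply, smul_comm c]

theorem coeff_taylorLin (f : A) (S α) : coeff S α (F.taylorLin f) = (fact α : 𝕜)⁻¹ • F.oddPow S (F.evenPow α f) := rfl

theorem taylorLin_coeff_zero (f : A) : coeff ∅ 0 (F.taylorLin f) = f := by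
  rw [coeff_taylorLin, evenPow_zero]
  simp [fact, oddPow, oddList]

theorem frame_taylorLin (k) (f : A) : (frame 𝕜 A n r).D k (F.taylorLin f) = F.taylorLin (F.D k f) := by
  rcases k with i | j
  · rw [frame_inl]
    ext S α
    rw [coeff_dEven, coeff_taylorLin, coeff_taylorLin, evenPow_add_single, fact_add_single, ← Nat.cast_smul_eq_nsmul 𝕜, smul_smul]
    have h := Nat.cast_ne_zero (R := 𝕜).2 (Nat.succ_ne_zero (α i))
    have h' := fact_ne_zero (𝕜 := 𝕜) α
    congr 1
    push_cast at h ⊢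
    field_simp
  · rw [frame_inr]
    ext S α
    rw [coeff_dOdd, coeff_taylorLin, coeff_taylorLin]
    have hc : Commute (F.D (.inr j)) (F.evenPow α) := F.commute_evenPow (fun i => LinearMap.ext (F.odd_even j i)) α
    have hc' : F.evenPow α (F.D (.inr j) f) = F.D (.inr j) (F.evenPow α f) := (LinearMap.congr_fun hc f).symm
    rw [hc']
    split_ifs with hj
    -- An odd field anticommutes with itself, so its square is zero as `2` is invertible. For `j ∈
    -- S` the operator `oddPow S` applies the `j`-th field once more, which kills the right side.
    · have h0 : F.D (.inr j) (F.D (.inr j) (F.evenPow α f)) = 0 := by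
        have h1 := F.odd_odd j j (F.evenPow α f)
        rw [eq_neg_iff_add_eq_zero, ← two_smul 𝕜] at h1
        exact (smul_eq_zero_iff_right two_ne_zero).1 h1
      have h2 := F.oddPow_insert (S.erase j) (Finset.notMem_erase j S) (F.D (.inr j) (F.evenPow α f))
      rw [h0, map_zero, map_zero, smul_zero, Finset.insert_erase hj] at h2
      rw [h2, smul_zero]
    · rw [oddPow_insert _ _ hj, map_smul, map_zsmul, SuperAlgebra.parity_parity, smul_comm _ (koszul {j} S), smul_smul,
        koszul_mul_self, one_smul]

/-- The defects of the identity, for all `f`, generate a group with vanishing constant terms. A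
derivative of the defect of `f` is up to sign the defect of a derivative of `f`, so
`eq_zero_of_frame` applies. -/
theorem taylorLin_parity (f : A) :
    F.taylorLin (SuperAlgebra.parity (𝕜 := 𝕜) f) = SuperAlgebra.parity (𝕜 := 𝕜) (F.taylorLin f) := by
  rw [← sub_eq_zero]
  let Z : AddSubgroup (FormalFun 𝕜 A n r) :=
    AddSubgroup.closure {z | ∃ f, z = F.taylorLin (SuperAlgebra.parity (𝕜 := 𝕜) f) - SuperAlgebra.parity (𝕜 := 𝕜) (F.taylorLin f)}
  refine eq_zero_of_frame Z ?_ ?_ _ (AddSubgroup.subset_closure ⟨f, rfl⟩)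
  · intro z hz
    induction hz using AddSubgroup.closure_induction with
    | mem z h =>
      obtain ⟨f, rfl⟩ := h
      rw [coeff_sub, coeff_parity, taylorLin_coeff_zero, taylorLin_coeff_zero]
      simp
    | zero => rfl
    | add x y _ _ hx hy => rw [coeff_add, hx, hy, add_zero]
    | neg x _ hx => rw [coeff_neg, hx, neg_zero]
  · intro k z hz
    induction hz using AddSubgroup.closure_induction with
    | mem z h =>
      obtain ⟨f, rfl⟩ := h
      have e1 : ∀ x, (frame 𝕜 A n r).D k (SuperAlgebra.parity (𝕜 := 𝕜) x) =
          (-1 : ℤ) ^ (coordParity k).val • SuperAlgebra.parity (𝕜 := 𝕜) ((frame 𝕜 A n r).D k x) := by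
        intro x
        rw [(frame 𝕜 A n r).D_parity, smul_smul, ← mul_pow]
        simp
      have e2 : ∀ x, F.D k (SuperAlgebra.parity (𝕜 := 𝕜) x) =
          (-1 : ℤ) ^ (coordParity k).val • SuperAlgebra.parity (𝕜 := 𝕜) (F.D k x) := by
        intro x
        rw [F.D_parity, smul_smul, ← mul_pow]
        simp
      rw [map_sub, e1, frame_taylorLin, frame_taylorLin, e2, map_zsmul, ← smul_sub]
      exact Z.zsmul_mem (AddSubgroup.subset_closure ⟨_, rfl⟩) _
    | zero => rw [map_zero]; exact Z.zero_mem
    | add x y _ _ hx hy => rw [map_add]; exact Z.add_mem hx hy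
    | neg x _ hx => rw [map_neg]; exact Z.neg_mem hx

theorem taylorLin_twist (k : ℕ) (f : A) : F.taylorLin (twist 𝕜 k f) = twist 𝕜 k (F.taylorLin f) := by
  induction k with
  | zero => rw [twist_zero, twist_zero]
  | succ k ih => rw [add_comm, twist_add, twist_add, twist_one, twist_one, taylorLin_parity, ih]

/-- Same method. By both Leibniz rules the derivative of the defect of `(f, g)` is the defect of `(D
f, g)` plus that of `(twist f, D g)`, so no binomial identities are needed. -/
theorem taylorLin_mul (f g : A) : F.taylorLin (f * g) = F.taylorLin f * F.taylorLin g := by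
  rw [← sub_eq_zero]
  let Z : AddSubgroup (FormalFun 𝕜 A n r) :=
    AddSubgroup.closure {z | ∃ f g, z = F.taylorLin (f * g) - F.taylorLin f * F.taylorLin g}
  refine eq_zero_of_frame Z ?_ ?_ _ (AddSubgroup.subset_closure ⟨f, g, rfl⟩)
  · intro z hz
    induction hz using AddSubgroup.closure_induction with
    | mem z h =>
      obtain ⟨f, g, rfl⟩ := h
      rw [coeff_sub, taylorLin_coeff_zero, ← evalZero_apply, map_mul, evalZero_apply, evalZero_apply, taylorLin_coeff_zero,
        taylorLin_coeff_zero, sub_self]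
    | zero => rfl
    | add x y _ _ hx hy => rw [coeff_add, hx, hy, add_zero]
    | neg x _ hx => rw [coeff_neg, hx, neg_zero]
  · intro k z hz
    induction hz using AddSubgroup.closure_induction with
    | mem z h =>
      obtain ⟨f, g, rfl⟩ := h
      rw [map_sub, Frame.leibniz, frame_taylorLin, frame_taylorLin, frame_taylorLin, F.leibniz, map_add, ← taylorLin_twist,
        add_sub_add_comm]
      exact Z.add_mem (AddSubgroup.subset_closure ⟨_, _, rfl⟩) (AddSubgroup.subset_closure ⟨_, _, rfl⟩)
    | zero => rw [map_zero]; exact Z.zero_mem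
    | add x y _ _ hx hy => rw [map_add]; exact Z.add_mem hx hy
    | neg x _ hx => rw [map_neg]; exact Z.neg_mem hx

theorem D_one (k) : F.D k 1 = 0 := by
  have := F.leibniz k 1 1
  simpa using this

theorem D_algebraMap (k) (c : 𝕜) : F.D k (algebraMap 𝕜 A c) = 0 := by
  rw [Algebra.algebraMap_eq_smul_one, map_smul, D_one, smul_zero]

theorem taylorLin_of_const {c : A} (h : ∀ k, F.D k c = 0) : F.taylorLin c = const c := by
  rw [← sub_eq_zero]
  refine eq_zero_of_frame (AddSubgroup.zmultiples (F.taylorLin c - const c)) ?_ ?_ _ (AddSubgroup.mem_zmultiples _)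
  · rintro z ⟨m, rfl⟩
    simp only [coeff_zsmul, coeff_sub, taylorLin_coeff_zero, coeff_const]
    simp
  · rintro k z ⟨m, rfl⟩
    simp only [map_zsmul, map_sub, frame_taylorLin, h, frame_const]
    simp

/-- The Taylor expansion `f ↦ exp(∑ y_k D_k) f` along a frame. -/
def taylor : A →ₐ[𝕜] FormalFun 𝕜 A n r :=
  AlgHom.ofLinearMap F.taylorLin (by rw [F.taylorLin_of_const F.D_one]; rfl) F.taylorLin_mul

theorem taylor_coeff_zero (f : A) : coeff ∅ 0 (F.taylor f) = f := F.taylorLin_coeff_zero f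
theorem frame_taylor (k) (f : A) : (frame 𝕜 A n r).D k (F.taylor f) = F.taylor (F.D k f) := F.frame_taylorLin k f
theorem taylor_parity (f : A) : F.taylor (SuperAlgebra.parity (𝕜 := 𝕜) f) = SuperAlgebra.parity (𝕜 := 𝕜) (F.taylor f) :=
  F.taylorLin_parity f
theorem taylor_of_const {c : A} (h : ∀ k, F.D k c = 0) : F.taylor c = const c := F.taylorLin_of_const h

end Frame
end

end SuperGeom
end

/-! ### Poisson brackets of frames and the change between two frames -/

noncomputable section
namespace SuperGeom
open FormalFun

section
variable {𝕜 A : Type*} [CommRing 𝕜] [Ring A] [Algebra 𝕜 A] [SuperAlgebra 𝕜 A]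

theorem HasParity.twist {i : ZMod 2} {a : A} (h : HasParity 𝕜 i a) (l : ℕ) : twist 𝕜 l a = (-1 : ℤ) ^ (l * i.val) • a :=
  twist_of_homog 𝕜 h l

theorem HasParity.mul_comm {i j : ZMod 2} {a b : A} (ha : HasParity 𝕜 i a) (hb : HasParity 𝕜 j b) :
    a * b = (-1 : ℤ) ^ (i.val * j.val) • (b * a) := by
  rw [homog_mul 𝕜 ha b, hb.twist, smul_mul_assoc]

theorem HasParity.der {i j : ZMod 2} {a : A} {Y : Module.End 𝕜 A} (hY : Y ∈ superDer 𝕜 A j) (ha : HasParity 𝕜 i a) :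
    HasParity 𝕜 (j + i) (Y a) := by
  unfold HasParity at *
  rw [hY.1 a, ha, map_zsmul, smul_smul, neg_one_pow_val_add]

theorem mulLeft_comp_mem {i j k : ZMod 2} {f : A} (hf : HasParity 𝕜 i f) {Y : Module.End 𝕜 A} (hY : Y ∈ superDer 𝕜 A j)
    (h : i + j = k) : LinearMap.mulLeft 𝕜 f ∘ₗ Y ∈ superDer 𝕜 A k := h ▸ (smulDer f hf ⟨Y, hY⟩).2

theorem der_one {i : ZMod 2} {Y : Module.End 𝕜 A} (hY : Y ∈ superDer 𝕜 A i) : Y 1 = 0 := by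
  simpa using hY.2 1 1

end

section
variable {𝕜 : Type*} [CommRing 𝕜] {A A' A'' : Type*} [Ring A] [Algebra 𝕜 A] [SuperAlgebra 𝕜 A] [Ring A'] [Algebra 𝕜 A']
  [SuperAlgebra 𝕜 A'] [Ring A''] [Algebra 𝕜 A''] [SuperAlgebra 𝕜 A''] {n r : ℕ}

/-- Homomorphisms of superalgebras. -/
def IsSuper (ρ : A →ₐ[𝕜] A') : Prop := ∀ a, ρ (SuperAlgebra.parity (𝕜 := 𝕜) a) = SuperAlgebra.parity (𝕜 := 𝕜) (ρ a)

theorem IsSuper.twist {ρ : A →ₐ[𝕜] A'} (h : IsSuper ρ) (k : ℕ) (a : A) : ρ (twist 𝕜 k a) = SuperGeom.twist 𝕜 k (ρ a) := by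
  induction k with
  | zero => rw [twist_zero, twist_zero]
  | succ k ih => rw [add_comm, twist_add, twist_add, twist_one, twist_one, h, ih]

namespace FormalFun

/-- Application of a homomorphism to the coefficients. -/
def mapCoeff (ρ : A →ₐ[𝕜] A') (h : IsSuper ρ) : FormalFun 𝕜 A n r →ₐ[𝕜] FormalFun 𝕜 A' n r := AlgHom.ofLinearMap
  { toFun := fun f => mk fun S α => ρ (coeff S α f)
    map_add' := fun f g => by ext S α; simp
    map_smul' := fun c f => by ext S α; simp }
  (by
    ext S α
    change ρ (coeff S α (const 1 : FormalFun 𝕜 A n r)) = coeff S α (const 1)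
    rw [coeff_const, coeff_const]
    split_ifs <;> simp)
  (fun f g => by
    ext S α
    change ρ (coeff S α (f * g)) = coeff S α (_ * _)
    rw [coeff_mul, coeff_mul]
    simp only [map_sum, map_zsmul, map_mul, h.twist]
    rfl)

@[simp] theorem coeff_mapCoeff (ρ : A →ₐ[𝕜] A') (h : IsSuper ρ) (f : FormalFun 𝕜 A n r) (S α) :
    coeff S α (mapCoeff ρ h f) = ρ (coeff S α f) := rfl

theorem mapCoeff_const (ρ : A →ₐ[𝕜] A') (h : IsSuper ρ) (c : A) :
    mapCoeff ρ h (const c : FormalFun 𝕜 A n r) = const (ρ c) := by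
  ext S α
  rw [coeff_mapCoeff, coeff_const, coeff_const]
  split_ifs <;> simp

theorem mapCoeff_mono (ρ : A →ₐ[𝕜] A') (h : IsSuper ρ) (S α) (c : A) :
    mapCoeff ρ h (mono S α c : FormalFun 𝕜 A n r) = mono S α (ρ c) := by
  ext S' α'
  rw [coeff_mapCoeff, coeff_mono, coeff_mono]
  split_ifs <;> simp

theorem mapCoeff_gen (ρ : A →ₐ[𝕜] A') (h : IsSuper ρ) (k) : mapCoeff ρ h (gen k : FormalFun 𝕜 A n r) = gen k := by
  rcases k with i | j <;> simp only [gen, mapCoeff_mono, map_one]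

theorem mapCoeff_parity (ρ : A →ₐ[𝕜] A') (h : IsSuper ρ) : IsSuper (mapCoeff (n := n) (r := r) ρ h) := by
  intro f
  ext S α
  rw [coeff_mapCoeff, coeff_parity, coeff_parity, coeff_mapCoeff, map_zsmul, h]

theorem mapCoeff_mem_filtration (ρ : A →ₐ[𝕜] A') (h : IsSuper ρ) {k : ℕ} {f : FormalFun 𝕜 A n r} (hf : f ∈ filtration k) :
    mapCoeff ρ h f ∈ filtration k := fun S α hd => by rw [coeff_mapCoeff, hf S α hd, map_zero]

theorem frame_mapCoeff (ρ : A →ₐ[𝕜] A') (h : IsSuper ρ) (k) (f : FormalFun 𝕜 A n r) :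
    (frame 𝕜 A' n r).D k (mapCoeff ρ h f) = mapCoeff ρ h ((frame 𝕜 A n r).D k f) := by
  rcases k with i | j
  · rw [frame_inl, frame_inl]
    ext S α
    rw [coeff_mapCoeff, coeff_dEven, coeff_dEven, coeff_mapCoeff, map_nsmul]
  · rw [frame_inr, frame_inr]
    ext S α
    rw [coeff_mapCoeff, coeff_dOdd, coeff_dOdd, coeff_mapCoeff]
    split_ifs
    · rw [map_zero]
    · rw [map_zsmul, h]

theorem isSuper_evalZero : IsSuper (evalZero : FormalFun 𝕜 A n r →ₐ[𝕜] A) := fun f => by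
  rw [evalZero_apply, coeff_parity]
  simp

/-- Derivations that vanish on constants and variables vanish. -/
theorem der_eq_zero {i : ZMod 2} {Y : Module.End 𝕜 (FormalFun 𝕜 A n r)} (hY : Y ∈ superDer 𝕜 (FormalFun 𝕜 A n r) i)
    (hcts : Cts Y) (hc : ∀ c, Y (const c) = 0) (hg : ∀ k, Y (gen k) = 0) (f : FormalFun 𝕜 A n r) : Y f = 0 := by
  let R : Subring (FormalFun 𝕜 A n r) :=
    { carrier := {f | Y f = 0}
      mul_mem' := fun {f g} hf hg => by
        change Y (f * g) = 0
        rw [hY.2, show Y f = 0 from hf, show Y g = 0 from hg, zero_mul, mul_zero, add_zero]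
      one_mem' := der_one hY
      add_mem' := fun {f g} hf hg => by
        change Y (f + g) = 0
        rw [map_add, show Y f = 0 from hf, show Y g = 0 from hg, add_zero]
      zero_mem' := map_zero Y
      neg_mem' := fun {f} hf => by
        change Y (-f) = 0
        rw [map_neg, show Y f = 0 from hf, neg_zero] }
  apply eq_of_sub_mem_filtration
  intro N
  obtain ⟨M, hM⟩ := hcts.2 N
  have h1 := hM _ (sub_sum_mono_mem M f)
  have h2 : ∀ S α c, Y (mono S α c) = 0 := fun S α c => mono_mem R hc hg S α c
  simpa only [map_sub, map_sum, h2, Finset.sum_const_zero, sub_zero] using h1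

theorem cts_frame (k) : Cts ((frame 𝕜 A n r).D k) :=
  ⟨map_add _, fun N => ⟨N + 1, fun f hf => frame_mem_filtration hf k⟩⟩

theorem Cts.sum {ι : Type*} (s : Finset ι) {Φ : ι → FormalFun 𝕜 A n r → FormalFun 𝕜 A n r} (h : ∀ i ∈ s, Cts (Φ i)) :
    Cts fun f => ∑ i ∈ s, Φ i f := by
  classical
  induction s using Finset.induction_on with
  | empty => exact ⟨fun _ _ => by simp, fun N => ⟨0, fun _ _ => by simpa using zero_mem_filtration⟩⟩
  | insert i s hi ih =>
    simp only [Finset.sum_insert hi]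
    exact (h i (Finset.mem_insert_self i s)).add (ih fun j hj => h j (Finset.mem_insert_of_mem hj))

theorem Cts.zsmul {Φ : FormalFun 𝕜 A n r → FormalFun 𝕜 A n r} (h : Cts Φ) (m : ℤ) : Cts fun f => m • Φ f := by
  refine ⟨fun f g => by simp only [h.1, smul_add], fun N => ?_⟩
  obtain ⟨M, hM⟩ := h.2 N
  exact ⟨M, fun f hf => zsmul_mem_filtration (hM f hf) m⟩

theorem Cts.sub {Φ Ψ : FormalFun 𝕜 A n r → FormalFun 𝕜 A n r} (hΦ : Cts Φ) (hΨ : Cts Ψ) : Cts fun f => Φ f - Ψ f := by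
  have := hΦ.add (hΨ.zsmul (-1))
  simpa only [neg_one_smul, ← sub_eq_add_neg] using this

end FormalFun

/-! #### The Poisson bracket of a frame -/

/-- `{f, -}` for the Poisson bracket with standard coefficients in the frame. -/
def Frame.ham {a b : ℕ} (F : Frame 𝕜 A n (a + b)) (f : A) : Module.End 𝕜 A :=
  ∑ i : Fin n, (LinearMap.mulLeft 𝕜 (F.D (.inl (.inl i)) f) ∘ₗ F.D (.inl (.inr i)) -
    LinearMap.mulLeft 𝕜 (F.D (.inl (.inr i)) f) ∘ₗ F.D (.inl (.inl i))) -
  ∑ j : Fin (a + b), quadSign a b j • (LinearMap.mulLeft 𝕜 (F.D (.inr j) (SuperAlgebra.parity (𝕜 := 𝕜) f)) ∘ₗ F.D (.inr j))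

theorem Frame.ham_apply {a b : ℕ} (F : Frame 𝕜 A n (a + b)) (f g : A) :
    F.ham f g = ∑ i : Fin n, (F.D (.inl (.inl i)) f * F.D (.inl (.inr i)) g - F.D (.inl (.inr i)) f * F.D (.inl (.inl i)) g) -
      ∑ j : Fin (a + b), quadSign a b j • (F.D (.inr j) (SuperAlgebra.parity (𝕜 := 𝕜) f) * F.D (.inr j) g) := by
  simp [Frame.ham, LinearMap.sum_apply, LinearMap.sub_apply]

theorem frame_ham {a b : ℕ} (f g : FormalFun 𝕜 A n (a + b)) : (frame 𝕜 A n (a + b)).ham f g = bracket a b f g :=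
  Frame.ham_apply _ f g

theorem Frame.ham_add {a b : ℕ} (F : Frame 𝕜 A n (a + b)) (f f' g : A) : F.ham (f + f') g = F.ham f g + F.ham f' g := by
  simp only [Frame.ham_apply, map_add, add_mul, smul_add, Finset.sum_add_distrib, Finset.sum_sub_distrib]
  abel

theorem Frame.ham_map {a b : ℕ} (F : Frame 𝕜 A n (a + b)) (F' : Frame 𝕜 A' n (a + b)) (ρ : A →ₐ[𝕜] A') (hρ : IsSuper ρ)
    (h : ∀ k f, ρ (F.D k f) = F'.D k (ρ f)) (f g : A) : ρ (F.ham f g) = F'.ham (ρ f) (ρ g) := by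
  simp only [Frame.ham_apply, map_sub, map_sum, map_mul, map_zsmul, h, hρ f]

theorem Frame.ham_mem {a b : ℕ} (F : Frame 𝕜 A n (a + b)) {i : ZMod 2} {f : A} (hf : HasParity 𝕜 i f) :
    F.ham f ∈ superDer 𝕜 A i := by
  have h2 : ∀ x : ZMod 2, x + x = 0 := by decide
  have e : ∀ m, HasParity 𝕜 i (F.D (.inl m) f) := fun m => by
    have := hf.der (F.der (.inl m))
    rwa [show coordParity (Sum.inl m : (Fin n ⊕ Fin n) ⊕ Fin (a + b)) = 0 from rfl, zero_add] at this
  refine Submodule.sub_mem _ (Submodule.sum_mem _ fun m _ => Submodule.sub_mem _ ?_ ?_) (Submodule.sum_mem _ fun j _ => ?_)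
  · exact mulLeft_comp_mem (e _) (F.der _) (add_zero i)
  · exact mulLeft_comp_mem (e _) (F.der _) (add_zero i)
  · refine zsmul_mem (mulLeft_comp_mem (i := 1 + i) ?_ (F.der (.inr j)) ?_) _
    · have h : HasParity 𝕜 i (SuperAlgebra.parity (𝕜 := 𝕜) f) := by
        unfold HasParity at *
        rw [hf, map_zsmul, hf]
      exact h.der (F.der (.inr j))
    · change 1 + i + 1 = i
      rw [add_comm 1 i, add_assoc, h2, add_zero]

/-- In the even part supercommutativity exchanges the two products of each pair. In the odd part the
derivatives have parities `1 + i` and `1 + j`, and the sign that their exchange produces is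
corrected by the parity built into the first argument. -/
theorem Frame.ham_skew {a b : ℕ} (F : Frame 𝕜 A n (a + b)) {i j : ZMod 2} {f g : A} (hf : HasParity 𝕜 i f) (hg : HasParity 𝕜 j g) :
    F.ham f g = -((-1 : ℤ) ^ (i.val * j.val) • F.ham g f) := by
  have e : ∀ {i : ZMod 2} {f : A}, HasParity 𝕜 i f → ∀ m, HasParity 𝕜 i (F.D (.inl m) f) := fun hf m => by
    have := hf.der (F.der (.inl m))
    rwa [show coordParity (Sum.inl m : (Fin n ⊕ Fin n) ⊕ Fin (a + b)) = 0 from rfl, zero_add] at this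
  have o : ∀ {i : ZMod 2} {f : A}, HasParity 𝕜 i f → ∀ m, HasParity 𝕜 (1 + i) (F.D (.inr m) f) := fun hf m =>
    hf.der (F.der (.inr m))
  have p1 : SuperAlgebra.parity (𝕜 := 𝕜) f = _ := hf
  have p2 : SuperAlgebra.parity (𝕜 := 𝕜) g = _ := hg
  have hO : ∑ m : Fin (a + b), quadSign a b m • (F.D (.inr m) (SuperAlgebra.parity (𝕜 := 𝕜) f) * F.D (.inr m) g) =
      -((-1 : ℤ) ^ (i.val * j.val) •
        ∑ m : Fin (a + b), quadSign a b m • (F.D (.inr m) (SuperAlgebra.parity (𝕜 := 𝕜) g) * F.D (.inr m) f)) := by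
    rw [Finset.smul_sum, ← Finset.sum_neg_distrib]
    refine Finset.sum_congr rfl fun m _ => ?_
    rw [p1, p2, map_zsmul, map_zsmul, smul_mul_assoc, smul_mul_assoc, (o hf m).mul_comm (o hg m), smul_comm _ (quadSign a b m),
      ← smul_neg, smul_smul ((-1 : ℤ) ^ i.val), smul_smul ((-1 : ℤ) ^ (i.val * j.val)), ← neg_smul]
    congr 2
    have : ∀ i j : ZMod 2, (-1 : ℤ) ^ i.val * (-1) ^ ((1 + i).val * (1 + j).val) = -((-1) ^ (i.val * j.val) * (-1) ^ j.val) := by decide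
    exact this i j
  have hE : ∑ m : Fin n, (F.D (.inl (.inl m)) f * F.D (.inl (.inr m)) g - F.D (.inl (.inr m)) f * F.D (.inl (.inl m)) g) =
      -((-1 : ℤ) ^ (i.val * j.val) •
        ∑ m : Fin n, (F.D (.inl (.inl m)) g * F.D (.inl (.inr m)) f - F.D (.inl (.inr m)) g * F.D (.inl (.inl m)) f)) := by
    rw [Finset.smul_sum, ← Finset.sum_neg_distrib]
    refine Finset.sum_congr rfl fun m _ => ?_
    rw [(e hf _).mul_comm (e hg _), (e hf (.inr m)).mul_comm (e hg _), ← smul_sub, ← smul_neg, neg_sub]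
  rw [Frame.ham_apply, Frame.ham_apply, hO, hE, smul_sub, neg_sub, neg_sub_neg]

end

/-! #### Frames of coordinates -/

section
variable (𝕜 A : Type*) [CommRing 𝕜] [Ring A] [Algebra 𝕜 A] [SuperAlgebra 𝕜 A] (n r : ℕ)

/-- The coordinate vector fields of a coordinate system `x`. -/
structure CoordFrame extends Frame 𝕜 A n r where
  x : (Fin n ⊕ Fin n) ⊕ Fin r → A
  x_parity : ∀ k, HasParity 𝕜 (coordParity k) (x k)
  D_x : ∀ k l, D k (x l) = if l = k then 1 else 0
  span : ∀ i, ∀ Y ∈ superDer 𝕜 A i, ∀ a, Y a = ∑ l, Y (x l) * D l a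

end

section
variable {𝕜 : Type*} [Field 𝕜] [CharZero 𝕜] {A A' : Type*} [Ring A] [Algebra 𝕜 A] [SuperAlgebra 𝕜 A] [Ring A'] [Algebra 𝕜 A']
  [SuperAlgebra 𝕜 A'] {n r : ℕ}

/-- The defects are again closed under derivatives and have no constant term. This serves twice: for
restriction to smaller open sets, and with a Taylor expansion in the role of `ρ`. -/
theorem Frame.taylor_natural (F : Frame 𝕜 A n r) (F' : Frame 𝕜 A' n r) (ρ : A →ₐ[𝕜] A') (hρ : IsSuper ρ)
    (h : ∀ k f, ρ (F.D k f) = F'.D k (ρ f)) (f : A) : mapCoeff ρ hρ (F.taylor f) = F'.taylor (ρ f) := by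
  rw [← sub_eq_zero]
  let Z : AddSubgroup (FormalFun 𝕜 A' n r) := AddSubgroup.closure {z | ∃ f, z = mapCoeff ρ hρ (F.taylor f) - F'.taylor (ρ f)}
  refine eq_zero_of_frame Z ?_ ?_ _ (AddSubgroup.subset_closure ⟨f, rfl⟩)
  · intro z hz
    induction hz using AddSubgroup.closure_induction with
    | mem z h =>
      obtain ⟨f, rfl⟩ := h
      rw [coeff_sub, coeff_mapCoeff, taylor_coeff_zero, taylor_coeff_zero, sub_self]
    | zero => rfl
    | add x y _ _ hx hy => rw [coeff_add, hx, hy, add_zero]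
    | neg x _ hx => rw [coeff_neg, hx, neg_zero]
  · intro k z hz
    induction hz using AddSubgroup.closure_induction with
    | mem z h' =>
      obtain ⟨f, rfl⟩ := h'
      rw [map_sub, frame_mapCoeff, frame_taylor, frame_taylor, ← h]
      exact AddSubgroup.subset_closure ⟨_, rfl⟩
    | zero => rw [map_zero]; exact Z.zero_mem
    | add x y _ _ hx hy => rw [map_add]; exact Z.add_mem hx hy
    | neg x _ hx => rw [map_neg]; exact Z.neg_mem hx

namespace CoordFrame
variable (F F' : CoordFrame 𝕜 A n r)

theorem taylor_x (k) : F.taylor (F.x k) = const (F.x k) + gen k := by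
  rw [← sub_eq_zero]
  refine eq_zero_of_frame (AddSubgroup.zmultiples (F.taylor (F.x k) - (const (F.x k) + gen k))) ?_ ?_ _ (AddSubgroup.mem_zmultiples _)
  · rintro z ⟨m, rfl⟩
    have : coeff ∅ 0 (gen k : FormalFun 𝕜 A n r) = 0 := by
      rcases k with i | j
      · rw [gen, coeff_mono, if_neg]
        rintro ⟨-, h⟩
        simpa using DFunLike.congr_fun h i
      · rw [gen, coeff_mono, if_neg]
        rintro ⟨h, -⟩
        exact Finset.singleton_ne_empty _ h.symm
    simp only [coeff_zsmul, coeff_sub, coeff_add, Frame.taylor_coeff_zero, coeff_const, this]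
    simp
  · rintro l z ⟨m, rfl⟩
    simp only [map_zsmul, map_sub, map_add, Frame.frame_taylor, F.D_x, frame_const, frame_gen]
    split_ifs <;> simp

theorem gen_eq (k) : (gen k : FormalFun 𝕜 A n r) = F.taylor (F.x k) - const (F.x k) := by
  rw [taylor_x, add_sub_cancel_left]

theorem isSuper_taylor : IsSuper F.taylor := F.taylor_parity

/-- The vector field `D'_k` of another frame on the formal disk, acting on `F`-Taylor expansions. -/
def transD (k : (Fin n ⊕ Fin n) ⊕ Fin r) : Module.End 𝕜 (FormalFun 𝕜 A n r) :=
  ∑ l, LinearMap.mulLeft 𝕜 (F.taylor (F'.D k (F.x l))) ∘ₗ (frame 𝕜 A n r).D l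

theorem transD_apply (k) (f : FormalFun 𝕜 A n r) :
    F.transD F' k f = ∑ l, F.taylor (F'.D k (F.x l)) * (frame 𝕜 A n r).D l f := by
  simp [transD, LinearMap.sum_apply]

theorem transD_der (k) : F.transD F' k ∈ superDer 𝕜 (FormalFun 𝕜 A n r) (coordParity k) := by
  refine Submodule.sum_mem _ fun l _ => ?_
  refine mulLeft_comp_mem (i := coordParity k + coordParity l) ?_ ((frame 𝕜 A n r).der l) ?_
  · have h : HasParity 𝕜 (coordParity k + coordParity l) (F'.D k (F.x l)) := (F.x_parity l).der (F'.der k)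
    unfold HasParity at *
    rw [← F.taylor_parity, h, map_zsmul]
  · have : ∀ x y : ZMod 2, x + y + y = x := by decide
    exact this _ _

/-- By `span`, `D'_k` is the combination of the `D_l` with coefficients `D'_k x_l`. The expansion is
multiplicative and turns `D_l` into the coordinate derivative. -/
theorem transD_taylor (k) (f : A) : F.transD F' k (F.taylor f) = F.taylor (F'.D k f) := by
  rw [transD_apply, F.span _ (F'.D k) (F'.der k) f, map_sum]
  refine Finset.sum_congr rfl fun l _ => ?_
  rw [Frame.frame_taylor, map_mul]

theorem transD_const (k) (c : A) : F.transD F' k (const c) = 0 := by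
  rw [transD_apply]
  exact Finset.sum_eq_zero fun l _ => by rw [frame_const, mul_zero]

theorem transD_mem_filtration {N : ℕ} {f : FormalFun 𝕜 A n r} (hf : f ∈ filtration (N + 1)) (k) :
    F.transD F' k f ∈ filtration N := by
  rw [transD_apply]
  exact sum_mem_filtration _ _ fun l _ => mul_mem_filtration_right (frame_mem_filtration hf l) _

theorem cts_transD (k) : Cts (F.transD F' k) := ⟨map_add _, fun N => ⟨N + 1, fun _ hf => F.transD_mem_filtration F' hf k⟩⟩

/-- The vector fields of another frame on the formal disk. -/
def transFrame : Frame 𝕜 (FormalFun 𝕜 A n r) n r where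
  D := F.transD F'
  der := F.transD_der F'
  comm k l f := by
    -- The supercommutator is a continuous derivation. It kills constants, and it kills the
    -- variables because each is an expanded coordinate minus a constant, where the commutation of
    -- the original fields applies.
    have h := der_eq_zero (superBracket ⟨_, F.transD_der F' k⟩ ⟨_, F.transD_der F' l⟩).2
      (((F.cts_transD F' k).comp (F.cts_transD F' l)).sub (((F.cts_transD F' l).comp (F.cts_transD F' k)).zsmul _)) ?_ ?_ f
    · exact sub_eq_zero.1 h
    · intro c
      change F.transD F' k (F.transD F' l _) - (_ : ℤ) • F.transD F' l (F.transD F' k _) = 0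
      rw [transD_const, transD_const, map_zero, map_zero, smul_zero, sub_zero]
    · intro m
      change F.transD F' k (F.transD F' l _) - (_ : ℤ) • F.transD F' l (F.transD F' k _) = 0
      simp only [F.gen_eq, map_sub, transD_const, sub_zero, transD_taylor, F'.comm k l, map_zsmul, sub_self]

/-- The change of formal coordinates between two frames. -/
def trans : FormalFun 𝕜 A n r →ₐ[𝕜] FormalFun 𝕜 A n r :=
  (mapCoeff evalZero isSuper_evalZero).comp (F.transFrame F').taylor

theorem trans_apply (f : FormalFun 𝕜 A n r) : F.trans F' f = mapCoeff evalZero isSuper_evalZero ((F.transFrame F').taylor f) := rfl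

theorem trans_coeff_zero (f : FormalFun 𝕜 A n r) : coeff ∅ 0 (F.trans F' f) = coeff ∅ 0 f := by
  rw [trans_apply, coeff_mapCoeff, Frame.taylor_coeff_zero, evalZero_apply]

theorem frame_trans (k) (f : FormalFun 𝕜 A n r) : (frame 𝕜 A n r).D k (F.trans F' f) = F.trans F' ((F.transFrame F').D k f) := by
  rw [trans_apply, trans_apply, frame_mapCoeff, Frame.frame_taylor]

theorem trans_const (c : A) : F.trans F' (const c) = const c := by
  rw [trans_apply, (F.transFrame F').taylor_of_const (fun k => F.transD_const F' k c), mapCoeff_const, evalZero_apply, coeff_const]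
  simp

/-- The `F`-expansion intertwines `D'` with the transported frame. By naturality, expanding
`F.taylor f` along that frame amounts to applying `F.taylor` to the coefficients of `F'.taylor f`.
Taking constant terms undoes this application. -/
theorem trans_taylor (f : A) : F.trans F' (F.taylor f) = F'.taylor f := by
  have h := Frame.taylor_natural F'.toFrame (F.transFrame F') F.taylor F.isSuper_taylor
    (fun k f => (F.transD_taylor F' k f).symm) f
  rw [trans_apply, ← h]
  ext S α
  simp only [coeff_mapCoeff, evalZero_apply, Frame.taylor_coeff_zero]

theorem isSuper_trans : IsSuper (F.trans F') := fun f => by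
  rw [trans_apply, trans_apply, Frame.taylor_parity, mapCoeff_parity]

/-- By induction through derivatives: the constant term is preserved, and each derivative of the
image is the image of an element one step lower in the filtration. -/
theorem trans_mem_filtration (k : ℕ) : ∀ f ∈ filtration k, F.trans F' f ∈ filtration k := by
  induction k with
  | zero => exact fun f _ => mem_filtration_zero _
  | succ k ih =>
    intro f hf
    refine mem_filtration_succ_of_frame ?_ fun l => ?_
    · rw [trans_coeff_zero]
      exact hf ∅ 0 (by simp)
    · rw [frame_trans]
      exact ih _ (F.transD_mem_filtration F' hf l)

theorem trans_gen (k) : F.trans F' (gen k) = F'.taylor (F.x k) - const (F.x k) := by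
  rw [F.gen_eq, map_sub, trans_taylor, trans_const]

theorem trans_trans (f : FormalFun 𝕜 A n r) : F'.trans F (F.trans F' f) = f := by
  have := ringHom_ext (Φ := ((F'.trans F).comp (F.trans F')).toRingHom) (Ψ := RingHom.id _)
    (fun k f hf => F'.trans_mem_filtration F k _ (F.trans_mem_filtration F' k f hf)) (fun k f hf => hf) (fun c => by
      change F'.trans F (F.trans F' (const c)) = const c
      rw [trans_const, trans_const]) (fun k => by
      change F'.trans F (F.trans F' (gen k)) = gen k
      rw [trans_gen, map_sub, trans_taylor, trans_const, ← gen_eq])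
  exact RingHom.congr_fun this f

end CoordFrame

theorem exists_even_add_odd (f : A) : ∃ g h : A, HasParity 𝕜 0 g ∧ HasParity 𝕜 1 h ∧ f = g + h := by
  refine ⟨(2 : 𝕜)⁻¹ • (f + SuperAlgebra.parity (𝕜 := 𝕜) f), (2 : 𝕜)⁻¹ • (f - SuperAlgebra.parity (𝕜 := 𝕜) f), ?_, ?_, ?_⟩
  · unfold HasParity
    rw [map_smul, map_add, SuperAlgebra.parity_parity, add_comm]
    simp
  · unfold HasParity
    rw [map_smul, map_sub, SuperAlgebra.parity_parity]
    change _ = (-1 : ℤ) ^ 1 • _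
    rw [pow_one, neg_one_smul, ← smul_neg, neg_sub]
  · rw [← smul_add, add_add_sub_cancel, ← two_smul 𝕜, smul_smul, inv_mul_cancel₀ two_ne_zero, one_smul]

namespace CoordFrame
variable {a b : ℕ} (F F' : CoordFrame 𝕜 A n (a + b))

theorem cts_ham (G : Frame 𝕜 (FormalFun 𝕜 A n (a + b)) n (a + b)) (hG : ∀ k, Cts (G.D k)) (f) : Cts (G.ham f) := by
  have : (fun g => G.ham f g) = _ := funext (G.ham_apply f)
  rw [show ⇑(G.ham f) = _ from this]
  refine (Cts.sum _ fun i _ => ?_).sub (Cts.sum _ fun j _ => ?_)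
  · exact ((Cts.mul_left _).comp (hG _)).sub ((Cts.mul_left _).comp (hG _))
  · exact ((Cts.mul_left _).comp (hG _)).zsmul _

theorem ham_const (G : Frame 𝕜 (FormalFun 𝕜 A n (a + b)) n (a + b)) (hG : ∀ k c, G.D k (const c) = 0) (f) (c : A) :
    G.ham f (const c) = 0 := by
  simp [Frame.ham_apply, hG]

/-- If two frames of coordinates define the same Poisson bracket, then so do their extensions to the formal disk. -/
theorem transFrame_ham (h : ∀ f g, F.ham f g = F'.ham f g) (f g : FormalFun 𝕜 A n (a + b)) :
    (F.transFrame F').ham f g = bracket a b f g := by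
  rw [← frame_ham]
  set G := F.transFrame F'
  set G' := frame 𝕜 A n (a + b)
  have hG : ∀ k, Cts (G.D k) := F.cts_transD F'
  have hG' : ∀ k, Cts (G'.D k) := cts_frame
  -- For a fixed homogeneous `f` both brackets with `f` are continuous derivations that kill
  -- constants, so it suffices to compare them on the expanded coordinates.
  have step : ∀ {i : ZMod 2} {f}, HasParity 𝕜 i f → (∀ m, G.ham f (F.taylor (F.x m)) = G'.ham f (F.taylor (F.x m))) →
      ∀ g, G.ham f g = G'.ham f g := by
    intro i f hf hm g
    have := der_eq_zero (Submodule.sub_mem _ (G.ham_mem hf) (G'.ham_mem hf)) ((cts_ham G hG f).sub (cts_ham G' hG' f))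
      (fun c => by rw [LinearMap.sub_apply, ham_const _ (F.transD_const F'), ham_const _ frame_const, sub_zero])
      (fun k => by
        rw [LinearMap.sub_apply, F.gen_eq, map_sub, map_sub, ham_const _ (F.transD_const F'), ham_const _ frame_const, hm, sub_self]) g
    exact sub_eq_zero.1 this
  have ht : ∀ m, HasParity 𝕜 (coordParity m) (F.taylor (F.x m)) := fun m => by
    have := F.x_parity m
    unfold HasParity at *
    rw [← F.taylor_parity, this, map_zsmul]
  -- When both arguments are expansions, the two brackets are the expansions of the `F'`- and the
  -- `F`-bracket on `A`, which agree by hypothesis. Skew-symmetry then moves an expanded coordinate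
  -- into the other slot and frees the first argument.
  have h1 : ∀ m g, G.ham (F.taylor (F.x m)) g = G'.ham (F.taylor (F.x m)) g := fun m => step (ht m) fun l => by
    rw [← Frame.ham_map F'.toFrame G F.taylor F.isSuper_taylor (fun k f => (F.transD_taylor F' k f).symm), ← h,
      Frame.ham_map F.toFrame G' F.taylor F.isSuper_taylor (fun k f => (F.frame_taylor k f).symm)]
  have h2 : ∀ {i : ZMod 2} {f}, HasParity 𝕜 i f → ∀ g, G.ham f g = G'.ham f g := fun hf => step hf fun m => by
    rw [G.ham_skew hf (ht m), G'.ham_skew hf (ht m), h1]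
  obtain ⟨f0, f1, hf0, hf1, rfl⟩ := exists_even_add_odd (𝕜 := 𝕜) f
  rw [G.ham_add, G'.ham_add, h2 hf0, h2 hf1]

/-- The change of formal coordinates between two frames with the same Poisson bracket. -/
def transAut (h : ∀ f g, F.ham f g = F'.ham f g) : formalAut 𝕜 A n a b :=
  ⟨AlgEquiv.ofAlgHom (F.trans F') (F'.trans F) (AlgHom.ext (F'.trans_trans F)) (AlgHom.ext (F.trans_trans F')),
    F.trans_const F', F.isSuper_trans F', fun f g => by
      change F.trans F' _ = bracket a b (F.trans F' f) (F.trans F' g)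
      rw [← F.transFrame_ham F' h, ← frame_ham]
      exact Frame.ham_map _ _ (F.trans F') (F.isSuper_trans F') (fun k f => (F.frame_trans F' k f).symm) f g,
    fun k f => ⟨fun hf => by
      have := F'.trans_mem_filtration F k (F.trans F' f) hf
      rwa [F.trans_trans F' f] at this, F.trans_mem_filtration F' k f⟩⟩

theorem transAut_taylor (h : ∀ f g, F.ham f g = F'.ham f g) (f : A) : (F.transAut F' h).1 (F.taylor f) = F'.taylor f :=
  F.trans_taylor F' f

/-- An automorphism is determined by its effect on the Taylor expansions of the coordinates. -/
theorem aut_ext {φ ψ : formalAut 𝕜 A n a b} (h : ∀ f, φ.1 (F.taylor f) = ψ.1 (F.taylor f)) : φ = ψ :=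
  formalAut.ext_gen fun k => by rw [F.gen_eq, map_sub, map_sub, h, φ.2.1, ψ.2.1]

end CoordFrame
end

end SuperGeom
end

/-! ### Hadamard's lemma and partial derivatives of smooth functions -/

noncomputable section
namespace SuperGeom
open FormalFun

section
open Filter Topology

theorem hasFDerivAt_intervalIntegral {E : Type} {G : Type*} [NormedAddCommGroup E] [NormedSpace ℝ E] [FiniteDimensional ℝ E]
    [NormedAddCommGroup G] [NormedSpace ℝ G] [CompleteSpace G] {H : E → ℝ → G} (hH : ContDiff ℝ 1 (Function.uncurry H)) (x₀ : E) :
    HasFDerivAt (fun x => ∫ t in (0 : ℝ)..1, H x t)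
      (∫ t in (0 : ℝ)..1, (fderiv ℝ (Function.uncurry H) (x₀, t)).comp (ContinuousLinearMap.inl ℝ E ℝ)) x₀ := by
  have hc : Continuous fun p : E × ℝ => (fderiv ℝ (Function.uncurry H) p).comp (ContinuousLinearMap.inl ℝ E ℝ) :=
    (hH.continuous_fderiv one_ne_zero).clm_comp continuous_const
  have hHc : ∀ x, Continuous (H x) := fun x => hH.continuous.comp (continuous_const.prodMk continuous_id)
  -- Continuity on the compact set (closed unit ball) × `[0, 1]` supplies the constant that
  -- dominates the derivative of the integrand.
  obtain ⟨C, hC⟩ := ((isCompact_closedBall x₀ 1).prod (isCompact_Icc (a := (0 : ℝ)) (b := 1))).exists_bound_of_continuousOn hc.continuousOn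
  refine intervalIntegral.hasFDerivAt_integral_of_dominated_of_fderiv_le (bound := fun _ => C)
    (F' := fun x t => (fderiv ℝ (Function.uncurry H) (x, t)).comp (ContinuousLinearMap.inl ℝ E ℝ))
    (Metric.closedBall_mem_nhds x₀ one_pos)
    (Eventually.of_forall fun x => (hHc x).aestronglyMeasurable) ((hHc x₀).intervalIntegrable _ _)
    (hc.comp (continuous_const.prodMk continuous_id)).aestronglyMeasurable ?_ intervalIntegrable_const ?_
  · refine Eventually.of_forall fun t ht x hx => hC (x, t) ⟨hx, ?_⟩
    rw [Set.uIoc_of_le zero_le_one] at ht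
    exact Set.Ioc_subset_Icc_self ht
  · refine Eventually.of_forall fun t _ x _ => ?_
    have h1 : HasFDerivAt (Function.uncurry H) (fderiv ℝ (Function.uncurry H) (x, t)) (x, t) :=
      (hH.differentiable one_ne_zero).differentiableAt.hasFDerivAt
    exact HasFDerivAt.comp (g := Function.uncurry H) (f := fun x => (x, t)) x h1 (hasFDerivAt_prodMk_left x t)

/-- Differentiation under the integral sign replaces values in `G` by continuous linear maps into
`G`, so the target space has to vary in the induction on `m`. -/
theorem contDiff_intervalIntegral.{u} {E : Type} [NormedAddCommGroup E] [NormedSpace ℝ E] [FiniteDimensional ℝ E] (m : ℕ) :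
    ∀ {G : Type u} [NormedAddCommGroup G] [NormedSpace ℝ G] [CompleteSpace G] (H : E → ℝ → G),
      ContDiff ℝ (⊤ : ℕ∞) (Function.uncurry H) → ContDiff ℝ m fun x => ∫ t in (0 : ℝ)..1, H x t := by
  induction m with
  | zero =>
    intro G _ _ _ H hH
    exact contDiff_zero.2 (intervalIntegral.continuous_parametric_intervalIntegral_of_continuous' hH.continuous 0 1)
  | succ m ih =>
    intro G _ _ _ H hH
    have hH1 : ContDiff ℝ 1 (Function.uncurry H) := hH.of_le (by exact_mod_cast le_top)
    have h := hasFDerivAt_intervalIntegral hH1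
    rw [show ((m + 1 : ℕ) : WithTop ℕ∞) = m + 1 by push_cast; rfl, contDiff_succ_iff_fderiv]
    refine ⟨fun x => (h x).differentiableAt, by simp, ?_⟩
    rw [show fderiv ℝ (fun x => ∫ t in (0 : ℝ)..1, H x t) = _ from funext fun x => (h x).fderiv]
    refine ih (fun x t => (fderiv ℝ (Function.uncurry H) (x, t)).comp (ContinuousLinearMap.inl ℝ E ℝ)) ?_
    exact (hH.fderiv_right (m := (⊤ : ℕ∞)) (by norm_cast)).clm_comp contDiff_const

variable {𝕜 : Type*} [RCLike 𝕜] {ι : Type} [Fintype ι] [DecidableEq ι]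

/-- Hadamard's lemma. -/
theorem exists_hadamard {F : (ι → ℝ) → 𝕜} (hF : ContDiff ℝ (⊤ : ℕ∞) F) (a : ι → ℝ) :
    ∃ g : ι → (ι → ℝ) → 𝕜, (∀ i, ContDiff ℝ (⊤ : ℕ∞) (g i)) ∧ ∀ y, F y - F a = ∑ i, ((y i - a i : ℝ) : 𝕜) * g i y := by
  -- The fundamental theorem of calculus along the segment from `a` to `y`, with `y - a` written in
  -- the standard basis.
  refine ⟨fun i y => ∫ t in (0 : ℝ)..1, fderiv ℝ F (a + t • (y - a)) (Pi.single i 1), fun i => ?_, fun y => ?_⟩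
  · refine contDiff_infty.2 fun m => contDiff_intervalIntegral m (fun y t => fderiv ℝ F (a + t • (y - a)) (Pi.single i 1)) ?_
    refine ContDiff.clm_apply ?_ contDiff_const
    refine (hF.fderiv_right (m := (⊤ : ℕ∞)) (by norm_cast)).comp (g := fderiv ℝ F) (f := fun p : (ι → ℝ) × ℝ => a + p.2 • (p.1 - a)) ?_
    fun_prop
  · have hd : Differentiable ℝ F := hF.differentiable (by simp)
    have hcd : Continuous (fderiv ℝ F) := hF.continuous_fderiv (by simp)
    have hline : Continuous fun t : ℝ => fderiv ℝ F (a + t • (y - a)) := hcd.comp (by fun_prop)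
    have h1 : ∫ t in (0 : ℝ)..1, fderiv ℝ F (a + t • (y - a)) (y - a) = F y - F a := by
      have := intervalIntegral.integral_eq_sub_of_hasDerivAt (a := 0) (b := 1) (f := fun t : ℝ => F (a + t • (y - a)))
        (f' := fun t => fderiv ℝ F (a + t • (y - a)) (y - a)) ?_ ?_
      · simpa using this
      · intro t _
        have h2 : HasDerivAt (fun t : ℝ => a + t • (y - a)) (y - a) t := by
          simpa using ((hasDerivAt_id t).smul_const (y - a)).const_add a
        exact (hd _).hasFDerivAt.comp_hasDerivAt t h2
      · exact (hline.clm_apply continuous_const).intervalIntegrable _ _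
    rw [← h1]
    have h3 : ∀ t : ℝ, fderiv ℝ F (a + t • (y - a)) (y - a) = ∑ i, ((y i - a i : ℝ) : 𝕜) * fderiv ℝ F (a + t • (y - a)) (Pi.single i 1) := by
      intro t
      generalize fderiv ℝ F (a + t • (y - a)) = L
      conv_lhs => rw [show y - a = ∑ i, (y i - a i) • (Pi.single i 1 : ι → ℝ) by
        ext j
        simp [Finset.sum_apply, Pi.single_apply]]
      rw [map_sum]
      refine Finset.sum_congr rfl fun i _ => ?_
      rw [map_smul, RCLike.real_smul_eq_coe_mul]
    simp only [h3]
    rw [intervalIntegral.integral_finsetSum]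
    · simp only [intervalIntegral.integral_const_mul]
    · intro i _
      exact (continuous_const.mul (hline.clm_apply continuous_const)).intervalIntegrable _ _

/-- Hadamard's lemma on an arbitrary open set. -/
theorem exists_hadamard_on {V : Set (ι → ℝ)} (hV : IsOpen V) {F : (ι → ℝ) → 𝕜} (hF : ContDiffOn ℝ (⊤ : ℕ∞) F V) {a : ι → ℝ} (ha : a ∈ V) :
    ∃ g : ι → (ι → ℝ) → 𝕜, (∀ i, ContDiffOn ℝ (⊤ : ℕ∞) (g i) V) ∧ ∀ y, F y - F a = ∑ i, ((y i - a i : ℝ) : 𝕜) * g i y := by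
  obtain ⟨ε, hε, hεV⟩ := Metric.isOpen_iff.1 hV a ha
  -- Write `F - F a = (χ F - F a) + (1 - χ) F`. The first part extends smoothly to the whole space,
  -- and `χ a = 1`. The second vanishes near `a`, where it must be divided by `|y - a|²`. The bump
  -- `ψ` keeps the denominator away from zero at `a`, and its support lies where `χ = 1`, so it does
  -- not affect the quotient.
  let χ : ContDiffBump a := ⟨ε / 3, ε / 2, by positivity, by linarith⟩
  let ψ : ContDiffBump a := ⟨ε / 6, ε / 3, by positivity, by linarith⟩
  have hofReal : ∀ {f : (ι → ℝ) → ℝ}, ContDiff ℝ (⊤ : ℕ∞) f → ContDiff ℝ (⊤ : ℕ∞) fun y => ((f y : ℝ) : 𝕜) := fun h =>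
    (RCLike.ofRealCLM (K := 𝕜)).contDiff.comp h
  have hχF : ContDiff ℝ (⊤ : ℕ∞) fun y => ((χ y : ℝ) : 𝕜) * F y := by
    rw [contDiff_iff_contDiffAt]
    intro y
    by_cases hy : y ∈ V
    · exact (hofReal χ.contDiff).contDiffAt.mul (hF.contDiffAt (hV.mem_nhds hy))
    · have h0 : y ∈ (tsupport χ)ᶜ := by
        rw [χ.tsupport_eq]
        intro h
        exact hy (hεV (Metric.closedBall_subset_ball (by change ε / 2 < ε; linarith) h))
      have : (fun y => ((χ y : ℝ) : 𝕜) * F y) =ᶠ[𝓝 y] fun _ => 0 := by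
        filter_upwards [(isClosed_tsupport χ).isOpen_compl.mem_nhds h0] with z hz
        rw [image_eq_zero_of_notMem_tsupport hz]
        simp
      exact contDiffAt_const.congr_of_eventuallyEq this
  obtain ⟨g, hg, hgF⟩ := exists_hadamard hχF a
  let den : (ι → ℝ) → ℝ := fun y => ∑ i, (y i - a i) ^ 2 + ψ y
  have hden : ContDiff ℝ (⊤ : ℕ∞) den := by
    refine ContDiff.add (ContDiff.sum fun i _ => ?_) ψ.contDiff
    exact ((contDiff_apply ℝ ℝ i).sub contDiff_const).pow 2
  have hpos : ∀ y, den y ≠ 0 := by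
    intro y h
    have h1 : 0 ≤ ∑ i, (y i - a i) ^ 2 := Finset.sum_nonneg fun i _ => sq_nonneg _
    have h2 : ψ y = 0 := by
      have := ψ.nonneg' y
      change ∑ i, (y i - a i) ^ 2 + ψ y = 0 at h
      linarith
    have h3 : ∑ i, (y i - a i) ^ 2 = 0 := by
      change ∑ i, (y i - a i) ^ 2 + ψ y = 0 at h
      linarith
    rw [Finset.sum_eq_zero_iff_of_nonneg fun i _ => sq_nonneg _] at h3
    have h4 : y = a := funext fun i => by
      have := h3 i (Finset.mem_univ i)
      rwa [sq_eq_zero_iff, sub_eq_zero] at this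
    rw [h4, ψ.eventuallyEq_one.self_of_nhds] at h2
    exact one_ne_zero h2
  have hid : ∀ y, (1 - χ y) * ∑ i, (y i - a i) ^ 2 = (1 - χ y) * den y := by
    intro y
    by_cases hy : y ∈ Metric.closedBall a (ε / 3)
    · rw [χ.one_of_mem_closedBall hy]
      simp
    · have : ψ y = 0 := ψ.zero_of_le_dist (by rw [Metric.mem_closedBall] at hy; exact (not_le.1 hy).le)
      change _ = (1 - χ y) * (∑ i, (y i - a i) ^ 2 + ψ y)
      rw [this, add_zero]
  -- The extra term uses `∑ (y i - a i)² / den = 1` wherever `1 - χ` is nonzero, so it contributes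
  -- exactly `(1 - χ) F`.
  refine ⟨fun i y => g i y + ((y i - a i : ℝ) : 𝕜) * ((((1 - χ y) / den y : ℝ) : 𝕜) * F y), fun i => ?_, fun y => ?_⟩
  · refine (hg i).contDiffOn.add (ContDiffOn.mul (ContDiff.contDiffOn (hofReal ?_)) (ContDiffOn.mul (ContDiff.contDiffOn (hofReal ?_)) hF))
    · exact (contDiff_apply ℝ ℝ i).sub contDiff_const
    · exact (contDiff_const.sub χ.contDiff).div hden hpos
  · simp only [mul_add, Finset.sum_add_distrib, ← hgF y, χ.eventuallyEq_one.self_of_nhds]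
    simp only [← mul_assoc, ← Finset.sum_mul, ← RCLike.ofReal_mul, ← RCLike.ofReal_sum]
    have : (∑ i, (y i - a i) * (y i - a i)) * ((1 - χ y) / den y) = 1 - χ y := by
      simp only [← sq]
      rw [← mul_div_assoc, mul_comm, hid, mul_div_assoc, div_self (hpos y), mul_one]
    rw [this]
    simp
    ring

end

section
variable {𝕜 : Type*} [RCLike 𝕜] {ι : Type} [Fintype ι] [DecidableEq ι] {V : Opens (ι → ℝ)}

namespace smoothFun

theorem ext {f g : smoothFun 𝕜 V} (h : ∀ x, f.1 x = g.1 x) : f = g := Subtype.ext (funext h)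

/-- The restriction of a function that is smooth on `V`. -/
def ofContDiffOn (F : (ι → ℝ) → 𝕜) (hF : ContDiffOn ℝ (⊤ : ℕ∞) F V) : smoothFun 𝕜 V := ⟨fun x => F x, F, hF, fun _ => rfl⟩

/-- The partial derivatives. -/
def pderiv (i : ι) (f : smoothFun 𝕜 V) : smoothFun 𝕜 V :=
  ofContDiffOn (fun x => fderiv ℝ f.2.choose x (Pi.single i 1))
    ((f.2.choose_spec.1.fderiv_of_isOpen V.2 (m := (⊤ : ℕ∞)) (by norm_cast)).clm_apply contDiffOn_const)

/-- The extension chosen in the definition is arbitrary off `V`, but a derivative at a point sees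
only the germ. Hence any function that agrees with `f` on an open subset can be used instead. -/
theorem pderiv_eq (i : ι) (f : smoothFun 𝕜 V) (F : (ι → ℝ) → 𝕜) {V' : Opens (ι → ℝ)} (h : V' ≤ V)
    (hf : ∀ x (hx : x ∈ V'), f.1 ⟨x, h hx⟩ = F x) (x : ι → ℝ) (hx : x ∈ V') :
    (pderiv i f).1 ⟨x, h hx⟩ = fderiv ℝ F x (Pi.single i 1) := by
  change fderiv ℝ f.2.choose x (Pi.single i 1) = _
  rw [Filter.EventuallyEq.fderiv_eq]
  filter_upwards [V'.2.mem_nhds hx] with y hy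
  rw [← hf y hy, f.2.choose_spec.2 ⟨y, h hy⟩]

theorem pderiv_congr (i : ι) {V' : Opens (ι → ℝ)} (h : V' ≤ V) (f : smoothFun 𝕜 V) (f' : smoothFun 𝕜 V')
    (hf : ∀ x (hx : x ∈ V'), f'.1 ⟨x, hx⟩ = f.1 ⟨x, h hx⟩) (x : ι → ℝ) (hx : x ∈ V') :
    (pderiv i f').1 ⟨x, hx⟩ = (pderiv i f).1 ⟨x, h hx⟩ := by
  rw [pderiv_eq i f' f'.2.choose le_rfl (fun x hx => f'.2.choose_spec.2 ⟨x, hx⟩) x hx,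
    pderiv_eq i f f'.2.choose h (fun x hx => (hf x hx).symm.trans (f'.2.choose_spec.2 ⟨x, hx⟩)) x hx]

theorem differentiableAt (f : smoothFun 𝕜 V) (x : V) : DifferentiableAt ℝ f.2.choose x :=
  (f.2.choose_spec.1.contDiffAt (V.2.mem_nhds x.2)).differentiableAt (by simp)

theorem pderiv_add (i : ι) (f g : smoothFun 𝕜 V) : pderiv i (f + g) = pderiv i f + pderiv i g := by
  refine ext fun x => ?_
  rw [pderiv_eq i (f + g) (f.2.choose + g.2.choose) le_rfl (fun x hx => by
    rw [Pi.add_apply, ← f.2.choose_spec.2 ⟨x, hx⟩, ← g.2.choose_spec.2 ⟨x, hx⟩]; rfl) x.1 x.2,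
    fderiv_add (smoothFun.differentiableAt f x) (smoothFun.differentiableAt g x)]
  rfl

theorem pderiv_mul (i : ι) (f g : smoothFun 𝕜 V) : pderiv i (f * g) = pderiv i f * g + f * pderiv i g := by
  refine ext fun x => ?_
  rw [pderiv_eq i (f * g) (f.2.choose * g.2.choose) le_rfl (fun x hx => by
    rw [Pi.mul_apply, ← f.2.choose_spec.2 ⟨x, hx⟩, ← g.2.choose_spec.2 ⟨x, hx⟩]; rfl) x.1 x.2,
    fderiv_mul (smoothFun.differentiableAt f x) (smoothFun.differentiableAt g x)]
  change f.2.choose x * (pderiv i g).1 x + g.2.choose x * (pderiv i f).1 x = (pderiv i f).1 x * g.1 x + f.1 x * (pderiv i g).1 x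
  rw [← f.2.choose_spec.2 x, ← g.2.choose_spec.2 x]
  ring

theorem pderiv_smul (i : ι) (c : 𝕜) (f : smoothFun 𝕜 V) : pderiv i (c • f) = c • pderiv i f := by
  refine ext fun x => ?_
  rw [pderiv_eq i (c • f) (c • f.2.choose) le_rfl (fun x hx => by
    rw [Pi.smul_apply, ← f.2.choose_spec.2 ⟨x, hx⟩]; rfl) x.1 x.2,
    fderiv_const_smul (smoothFun.differentiableAt f x)]
  rfl

theorem pderiv_comm (i j : ι) (f : smoothFun 𝕜 V) : pderiv i (pderiv j f) = pderiv j (pderiv i f) := by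
  refine ext fun x => ?_
  have hx := f.2.choose_spec.1.contDiffAt (V.2.mem_nhds x.2)
  have hd : DifferentiableAt ℝ (fderiv ℝ f.2.choose) x :=
    (hx.fderiv_right (m := 1) (by norm_cast)).differentiableAt one_ne_zero
  have key : ∀ i j, (pderiv i (pderiv j f)).1 x = fderiv ℝ (fderiv ℝ f.2.choose) x (Pi.single i 1) (Pi.single j 1) := by
    intro i j
    rw [pderiv_eq i (pderiv j f) (fun y => fderiv ℝ f.2.choose y (Pi.single j 1)) le_rfl (fun _ _ => rfl) x.1 x.2,
      fderiv_clm_apply hd (differentiableAt_const _)]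
    simp
  rw [key, key]
  exact (hx.isSymmSndFDerivAt (by simp only [minSmoothness_of_isRCLikeNormedField]; exact WithTop.coe_le_coe.2 le_top)) _ _

theorem pderiv_coordFun (i j : ι) : pderiv i (coordFun 𝕜 V j) = if j = i then 1 else 0 := by
  refine ext fun x => ?_
  rw [pderiv_eq i (coordFun 𝕜 V j) (fun x => ((x j : ℝ) : 𝕜)) le_rfl (fun _ _ => rfl) x.1 x.2]
  have h : HasFDerivAt (fun x : ι → ℝ => ((x j : ℝ) : 𝕜)) ((RCLike.ofRealCLM (K := 𝕜)).comp (ContinuousLinearMap.proj j)) x.1 :=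
    (RCLike.ofRealCLM (K := 𝕜)).hasFDerivAt.comp x.1 (ContinuousLinearMap.proj (R := ℝ) (φ := fun _ : ι => ℝ) j).hasFDerivAt
  rw [h.fderiv]
  by_cases hij : j = i
  · subst hij
    simp
  · simp [hij]

theorem hadamard (f : smoothFun 𝕜 V) (a : V) :
    ∃ g : ι → smoothFun 𝕜 V, f = algebraMap 𝕜 _ (f.1 a) + ∑ i, (coordFun 𝕜 V i - algebraMap 𝕜 _ ((a.1 i : ℝ) : 𝕜)) * g i := by
  obtain ⟨g, hg, h⟩ := exists_hadamard_on V.2 f.2.choose_spec.1 a.2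
  refine ⟨fun i => ofContDiffOn (g i) (hg i), ext fun x => ?_⟩
  have := h x.1
  rw [← f.2.choose_spec.2 x, ← f.2.choose_spec.2 a, sub_eq_iff_eq_add'] at this
  rw [this]
  simp only [RCLike.ofReal_sub, Subalgebra.coe_add, Pi.add_apply, AddSubmonoidClass.coe_finsetSum, Finset.sum_apply]
  rfl

theorem isUnit_of_ne_zero {f : smoothFun 𝕜 V} (h : ∀ x, f.1 x ≠ 0) : IsUnit f := by
  refine IsUnit.of_mul_eq_one (ofContDiffOn (fun x => (f.2.choose x)⁻¹) (f.2.choose_spec.1.inv fun x hx => ?_)) (ext fun x => ?_)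
  · rw [← f.2.choose_spec.2 ⟨x, hx⟩]
    exact h _
  · change f.1 x * (f.2.choose x)⁻¹ = 1
    rw [← f.2.choose_spec.2 x, mul_inv_cancel₀ (h x)]

end smoothFun
end

end SuperGeom
end

/-! ### Coordinate frames on smooth functions with odd variables -/

noncomputable section
namespace SuperGeom
open FormalFun

section
variable {𝕜 A : Type*} [CommRing 𝕜] [Ring A] [Algebra 𝕜 A] [SuperAlgebra 𝕜 A] {r : ℕ}

/-- The quotient by the odd variables. -/
def Gr.body : Gr 𝕜 A r →ₐ[𝕜] A := AlgHom.ofLinearMap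
  { toFun := fun f => f ∅
    map_add' := fun f g => rfl
    map_smul' := fun c f => rfl }
  (by
    change (1 : Gr 𝕜 A r) ∅ = 1
    rw [Gr.one_apply, if_pos rfl])
  (fun f g => by
    change (f * g) ∅ = f ∅ * g ∅
    rw [Gr.mul_apply, Finset.powerset_empty, Finset.sum_singleton, Finset.sdiff_empty, koszul_empty_left, one_smul, Finset.card_empty,
      twist_zero])

/-- An element without body has odd degree at least one in every term, so its `k`-th power starts in
odd degree `k`. -/
theorem Gr.pow_apply_eq_zero {f : Gr 𝕜 A r} (h : f ∅ = 0) (k : ℕ) : ∀ T : Finset (Fin r), T.card < k → (f ^ k) T = 0 := by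
  induction k with
  | zero => exact fun T hT => absurd hT (Nat.not_lt_zero _)
  | succ k ih =>
    intro T hT
    rw [pow_succ, Gr.mul_apply]
    refine Finset.sum_eq_zero fun S hS => ?_
    rw [Finset.mem_powerset] at hS
    by_cases hk : S.card < k
    · rw [ih S hk, zero_mul, smul_zero]
    · rw [Finset.eq_of_subset_of_card_le hS (by omega), Finset.sdiff_self, h, map_zero, mul_zero, smul_zero]

theorem Gr.isNilpotent {f : Gr 𝕜 A r} (h : f ∅ = 0) : IsNilpotent f :=
  ⟨r + 1, Gr.ext fun T => by
    rw [Gr.pow_apply_eq_zero h, Gr.zero_apply]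
    exact Nat.lt_succ_of_le ((Finset.card_le_univ T).trans_eq (Fintype.card_fin r))⟩

theorem Gr.single_empty_mul_single_empty (a b : A) : (Gr.single ∅ a * Gr.single ∅ b : Gr 𝕜 A r) = Gr.single ∅ (a * b) := by
  ext T
  rw [Gr.single_empty_mul, Gr.single_apply, Gr.single_apply]
  split_ifs <;> simp

/-- The element is its body plus a nilpotent. The two commute because the body is even, so
invertibility of the body suffices. -/
theorem Gr.isUnit_of_body {f : Gr 𝕜 A r} (h : IsUnit (f ∅)) (hf : SuperAlgebra.parity (𝕜 := 𝕜) (f ∅) = f ∅) : IsUnit f := by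
  have hu : IsUnit (Gr.single ∅ (f ∅) : Gr 𝕜 A r) := by
    obtain ⟨u, hu⟩ := h
    refine ⟨⟨Gr.single ∅ (u : A), Gr.single ∅ ((u⁻¹ : Aˣ) : A), ?_, ?_⟩, by simp [hu]⟩
    · rw [Gr.single_empty_mul_single_empty, Units.mul_inv]; rfl
    · rw [Gr.single_empty_mul_single_empty, Units.inv_mul]; rfl
  have hn : IsNilpotent (f - Gr.single ∅ (f ∅)) := Gr.isNilpotent (by rw [Gr.sub_apply, Gr.single_apply, if_pos rfl, sub_self])
  have hc : Commute (Gr.single ∅ (f ∅) : Gr 𝕜 A r) (f - Gr.single ∅ (f ∅)) := by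
    refine SuperAlgebra.even_mul (𝕜 := 𝕜) _ _ ?_
    ext S
    rw [Gr.parity_apply, Gr.single_apply]
    split_ifs with hS
    · subst hS; simp [hf]
    · simp
  have := hn.isUnit_add_left_of_commute hu hc.symm
  rwa [add_sub_cancel] at this

end

section
variable (𝕜 B : Type*) [CommRing 𝕜] [Ring B] [Algebra 𝕜 B] [SuperAlgebra 𝕜 B] (n : ℕ)

/-- A purely even algebra of functions with `2n` coordinates for which Hadamard's lemma holds. -/
structure EvenCoords where
  parity_eq : ∀ f : B, SuperAlgebra.parity (𝕜 := 𝕜) f = f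
  d : Fin n ⊕ Fin n → Module.End 𝕜 B
  d_mul : ∀ i f g, d i (f * g) = d i f * g + f * d i g
  d_comm : ∀ i j f, d i (d j f) = d j (d i f)
  x : Fin n ⊕ Fin n → B
  d_x : ∀ i j, d i (x j) = if j = i then 1 else 0
  pt : Type
  ev : pt → B →ₐ[𝕜] 𝕜
  eq_zero : ∀ f, (∀ p, ev p f = 0) → f = 0
  hadamard : ∀ f p, ∃ g : Fin n ⊕ Fin n → B, f = algebraMap 𝕜 B (ev p f) + ∑ i, (x i - algebraMap 𝕜 B (ev p (x i))) * g i

end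

section
variable {𝕜 B : Type*} [CommRing 𝕜] [Ring B] [Algebra 𝕜 B] [SuperAlgebra 𝕜 B] {n r : ℕ} (C : EvenCoords 𝕜 B n)

namespace EvenCoords

theorem twist_eq (C : EvenCoords 𝕜 B n) (k : ℕ) (f : B) : twist 𝕜 k f = f := twist_of_even (C.parity_eq f) k

theorem d_one (i) : C.d i 1 = 0 := by simpa using C.d_mul i 1 1

/-- The partial derivatives in the even variables. -/
def pderiv (i : Fin n ⊕ Fin n) : Module.End 𝕜 (Gr 𝕜 B r) where
  toFun f := fun S => C.d i (f S)
  map_add' f g := Gr.ext fun S => map_add (C.d i) _ _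
  map_smul' c f := Gr.ext fun S => map_smul (C.d i) c _

theorem pderiv_apply (i : Fin n ⊕ Fin n) (f : Gr 𝕜 B r) (S) : C.pderiv i f S = C.d i (f S) := rfl

theorem pderiv_mul (i : Fin n ⊕ Fin n) (f g : Gr 𝕜 B r) : C.pderiv i (f * g) = C.pderiv i f * g + f * C.pderiv i g := by
  ext T
  rw [pderiv_apply, Gr.add_apply, Gr.mul_apply, Gr.mul_apply, Gr.mul_apply, map_sum, ← Finset.sum_add_distrib]
  refine Finset.sum_congr rfl fun S _ => ?_
  simp only [C.twist_eq, map_zsmul, C.d_mul, smul_add, pderiv_apply]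

theorem deriv_pderiv (i) (j : Fin r) (f : Gr 𝕜 B r) : Gr.deriv j (C.pderiv i f) = C.pderiv i (Gr.deriv j f) := by
  ext S
  rw [pderiv_apply, Gr.deriv_apply, Gr.deriv_apply, pderiv_apply, C.parity_eq, C.parity_eq]
  split_ifs
  · rw [map_zero]
  · rw [map_zsmul]

/-- The coordinate vector fields. -/
def frame : Frame 𝕜 (Gr 𝕜 B r) n r where
  D
    | .inl i => C.pderiv i
    | .inr j => { toFun := Gr.deriv j, map_add' := Gr.deriv_add j, map_smul' := Gr.deriv_smul j }
  der
    | .inl i => ⟨fun f => by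
        change SuperAlgebra.parity (𝕜 := 𝕜) (C.pderiv i f) = (-1 : ℤ) ^ 0 • C.pderiv i (SuperAlgebra.parity (𝕜 := 𝕜) f)
        rw [pow_zero, one_smul]
        ext S
        rw [Gr.parity_apply, pderiv_apply, pderiv_apply, Gr.parity_apply, map_zsmul, C.parity_eq, C.parity_eq], fun f g => by
        change C.pderiv i (f * g) = C.pderiv i f * g + twist 𝕜 0 f * C.pderiv i g
        rw [twist_zero, pderiv_mul]⟩
    | .inr j => ⟨fun f => by
        change SuperAlgebra.parity (𝕜 := 𝕜) (Gr.deriv j f) = (-1 : ℤ) ^ 1 • Gr.deriv j (SuperAlgebra.parity (𝕜 := 𝕜) f)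
        rw [Gr.parity_deriv, pow_one, neg_one_smul], fun f g => by
        change Gr.deriv j (f * g) = Gr.deriv j f * g + twist 𝕜 1 f * Gr.deriv j g
        rw [twist_one, Gr.deriv_mul]⟩
  comm := by
    rintro (i | i) (j | j) f
    · change C.pderiv i (C.pderiv j f) = (-1 : ℤ) ^ 0 • C.pderiv j (C.pderiv i f)
      rw [pow_zero, one_smul]
      exact Gr.ext fun S => C.d_comm i j _
    · change C.pderiv i (Gr.deriv j f) = (-1 : ℤ) ^ 0 • Gr.deriv j (C.pderiv i f)
      rw [pow_zero, one_smul, deriv_pderiv]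
    · change Gr.deriv i (C.pderiv j f) = (-1 : ℤ) ^ 0 • C.pderiv j (Gr.deriv i f)
      rw [pow_zero, one_smul, deriv_pderiv]
    · change Gr.deriv i (Gr.deriv j f) = (-1 : ℤ) ^ 1 • Gr.deriv j (Gr.deriv i f)
      rw [pow_one, neg_one_smul, Gr.deriv_deriv]

theorem frame_inl (i) (f : Gr 𝕜 B r) : C.frame.D (.inl i) f = C.pderiv i f := rfl
theorem frame_inr (j) (f : Gr 𝕜 B r) : C.frame.D (.inr j) f = Gr.deriv j f := rfl

/-- The even and odd coordinates. -/
def coord : (Fin n ⊕ Fin n) ⊕ Fin r → Gr 𝕜 B r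
  | .inl i => Gr.single ∅ (C.x i)
  | .inr j => Gr.single {j} 1

theorem coord_parity (k) : HasParity 𝕜 (coordParity k) (C.coord k : Gr 𝕜 B r) := by
  rcases k with i | j
  · change SuperAlgebra.parity (𝕜 := 𝕜) (Gr.single ∅ _) = (-1 : ℤ) ^ 0 • Gr.single ∅ _
    ext S
    rw [Gr.parity_apply, pow_zero, one_smul, Gr.single_apply, C.parity_eq]
    split_ifs with h
    · subst h; simp
    · simp
  · change SuperAlgebra.parity (𝕜 := 𝕜) (Gr.single {j} 1) = (-1 : ℤ) ^ 1 • Gr.single {j} 1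
    ext S
    rw [Gr.parity_apply, pow_one, neg_one_smul, Gr.neg_apply, Gr.single_apply, C.parity_eq]
    split_ifs with h
    · subst h; simp
    · simp

theorem frame_coord (k l) : C.frame.D k (C.coord l : Gr 𝕜 B r) = if l = k then 1 else 0 := by
  rcases k with i | j <;> rcases l with i' | j'
  · rw [frame_inl]
    ext S
    rw [pderiv_apply, coord, Gr.single_apply]
    by_cases hS : S = ∅
    · rw [if_pos hS, C.d_x]
      by_cases h : i' = i
      · simp [h, hS, Gr.one_apply]
      · simp [h, Gr.zero_apply]
    · rw [if_neg hS, map_zero]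
      split_ifs
      · rw [Gr.one_apply, if_neg hS]
      · rfl
  · rw [frame_inl, if_neg (by simp)]
    ext S
    rw [pderiv_apply, coord, Gr.single_apply, Gr.zero_apply]
    split_ifs
    · exact C.d_one i
    · exact map_zero _
  · rw [frame_inr, if_neg (by simp)]
    ext S
    rw [Gr.deriv_apply, coord, Gr.single_apply, if_neg (Finset.insert_ne_empty _ _), map_zero, smul_zero, ite_self, Gr.zero_apply]
  · rw [frame_inr]
    ext S
    rw [Gr.deriv_apply, coord, Gr.single_apply]
    by_cases h : j' = j
    · subst h
      rw [if_pos rfl, Gr.one_apply]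
      by_cases hS : S = ∅
      · subst hS
        simp [koszul_empty_right]
      · rw [if_neg hS]
        split_ifs with h1 h2
        · rfl
        · exact absurd ((Finset.erase_insert h1).symm.trans (h2 ▸ Finset.erase_singleton j')) hS
        · simp
    · rw [if_neg (show ¬(Sum.inr j' : (Fin n ⊕ Fin n) ⊕ Fin r) = Sum.inr j by simpa using h), Gr.zero_apply]
      split_ifs with h1 h2
      · rfl
      · have : j ∈ ({j'} : Finset (Fin r)) := h2 ▸ Finset.mem_insert_self j S
        exact absurd (Finset.mem_singleton.1 this).symm h
      · simp

/-- The value at a point. -/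
def evalAt (p : C.pt) : Gr 𝕜 B r →ₐ[𝕜] 𝕜 := (C.ev p).comp Gr.body

theorem evalAt_apply (p : C.pt) (f : Gr 𝕜 B r) : C.evalAt p f = C.ev p (f ∅) := rfl

theorem isSuper_evalAt (p : C.pt) : IsSuper (C.evalAt p : Gr 𝕜 B r →ₐ[𝕜] 𝕜) := fun f => by
  rw [evalAt_apply, Gr.parity_apply, C.parity_eq, Finset.card_empty, pow_zero, one_smul]
  rfl

theorem evalAt_coord_inr (p : C.pt) (j : Fin r) : C.evalAt p (C.coord (.inr j) : Gr 𝕜 B r) = 0 := by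
  rw [evalAt_apply, coord, Gr.single_apply, if_neg (Finset.singleton_ne_empty j).symm, map_zero]

theorem evalAt_coord_inl (p : C.pt) (i) : C.evalAt p (C.coord (.inl i) : Gr 𝕜 B r) = C.ev p (C.x i) := by
  rw [evalAt_apply, coord, Gr.single_apply, if_pos rfl]

theorem single_hadamard (p : C.pt) (b : B) : ∃ g : Fin n ⊕ Fin n → B, (Gr.single ∅ b : Gr 𝕜 B r) =
    algebraMap 𝕜 _ (C.ev p b) + ∑ i, (C.coord (.inl i) - algebraMap 𝕜 _ (C.ev p (C.x i))) * Gr.single ∅ (g i) := by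
  obtain ⟨g, hg⟩ := C.hadamard b p
  refine ⟨g, ?_⟩
  ext T
  rw [Gr.add_apply, Gr.sum_apply]
  simp only [coord, Gr.mul_single_empty, C.twist_eq, Gr.sub_apply, Gr.algebraMap_eq, Gr.single_apply]
  split_ifs
  · exact hg
  · simp

theorem single_eq_coord_mul {j : Fin r} {S : Finset (Fin r)} (hj : j ∈ S) (b : B) :
    (Gr.single S b : Gr 𝕜 B r) = C.coord (.inr j) * Gr.single (S.erase j) (koszul {j} (S.erase j) • b) := by
  rw [coord, Gr.single_mul_single, C.twist_eq, one_mul, if_pos (Finset.disjoint_singleton_left.2 (Finset.notMem_erase j S)),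
    ← Finset.insert_eq, Finset.insert_erase hj]
  ext T
  rw [Gr.zsmul_apply, Gr.single_apply, Gr.single_apply]
  split_ifs
  · rw [smul_smul, koszul_mul_self, one_smul]
  · rw [smul_zero]

/-- The super version of Hadamard's lemma. -/
theorem gr_hadamard (f : Gr 𝕜 B r) (p : C.pt) : ∃ g : (Fin n ⊕ Fin n) ⊕ Fin r → Gr 𝕜 B r,
    f = algebraMap 𝕜 _ (C.evalAt p f) + ∑ l, (C.coord l - algebraMap 𝕜 _ (C.evalAt p (C.coord l : Gr 𝕜 B r))) * g l := by
  let P : Gr 𝕜 B r → Prop := fun f => ∃ g : (Fin n ⊕ Fin n) ⊕ Fin r → Gr 𝕜 B r,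
    f = algebraMap 𝕜 _ (C.evalAt p f) + ∑ l, (C.coord l - algebraMap 𝕜 _ (C.evalAt p (C.coord l : Gr 𝕜 B r))) * g l
  have hadd : ∀ f f', P f → P f' → P (f + f') := by
    rintro f f' ⟨g, hg⟩ ⟨g', hg'⟩
    refine ⟨fun l => g l + g' l, ?_⟩
    simp only [mul_add, Finset.sum_add_distrib, map_add (C.evalAt p), map_add (algebraMap 𝕜 (Gr 𝕜 B r))]
    nth_rw 1 [hg, hg']
    abel
  -- The summand with `S = ∅` is handled by Hadamard's lemma for the even algebra. Every other one
  -- is divisible by some odd coordinate and has value zero at the point.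
  have h : ∀ s : Finset (Finset (Fin r)), P (∑ S ∈ s, Gr.single S (f S)) := by
    intro s
    induction s using Finset.induction_on with
    | empty => exact ⟨0, by simp⟩
    | insert S s hS ih =>
      rw [Finset.sum_insert hS]
      refine hadd _ _ ?_ ih
      by_cases h0 : S = ∅
      · subst h0
        obtain ⟨g, hg⟩ := C.single_hadamard (r := r) p (f ∅)
        refine ⟨Sum.elim (fun i => Gr.single ∅ (g i)) 0, ?_⟩
        rw [Fintype.sum_sum_type (α₁ := Fin n ⊕ Fin n)]
        simp only [Sum.elim_inl, Sum.elim_inr, Pi.zero_apply, mul_zero, Finset.sum_const_zero, add_zero, evalAt_coord_inl]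
        rw [C.evalAt_apply p (Gr.single _ _), Gr.single_apply, if_pos rfl]
        exact hg
      · obtain ⟨j, hj⟩ := Finset.nonempty_iff_ne_empty.2 h0
        refine ⟨Pi.single (.inr j) (Gr.single (S.erase j) (koszul {j} (S.erase j) • f S)), ?_⟩
        rw [Finset.sum_eq_single (.inr j) (fun l _ hl => by rw [Pi.single_eq_of_ne hl, mul_zero]) (by simp), Pi.single_eq_same,
          evalAt_coord_inr, map_zero, sub_zero, ← C.single_eq_coord_mul hj, evalAt_apply, Gr.single_apply, if_neg (Ne.symm h0), map_zero,
          map_zero, zero_add]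
  have := h Finset.univ
  rwa [← Gr.eq_sum_single] at this

/-- A superderivation is determined by its values on the coordinates. -/
theorem der_eq_zero {i : ZMod 2} {Y : Module.End 𝕜 (Gr 𝕜 B r)} (hY : Y ∈ superDer 𝕜 (Gr 𝕜 B r) i) (h : ∀ l, Y (C.coord l) = 0)
    (f : Gr 𝕜 B r) : Y f = 0 := by
  let R : Subring (Gr 𝕜 B r) :=
    { carrier := {f | Y f = 0}
      mul_mem' := fun {f g} hf hg => by
        change Y (f * g) = 0
        rw [hY.2, show Y f = 0 from hf, show Y g = 0 from hg, zero_mul, mul_zero, add_zero]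
      one_mem' := der_one hY
      add_mem' := fun {f g} hf hg => by
        change Y (f + g) = 0
        rw [map_add, show Y f = 0 from hf, show Y g = 0 from hg, add_zero]
      zero_mem' := map_zero Y
      neg_mem' := fun {f} hf => by
        change Y (-f) = 0
        rw [map_neg, show Y f = 0 from hf, neg_zero] }
  have halg : ∀ c : 𝕜, Y (algebraMap 𝕜 _ c) = 0 := fun c => by
    rw [Algebra.algebraMap_eq_smul_one, map_smul, der_one hY, smul_zero]
  -- It is enough that all coefficients of `Y b` vanish at each point `p`. Expand `b` at `p` by
  -- Hadamard: in `Y ((x - x(p)) g)` the term with `Y x` is zero, and the other one vanishes at `p`.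
  have he : ∀ b : B, (Gr.single ∅ b : Gr 𝕜 B r) ∈ R := by
    intro b
    change Y _ = 0
    ext T
    refine C.eq_zero _ fun p => ?_
    obtain ⟨g, hg⟩ := C.single_hadamard (r := r) p b
    rw [hg, map_add, halg, zero_add, map_sum, Gr.sum_apply, map_sum]
    refine Finset.sum_eq_zero fun m _ => ?_
    have hpar : SuperAlgebra.parity (𝕜 := 𝕜) (C.coord (.inl m) - algebraMap 𝕜 _ (C.ev p (C.x m)) : Gr 𝕜 B r) = C.coord (.inl m) - algebraMap 𝕜 _ (C.ev p (C.x m)) := by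
      have : SuperAlgebra.parity (𝕜 := 𝕜) (C.coord (.inl m) : Gr 𝕜 B r) = (-1 : ℤ) ^ 0 • _ := C.coord_parity (.inl m)
      rw [map_sub, this, pow_zero, one_smul, AlgHom.commutes]
    rw [hY.2, map_sub, h, halg, sub_zero, zero_mul, zero_add, twist_of_even hpar, sub_mul, Gr.algebraMap_eq, Gr.sub_apply, coord,
      Gr.single_empty_mul, Gr.single_empty_mul, map_sub, map_mul, map_mul, AlgHom.commutes]
    simp
  have := R.sum_mem (t := Finset.univ) (f := fun S => Gr.single S (f S)) fun S _ =>
    Gr.single_mem_of_mem R (fun j => h (.inr j)) S (f S) fun k => he _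
  rwa [← Gr.eq_sum_single] at this

/-- The frame of coordinate vector fields with its coordinates. -/
def coordFrame : CoordFrame 𝕜 (Gr 𝕜 B r) n r where
  toFrame := C.frame
  x := C.coord
  x_parity := C.coord_parity
  D_x := C.frame_coord
  span i Y hY f := by
    have hp : ∀ x y : ZMod 2, x + y + y = x := by decide
    -- The difference of `Y` and the proposed combination is a derivation that vanishes on the
    -- coordinates.
    have hY' : Y - ∑ l, LinearMap.mulLeft 𝕜 (Y (C.coord l)) ∘ₗ C.frame.D l ∈ superDer 𝕜 (Gr 𝕜 B r) i :=
      Submodule.sub_mem _ hY (Submodule.sum_mem _ fun l _ =>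
        mulLeft_comp_mem ((C.coord_parity l).der hY) (C.frame.der l) (hp i (coordParity l)))
    have := C.der_eq_zero hY' (fun m => by
      rw [LinearMap.sub_apply, LinearMap.sum_apply, Finset.sum_eq_single m (fun l _ hl => by
        rw [LinearMap.comp_apply, C.frame_coord, if_neg (Ne.symm hl), map_zero]) (by simp), LinearMap.comp_apply, C.frame_coord, if_pos rfl,
        LinearMap.mulLeft_apply, mul_one, sub_self]) f
    rw [LinearMap.sub_apply, sub_eq_zero] at this
    rw [this]
    simp [LinearMap.sum_apply]

end EvenCoords
end

section
variable {𝕜 : Type*} [RCLike 𝕜] {n r : ℕ}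

/-- Smooth functions on an open subset of `ℝ^{2n}`. -/
def smoothCoords (V : Opens ((Fin n ⊕ Fin n) → ℝ)) : EvenCoords 𝕜 (smoothFun 𝕜 V) n where
  parity_eq _ := rfl
  d i := { toFun := smoothFun.pderiv i, map_add' := smoothFun.pderiv_add i, map_smul' := smoothFun.pderiv_smul i }
  d_mul := smoothFun.pderiv_mul
  d_comm := smoothFun.pderiv_comm
  x := coordFun 𝕜 V
  d_x := smoothFun.pderiv_coordFun
  pt := V
  ev p := (Pi.evalAlgHom 𝕜 (fun _ : V => 𝕜) p).comp (smoothFun 𝕜 V).val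
  eq_zero f h := smoothFun.ext h
  hadamard := smoothFun.hadamard

end

end SuperGeom
end

/-! ### Expansion at a point and powers of its maximal ideal -/

noncomputable section
namespace SuperGeom
open FormalFun

section
variable {𝕜 A A' : Type*} [CommRing 𝕜] [Ring A] [Algebra 𝕜 A] [SuperAlgebra 𝕜 A] [Ring A'] [Algebra 𝕜 A'] [SuperAlgebra 𝕜 A'] {n a b : ℕ}

theorem FormalFun.const_mul_mono_one {r : ℕ} (S : Finset (Fin r)) (α : (Fin n ⊕ Fin n) →₀ ℕ) (c : A) :
    (const c : FormalFun 𝕜 A n r) * mono S α 1 = mono S α c := by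
  ext S' α'
  rw [coeff_const_mul, coeff_mono, coeff_mono]
  split_ifs <;> simp

/-- Although `f` itself need not lie in the filtration, its monomials of degree below `k` have
coefficients killed by `ρ`, and `A`-linearity of `φ` preserves this; the remaining terms stay in the
filtration. With `ρ` the evaluation at a point, `φ` thus induces a filtered map on the formal fibre.
-/
theorem formalAut.mapCoeff_mem_filtration (φ : formalAut 𝕜 A n a b) (ρ : A →ₐ[𝕜] A') (hρ : IsSuper ρ) {k : ℕ} {f : FormalFun 𝕜 A n (a + b)}
    (hf : mapCoeff ρ hρ f ∈ filtration k) : mapCoeff ρ hρ (φ.1 f) ∈ filtration k := by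
  have h1 := FormalFun.mapCoeff_mem_filtration ρ hρ ((φ.2.2.2.2 k _).2 (sub_sum_mono_mem k f))
  have h2 : ∀ p ∈ monoIdx n (a + b) k, mapCoeff ρ hρ (φ.1 (mono p.1 p.2 (coeff p.1 p.2 f))) ∈ filtration k := by
    intro p _
    by_cases hp : deg p.1 p.2 < k
    · rw [← const_mul_mono_one, formalAut.const_mul, map_mul, mapCoeff_const]
      have : ρ (coeff p.1 p.2 f) = 0 := hf p.1 p.2 hp
      rw [this, const_zero, zero_mul]
      exact zero_mem_filtration
    · refine FormalFun.mapCoeff_mem_filtration ρ hρ ((φ.2.2.2.2 k _).2 fun S α hS => ?_)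
      rw [coeff_mono, if_neg]
      rintro ⟨rfl, rfl⟩
      exact hp hS
  rw [map_sub, map_sub, map_sum, map_sum] at h1
  have := add_mem_filtration h1 (sum_mem_filtration _ _ h2)
  rwa [sub_add_cancel] at this

end

section
variable {𝕜 : Type*} [Field 𝕜] [CharZero 𝕜] {A : Type*} [Ring A] [Algebra 𝕜 A] [SuperAlgebra 𝕜 A]

theorem ev_odd {ev : A →ₐ[𝕜] 𝕜} (hev : IsSuper ev) {f : A} (hf : HasParity 𝕜 1 f) : ev f = 0 := by
  have h := hev f
  rw [show SuperAlgebra.parity (𝕜 := 𝕜) f = (-1 : ℤ) ^ 1 • f from hf, pow_one, neg_one_smul, map_neg] at h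
  exact self_eq_neg.1 h.symm

namespace CoordFrame
variable {n r : ℕ} (F : CoordFrame 𝕜 A n r)

/-- A point of a space with coordinates, at which Hadamard's lemma holds. -/
structure IsPoint (ev : A →ₐ[𝕜] 𝕜) : Prop where
  isSuper : IsSuper ev
  hadamard : ∀ f, ∃ g : (Fin n ⊕ Fin n) ⊕ Fin r → A, f = algebraMap 𝕜 A (ev f) + ∑ l, (F.x l - algebraMap 𝕜 A (ev (F.x l))) * g l

variable {F} {ev : A →ₐ[𝕜] 𝕜}

namespace IsPoint

theorem shift_parity (h : F.IsPoint ev) (l) : HasParity 𝕜 (coordParity l) (F.x l - algebraMap 𝕜 A (ev (F.x l))) := by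
  have hx := F.x_parity l
  rcases l with i | j
  · have hx' : SuperAlgebra.parity (𝕜 := 𝕜) (F.x (.inl i)) = (-1 : ℤ) ^ 0 • _ := hx
    change _ = (-1 : ℤ) ^ 0 • _
    rw [pow_zero, one_smul] at *
    rw [map_sub, hx', AlgHom.commutes]
  · rw [ev_odd h.isSuper hx, map_zero, sub_zero]
    exact hx

theorem mul_mem_ker_left {f : A} (hf : f ∈ LinearMap.ker ev.toLinearMap) (g : A) : f * g ∈ LinearMap.ker ev.toLinearMap := by
  rw [LinearMap.mem_ker, AlgHom.toLinearMap_apply] at *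
  rw [map_mul, hf, zero_mul]

theorem shift_mem (l) : F.x l - algebraMap 𝕜 A (ev (F.x l)) ∈ LinearMap.ker ev.toLinearMap := by
  rw [LinearMap.mem_ker, AlgHom.toLinearMap_apply, map_sub, AlgHom.commutes]
  exact sub_self _

variable (F ev) in
/-- The Euler vector field at a point. -/
def euler : Module.End 𝕜 A := ∑ l, LinearMap.mulLeft 𝕜 (F.x l - algebraMap 𝕜 A (ev (F.x l))) ∘ₗ F.D l

theorem euler_apply (f : A) : euler F ev f = ∑ l, (F.x l - algebraMap 𝕜 A (ev (F.x l))) * F.D l f := by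
  simp [euler, LinearMap.sum_apply]

theorem euler_mul (h : F.IsPoint ev) (f g : A) : euler F ev (f * g) = euler F ev f * g + f * euler F ev g := by
  have hp : ∀ x : ZMod 2, x + x = 0 := by decide
  have : euler F ev ∈ superDer 𝕜 A 0 := Submodule.sum_mem _ fun l _ => mulLeft_comp_mem (h.shift_parity l) (F.der l) (hp _)
  rw [this.2, ZMod.val_zero, twist_zero]

theorem euler_mem (f : A) : euler F ev f ∈ LinearMap.ker ev.toLinearMap := by
  rw [euler_apply]
  exact Submodule.sum_mem _ fun l _ => mul_mem_ker_left (shift_mem l) _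

theorem euler_shift (l) : euler F ev (F.x l - algebraMap 𝕜 A (ev (F.x l))) = F.x l - algebraMap 𝕜 A (ev (F.x l)) := by
  rw [euler_apply, Finset.sum_eq_single l, map_sub, F.D_x, if_pos rfl, F.D_algebraMap, sub_zero, mul_one]
  · intro m _ hm
    rw [map_sub, F.D_x, if_neg (Ne.symm hm), F.D_algebraMap, sub_zero, mul_zero]
  · simp

/-- For `k = 0`, Hadamard writes `f` as a sum of terms `(x - x(p)) g`, and the Euler field fixes the
first factor and sends the second into the ideal. Higher powers follow by the Leibniz rule on
products. -/
theorem euler_sub_mem (h : F.IsPoint ev) (k : ℕ) : ∀ f ∈ LinearMap.ker ev.toLinearMap ^ (k + 1),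
    euler F ev f - ((k + 1 : ℕ) : 𝕜) • f ∈ LinearMap.ker ev.toLinearMap ^ (k + 2) := by
  have h1 : ∀ f ∈ LinearMap.ker ev.toLinearMap, euler F ev f - f ∈ LinearMap.ker ev.toLinearMap ^ 2 := by
    intro f hf
    obtain ⟨g, hg⟩ := h.hadamard f
    rw [LinearMap.mem_ker, AlgHom.toLinearMap_apply] at hf
    rw [hf, map_zero, zero_add] at hg
    rw [hg, map_sum, ← Finset.sum_sub_distrib]
    refine Submodule.sum_mem _ fun l _ => ?_
    rw [h.euler_mul, euler_shift, add_sub_cancel_left, sq]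
    exact Submodule.mul_mem_mul (shift_mem l) (euler_mem _)
  induction k with
  | zero =>
    intro f hf
    rw [zero_add, pow_one] at hf
    simpa using h1 f hf
  | succ k ih =>
    intro f hf
    rw [pow_succ] at hf
    induction hf using Submodule.mul_induction_on' with
    | mem_mul_mem x hx y hy =>
      have e : euler F ev (x * y) - ((k + 1 + 1 : ℕ) : 𝕜) • (x * y) =
          (euler F ev x - ((k + 1 : ℕ) : 𝕜) • x) * y + x * (euler F ev y - y) := by
        rw [h.euler_mul, sub_mul, mul_sub, Nat.cast_succ (k + 1), add_smul, one_smul, smul_mul_assoc]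
        abel
      rw [e]
      refine Submodule.add_mem _ ?_ ?_
      · rw [pow_succ]
        exact Submodule.mul_mem_mul (ih x hx) hy
      · rw [show k + 1 + 2 = (k + 1) + 2 from rfl, pow_add]
        exact Submodule.mul_mem_mul hx (h1 y hy)
    | add x _ y _ hx hy =>
      rw [map_add, smul_add, add_sub_add_comm]
      exact Submodule.add_mem _ hx hy

variable (F ev) in
/-- The Taylor expansion at a point. -/
def expand (h : F.IsPoint ev) : A →ₐ[𝕜] FormalFun 𝕜 𝕜 n r := (mapCoeff ev h.isSuper).comp F.taylor

theorem expand_apply (h : F.IsPoint ev) (f : A) : expand F ev h f = mapCoeff ev h.isSuper (F.taylor f) := rfl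

theorem expand_shift (h : F.IsPoint ev) (l) : expand F ev h (F.x l - algebraMap 𝕜 A (ev (F.x l))) = gen l := by
  rw [map_sub, AlgHom.commutes, expand_apply, taylor_x, map_add, mapCoeff_const, mapCoeff_gen, algebraMap_eq_const]
  exact add_sub_cancel_left _ _

/-- By induction all first derivatives of `f` lie in `m^(k+1)`, so the Euler field sends `f` into
`m^(k+2)`. It also sends `f` to `(k + 1) f` modulo `m^(k+2)`, because `f` is already known to lie in
`m^(k+1)`. Dividing by `k + 1` gives the claim. -/
theorem mem_pow_of_expand (h : F.IsPoint ev) (k : ℕ) : ∀ f, expand F ev h f ∈ filtration (k + 1) → f ∈ LinearMap.ker ev.toLinearMap ^ (k + 1) := by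
  induction k with
  | zero =>
    intro f hf
    rw [zero_add, pow_one, LinearMap.mem_ker, AlgHom.toLinearMap_apply]
    have := hf ∅ 0 (by simp)
    rwa [expand_apply, coeff_mapCoeff, F.taylor_coeff_zero] at this
  | succ k ih =>
    intro f hf
    have h1 : euler F ev f ∈ LinearMap.ker ev.toLinearMap ^ (k + 2) := by
      rw [euler_apply, pow_succ']
      refine Submodule.sum_mem _ fun l _ => Submodule.mul_mem_mul (shift_mem l) (ih _ ?_)
      rw [expand_apply, ← F.frame_taylor, ← frame_mapCoeff]
      exact frame_mem_filtration hf l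
    have h2 := Submodule.sub_mem _ h1 (h.euler_sub_mem k f (ih f (filtration_mono (Nat.le_succ _) hf)))
    rw [sub_sub_cancel] at h2
    exact (Submodule.smul_mem_iff _ (Nat.cast_ne_zero.2 (Nat.succ_ne_zero k))).1 h2

/-- The expansion of a shifted coordinate is a variable, so the image contains all polynomials,
which approximate `g` to any order. -/
theorem exists_expand (h : F.IsPoint ev) (N : ℕ) (g : FormalFun 𝕜 𝕜 n r) : ∃ f, expand F ev h f - g ∈ filtration N := by
  have h1 : ∑ p ∈ monoIdx n r N, mono p.1 p.2 (coeff p.1 p.2 g) ∈ (expand F ev h).toRingHom.range := by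
    refine Subring.sum_mem _ fun p _ => mono_mem (expand F ev h).toRingHom.range (fun c => ⟨algebraMap 𝕜 A c, ?_⟩) (fun l => ⟨_, h.expand_shift l⟩) _ _ _
    change expand F ev h _ = _
    rw [AlgHom.commutes, algebraMap_eq_const]
    rfl
  obtain ⟨f, hf⟩ := h1
  refine ⟨f, ?_⟩
  change expand F ev h f = _ at hf
  rw [hf, ← neg_sub]
  exact neg_mem_filtration (sub_sum_mono_mem N g)

end IsPoint

end CoordFrame

namespace CoordFrame.IsPoint
variable {n a b : ℕ} {F : CoordFrame 𝕜 A n (a + b)} {ev : A →ₐ[𝕜] 𝕜} (φ : formalAut 𝕜 A n a b)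

/-- The inverse of `φ` also respects the reduction at the point, which reduces the claim to the
unmodified expansion. -/
theorem formal_injective (h : F.IsPoint ev) (k : ℕ) (f : A)
    (hf : ∀ S α, α.degree + S.card < k + 1 → coeff S α (φ.1 (F.taylor f)) ∈ LinearMap.ker ev.toLinearMap) :
    f ∈ LinearMap.ker ev.toLinearMap ^ (k + 1) := by
  refine h.mem_pow_of_expand k f ?_
  have h1 : mapCoeff ev h.isSuper (φ.1 (F.taylor f)) ∈ filtration (k + 1) := fun S α hS => hf S α hS
  have h2 := formalAut.mapCoeff_mem_filtration φ⁻¹ ev h.isSuper h1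
  rwa [show (φ⁻¹).1 (φ.1 (F.taylor f)) = F.taylor f from φ.1.symm_apply_apply _] at h2

theorem formal_surjective (h : F.IsPoint ev) (k : ℕ) (g : FormalFun 𝕜 𝕜 n (a + b)) : ∃ f : A, ∀ S α, α.degree + S.card < k + 1 →
    coeff S α (φ.1 (F.taylor f)) - algebraMap 𝕜 A (coeff S α g) ∈ LinearMap.ker ev.toLinearMap := by
  -- `G` is the lift of `g` with constant coefficients; `f` is chosen so that its expansion at the
  -- point approximates the reduction of `φ⁻¹ G`, and `φ` is applied afterwards.
  let G : FormalFun 𝕜 A n (a + b) := FormalFun.mk fun S α => algebraMap 𝕜 A (coeff S α g)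
  obtain ⟨f, hf⟩ := h.exists_expand (k + 1) (mapCoeff ev h.isSuper ((φ⁻¹).1 G))
  refine ⟨f, fun S α hS => ?_⟩
  rw [expand_apply, ← map_sub] at hf
  have h1 := formalAut.mapCoeff_mem_filtration φ ev h.isSuper hf S α hS
  rw [map_sub, show φ.1 ((φ⁻¹).1 G) = G from φ.1.apply_symm_apply _] at h1
  exact h1

end CoordFrame.IsPoint
end

end SuperGeom
end

/-! ### Transport of frames and points to charts -/

noncomputable section
namespace SuperGeom
open FormalFun

section
variable {𝕜 : Type*} [Field 𝕜] [CharZero 𝕜] {A A' : Type*} [Ring A] [Algebra 𝕜 A] [SuperAlgebra 𝕜 A] [Ring A'] [Algebra 𝕜 A']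
  [SuperAlgebra 𝕜 A'] {n r : ℕ}

theorem isSuper_symm {e : A ≃ₐ[𝕜] A'} (he : IsSuper e.toAlgHom) : IsSuper e.symm.toAlgHom := fun f => by
  change e.symm _ = SuperAlgebra.parity (𝕜 := 𝕜) (e.symm f)
  apply e.injective
  rw [AlgEquiv.apply_symm_apply]
  exact (congrArg _ (e.apply_symm_apply f)).symm.trans (he _).symm

theorem HasParity.map {ρ : A →ₐ[𝕜] A'} (hρ : IsSuper ρ) {i : ZMod 2} {f : A} (hf : HasParity 𝕜 i f) : HasParity 𝕜 i (ρ f) := by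
  unfold HasParity at *
  rw [← hρ, hf, map_zsmul]

/-- Transport of vector fields along an isomorphism. -/
def endComap (e : A ≃ₐ[𝕜] A') (Y : Module.End 𝕜 A') : Module.End 𝕜 A := e.symm.toLinearMap ∘ₗ Y ∘ₗ e.toLinearMap

theorem endComap_apply (e : A ≃ₐ[𝕜] A') (Y : Module.End 𝕜 A') (f : A) : endComap e Y f = e.symm (Y (e f)) := rfl

theorem endComap_mem {e : A ≃ₐ[𝕜] A'} (he : IsSuper e.toAlgHom) {i : ZMod 2} {Y : Module.End 𝕜 A'} (hY : Y ∈ superDer 𝕜 A' i) :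
    endComap e Y ∈ superDer 𝕜 A i := by
  have he' : ∀ f, e (SuperAlgebra.parity (𝕜 := 𝕜) f) = SuperAlgebra.parity (𝕜 := 𝕜) (e f) := he
  have hs : ∀ f, e.symm (SuperAlgebra.parity (𝕜 := 𝕜) f) = SuperAlgebra.parity (𝕜 := 𝕜) (e.symm f) := isSuper_symm he
  have ht : ∀ k f, e (twist 𝕜 k f) = twist 𝕜 k (e f) := fun k f => IsSuper.twist he k f
  refine ⟨fun f => ?_, fun f g => ?_⟩
  · rw [endComap_apply, endComap_apply, ← hs, hY.1, map_zsmul, he']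
  · rw [endComap_apply, endComap_apply, endComap_apply, map_mul, hY.2, map_add, map_mul, map_mul, e.symm_apply_apply, ← ht,
      e.symm_apply_apply]

namespace CoordFrame

/-- Transport of a frame of coordinates along an isomorphism. -/
def comap (e : A ≃ₐ[𝕜] A') (he : IsSuper e.toAlgHom) (F : CoordFrame 𝕜 A' n r) : CoordFrame 𝕜 A n r where
  D k := endComap e (F.D k)
  der k := endComap_mem he (F.der k)
  comm k l f := by
    rw [endComap_apply, endComap_apply, endComap_apply, endComap_apply, e.apply_symm_apply, e.apply_symm_apply, F.comm, map_zsmul]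
  x k := e.symm (F.x k)
  x_parity k := (F.x_parity k).map (isSuper_symm he)
  D_x k l := by
    rw [endComap_apply, e.apply_symm_apply, F.D_x]
    split_ifs <;> simp
  span i Y hY f := by
    have hY' := endComap_mem (isSuper_symm he) hY
    have h : Y f = e.symm (endComap e.symm Y (e f)) := by
      rw [endComap_apply, e.symm_apply_apply, AlgEquiv.symm_symm, e.symm_apply_apply]
    rw [h, F.span i _ hY', map_sum]
    refine Finset.sum_congr rfl fun l _ => ?_
    rw [map_mul, endComap_apply, AlgEquiv.symm_symm, e.symm_apply_apply, endComap_apply]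

theorem IsPoint.comap {F : CoordFrame 𝕜 A' n r} {ev : A' →ₐ[𝕜] 𝕜} (h : F.IsPoint ev) (e : A ≃ₐ[𝕜] A') (he : IsSuper e.toAlgHom) :
    (F.comap e he).IsPoint (ev.comp e.toAlgHom) where
  isSuper f := by
    change ev (e.toAlgHom _) = SuperAlgebra.parity (𝕜 := 𝕜) (ev (e.toAlgHom f))
    rw [he, h.isSuper]
  hadamard f := by
    obtain ⟨g, hg⟩ := h.hadamard (e f)
    refine ⟨fun l => e.symm (g l), e.injective ?_⟩
    have hx : ∀ l, e ((F.comap e he).x l) = F.x l := fun l => e.apply_symm_apply _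
    have hev : ∀ f, ev.comp e.toAlgHom f = ev (e f) := fun f => rfl
    rw [map_add, map_sum, AlgEquiv.commutes, hev]
    refine hg.trans (congrArg _ (Finset.sum_congr rfl fun l _ => ?_))
    rw [map_mul, map_sub, AlgEquiv.commutes, e.apply_symm_apply, hev, hx]

end CoordFrame

theorem EvenCoords.isPoint {B : Type*} [Ring B] [Algebra 𝕜 B] [SuperAlgebra 𝕜 B] (C : EvenCoords 𝕜 B n) (p : C.pt) :
    (C.coordFrame (r := r)).IsPoint (C.evalAt p) where
  isSuper := C.isSuper_evalAt p
  hadamard f := C.gr_hadamard f p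

/-- Subtracting the constant term puts `f` into step one of the filtration, which is preserved, and
constants are fixed. -/
theorem formalAut.coeff_zero {a b : ℕ} (φ : formalAut 𝕜 A n a b) (f : FormalFun 𝕜 A n (a + b)) : coeff ∅ 0 (φ.1 f) = coeff ∅ 0 f := by
  have h1 : f - const (coeff ∅ 0 f) ∈ filtration 1 := by
    intro S α h
    have h' : α.degree = 0 ∧ S.card = 0 := by omega
    rw [Finset.card_eq_zero, Finsupp.degree_eq_zero_iff] at h'
    rw [h'.1, h'.2, coeff_sub, coeff_const, if_pos ⟨rfl, rfl⟩, sub_self]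
  have h2 := (φ.2.2.2.2 1 _).2 h1 ∅ 0 (by simp)
  rwa [map_sub, φ.2.1, coeff_sub, coeff_const, if_pos ⟨rfl, rfl⟩, sub_eq_zero] at h2

end

/-! ### Charts -/

section
variable {𝕜 : Type*} [RCLike 𝕜] {X : Type*} [TopologicalSpace X] {n r : ℕ}

namespace SuperSpace
variable {M : SuperSpace 𝕜 X}

theorem isSuper_res {U V : Opens X} (h : V ≤ U) : IsSuper (M.res h) := M.res_parity h

namespace Chart
variable (c : M.Chart (Fin n ⊕ Fin n) r) {V : Opens X} (hV : (V : Set X) ⊆ c.body.source)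

theorem isSuper_iso : IsSuper (c.iso V hV).toAlgHom := c.iso_parity V hV

/-- The coordinates of a chart and the coordinate vector fields. -/
def frame : CoordFrame 𝕜 (M.O V) n r := (smoothCoords _).coordFrame.comap (c.iso V hV) (c.isSuper_iso hV)

theorem frame_x (k) : (c.frame hV).x k = c.coord V hV k := by
  rcases k with i | j <;> rfl

theorem frame_D (k) (f : M.O V) : c.iso V hV ((c.frame hV).D k f) = (smoothCoords _).frame.D k (c.iso V hV f) :=
  (c.iso V hV).apply_symm_apply _

theorem frame_res {V' : Opens X} (h : V' ≤ V) (k) (f : M.O V) :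
    M.res h ((c.frame hV).D k f) = (c.frame (Set.Subset.trans h hV)).D k (M.res h f) := by
  apply (c.iso V' (Set.Subset.trans h hV)).injective
  refine Gr.ext fun S => smoothFun.ext ?_
  rintro ⟨_, x, hx, rfl⟩
  have e := c.iso_res V hV V' h
  rw [e _ _ x hx, frame_D, frame_D]
  rcases k with i | j
  · rw [EvenCoords.frame_inl, EvenCoords.frame_inl, EvenCoords.pderiv_apply, EvenCoords.pderiv_apply]
    refine (smoothFun.pderiv_congr i (V := ⟨c.body '' V, _⟩) (V' := ⟨c.body '' V', _⟩) (Set.image_mono h) _ _ ?_ _ _).symm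
    rintro _ ⟨z, hz, rfl⟩
    exact e _ _ z hz
  · rw [EvenCoords.frame_inr, EvenCoords.frame_inr, Gr.deriv_apply, Gr.deriv_apply]
    split_ifs
    · rfl
    · change koszul {j} S • (c.iso V hV f (insert j S)).1 _ = koszul {j} S • (c.iso V' _ (M.res h f) (insert j S)).1 _
      rw [e _ _ x hx]

/-- The value at a point. -/
def evalAt {x : X} (hx : x ∈ V) : M.O V →ₐ[𝕜] 𝕜 :=
  ((smoothCoords _).evalAt (⟨c.body x, Set.mem_image_of_mem c.body hx⟩ : (⟨c.body '' V, c.body.isOpen_image_of_subset_source V.2 hV⟩ : Opens _))).comp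
    (c.iso V hV).toAlgHom

theorem evalAt_apply {x : X} (hx : x ∈ V) (f : M.O V) :
    c.evalAt hV hx f = (c.iso V hV f ∅).1 ⟨c.body x, Set.mem_image_of_mem c.body hx⟩ := rfl

theorem isPoint {x : X} (hx : x ∈ V) : (c.frame hV).IsPoint (c.evalAt hV hx) :=
  (EvenCoords.isPoint _ _).comap _ _

theorem evalAt_res {V' : Opens X} (h : V' ≤ V) {x : X} (hx : x ∈ V') (f : M.O V) :
    c.evalAt (Set.Subset.trans h hV) hx (M.res h f) = c.evalAt hV (h hx) f := c.iso_res V hV V' h f ∅ x hx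

theorem isUnit_of_evalAt {f : M.O V} (h : ∀ x (hx : x ∈ V), c.evalAt hV hx f ≠ 0) : IsUnit f := by
  rw [← MulEquiv.isUnit_map (c.iso V hV)]
  refine Gr.isUnit_of_body (smoothFun.isUnit_of_ne_zero ?_) rfl
  rintro ⟨_, x, hx, rfl⟩
  exact h x hx

theorem isOpen_evalAt_ne_zero (f : M.O V) : IsOpen {x | ∃ hx : x ∈ V, c.evalAt hV hx f ≠ 0} := by
  obtain ⟨F, hF, hf⟩ := (c.iso V hV f ∅).2
  have h1 := hF.continuousOn.isOpen_inter_preimage (c.body.isOpen_image_of_subset_source V.2 hV) isOpen_compl_singleton (t := {0}ᶜ)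
  have h2 := V.2.inter (c.body.isOpen_inter_preimage h1)
  convert h2 using 1
  ext x
  constructor
  · rintro ⟨hx, hne⟩
    refine ⟨hx, hV hx, Set.mem_image_of_mem _ hx, ?_⟩
    rw [evalAt_apply, hf] at hne
    exact hne
  · rintro ⟨hx, _, _, hne⟩
    refine ⟨hx, ?_⟩
    rw [evalAt_apply, hf]
    exact hne

/-- A function that is nonzero at `x` is invertible on the open set where it is nonzero, since
nilpotents do not affect invertibility; conversely, evaluation maps units to units. The set in the
definition is therefore already a kernel, and taking its span adds nothing. -/
theorem vanishing_eq {x : X} (hx : x ∈ V) : M.vanishing V x = LinearMap.ker (c.evalAt hV hx).toLinearMap := by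
  have : {f : M.O V | ∀ (W : Opens X) (h : W ≤ V), x ∈ W → ¬ IsUnit (M.res h f)} = LinearMap.ker (c.evalAt hV hx).toLinearMap := by
    ext f
    rw [SetLike.mem_coe, LinearMap.mem_ker, AlgHom.toLinearMap_apply, Set.mem_ofPred_eq]
    constructor
    · intro h
      by_contra hne
      have hle : (⟨_, c.isOpen_evalAt_ne_zero hV f⟩ : Opens X) ≤ V := fun y hy => hy.1
      refine h ⟨_, c.isOpen_evalAt_ne_zero hV f⟩ hle ⟨hx, hne⟩ (c.isUnit_of_evalAt (Set.Subset.trans hle hV) fun y hy => ?_)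
      rw [c.evalAt_res hV hle]
      exact hy.2
    · intro h W hW hxW hu
      have := hu.map (c.evalAt (Set.Subset.trans hW hV) hxW)
      rw [c.evalAt_res hV hW, h] at this
      exact not_isUnit_zero this
  rw [vanishing, this, Submodule.span_eq]

end Chart
end SuperSpace
end

end SuperGeom
end

noncomputable section
namespace SuperGeom
open FormalFun

/-! ### Poisson brackets in Darboux charts -/

section
variable {𝕜 : Type*} [RCLike 𝕜] {X : Type*} [TopologicalSpace X] {n a b : ℕ}

namespace SuperSpace
variable {M : SuperSpace 𝕜 X} (w₂ : M.EvenTwoForm)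

theorem EvenTwoForm.ev_congr {U : Opens X} {i i' j : ZMod 2} (h : i = i') (Y : superDer 𝕜 (M.O U) i) (Y' : superDer 𝕜 (M.O U) i')
    (hY : Y.1 = Y'.1) (Z : superDer 𝕜 (M.O U) j) : w₂.ev U i j Y Z = w₂.ev U i' j Y' Z := by
  subst h
  rw [Subtype.ext hY]

/-- The pairing of a sum of multiples of homogeneous vector fields. -/
theorem EvenTwoForm.ev_sum {U : Opens X} {j k : ZMod 2} {β : Type*} [Fintype β] {d : β → ZMod 2} (D : ∀ l, superDer 𝕜 (M.O U) (d l))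
    {f : β → M.O U} (hf : ∀ l, HasParity 𝕜 (j + d l) (f l)) (Z : superDer 𝕜 (M.O U) j) (hZ : ∀ g, Z.1 g = ∑ l, f l * (D l).1 g)
    (Y : superDer 𝕜 (M.O U) k) : w₂.ev U j k Z Y = ∑ l, f l * w₂.ev U (d l) k (D l) Y := by
  have hp : ∀ x y : ZMod 2, x + y + y = x := by decide
  obtain ⟨T, hT⟩ : ∃ T : β → superDer 𝕜 (M.O U) j, ∀ l, (T l).1 = LinearMap.mulLeft 𝕜 (f l) ∘ₗ (D l).1 :=
    ⟨fun l => ⟨_, mulLeft_comp_mem (hf l) (D l).2 (hp j (d l))⟩, fun l => rfl⟩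
  have h1 : Z = ∑ l, T l := by
    refine Subtype.ext (LinearMap.ext fun g => ?_)
    rw [hZ, Submodule.coe_sum, LinearMap.sum_apply]
    refine Finset.sum_congr rfl fun l _ => ?_
    rw [hT]
    rfl
  have h2 : ∀ l, w₂.ev U j k (T l) Y = f l * w₂.ev U (d l) k (D l) Y := fun l => by
    rw [← w₂.smul_ev U (j + d l) (d l) k (f l) (hf l) (D l) Y]
    exact w₂.ev_congr (hp _ _).symm _ _ (hT l) Y
  rw [h1, map_sum, LinearMap.sum_apply]
  exact Finset.sum_congr rfl fun l _ => h2 l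

/-- Expand `Z` in the coordinate fields and pair with each of them. The standard matrix has one
entry `±1` in every row, so the derivatives of `f` determine the components `Z x_k`, and
substituting them yields the bracket formula. -/
theorem Chart.hamiltonian_apply {c : M.Chart (Fin n ⊕ Fin n) (a + b)} (hc : c.IsDarboux w₂) {V : Opens X} (hV : (V : Set X) ⊆ c.body.source)
    {j : ZMod 2} {f : M.O V} {Z : superDer 𝕜 (M.O V) j} (hZ : w₂.IsHamiltonian f Z) (g : M.O V) : Z.1 g = (c.frame hV).ham f g := by
  set F := c.frame hV with hF
  let D : ∀ l, superDer 𝕜 (M.O V) (coordParity l) := fun l => ⟨F.D l, F.der l⟩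
  have hD : ∀ l m, (D l).1 (c.coord V hV m) = if m = l then 1 else 0 := fun l m => by
    rw [← c.frame_x]
    exact F.D_x l m
  have hZg : ∀ g, Z.1 g = ∑ l, Z.1 (F.x l) * F.D l g := F.span j Z.1 Z.2
  have hpar : ∀ l, HasParity 𝕜 (j + coordParity l) (Z.1 (F.x l)) := fun l => (F.x_parity l).der Z.2
  have hDf : ∀ l, F.D l f = -((-1 : ℤ) ^ ((coordParity l).val * j.val) • ∑ k, Z.1 (F.x k) * (standardForm n a b k l : M.O V)) := by
    intro l
    have h1 := hZ _ (D l)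
    rw [w₂.skew, w₂.ev_sum D hpar Z hZg] at h1
    rw [show F.D l f = (D l).1 f from rfl, ← h1]
    simp only [hc V hV _ _ _ _ (hD _) (hD _)]
  -- `f` is not assumed homogeneous. Its derivatives are, because they are values of the even form
  -- on homogeneous fields.
  have hodd : ∀ m, F.D (.inr m) (SuperAlgebra.parity (𝕜 := 𝕜) f) = (-1 : ℤ) ^ j.val • F.D (.inr m) f := by
    intro m
    have h1 := w₂.parity_ev V _ _ (D (.inr m)) Z
    rw [hZ _ (D (.inr m))] at h1
    have h2 : SuperAlgebra.parity (𝕜 := 𝕜) (F.D (.inr m) f) = (-1 : ℤ) ^ (1 + j).val • F.D (.inr m) f := h1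
    have h3 : SuperAlgebra.parity (𝕜 := 𝕜) (F.D (.inr m) f) = (-1 : ℤ) ^ 1 • F.D (.inr m) (SuperAlgebra.parity (𝕜 := 𝕜) f) := F.D_parity _ _
    rw [h2, neg_one_pow_val_add, pow_one, neg_one_smul, show (1 : ZMod 2).val = 1 from rfl, pow_one, neg_mul, one_mul, neg_smul] at h3
    exact (neg_injective h3).symm
  have hp : ∀ i, F.D (.inl (.inl i)) f = Z.1 (F.x (.inl (.inr i))) := by
    intro i
    rw [hDf, Fintype.sum_sum_type, Fintype.sum_sum_type]
    simp [standardForm, coordParity]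
  have hq : ∀ i, F.D (.inl (.inr i)) f = -Z.1 (F.x (.inl (.inl i))) := by
    intro i
    rw [hDf, Fintype.sum_sum_type, Fintype.sum_sum_type]
    simp [standardForm, coordParity]
  have ho : ∀ m, quadSign a b m • F.D (.inr m) (SuperAlgebra.parity (𝕜 := 𝕜) f) = -Z.1 (F.x (.inr m)) := by
    intro m
    have hs : quadSign a b m * quadSign a b m = 1 := by
      unfold quadSign
      split_ifs <;> norm_num
    have hj : (-1 : ℤ) ^ j.val * (-1) ^ j.val = 1 := by rw [← mul_pow]; norm_num
    have h1 : F.D (.inr m) f = -((-1 : ℤ) ^ j.val • (quadSign a b m • Z.1 (F.x (.inr m)))) := by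
      rw [hDf, Fintype.sum_sum_type, Fintype.sum_sum_type]
      simp [standardForm, coordParity, ZMod.val_one, (Int.cast_commute (quadSign a b m) (Z.1 (F.x (.inr m)))).eq]
    rw [hodd, h1, smul_neg, smul_neg, smul_smul ((-1 : ℤ) ^ j.val), hj, one_smul, smul_smul, hs, one_smul]
  rw [Frame.ham_apply, hZg, Fintype.sum_sum_type, Fintype.sum_sum_type]
  simp only [hp, hq, ← smul_mul_assoc, ho, neg_mul, Finset.sum_neg_distrib, sub_neg_eq_add, Finset.sum_add_distrib]
  abel

end SuperSpace

/-! ### Formal coordinates from a Darboux chart and a section of the automorphism group -/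

namespace SymplecticSupermanifold
variable (M : SymplecticSupermanifold 𝕜 n a b X)

/-- Nondegeneracy is applied to the 1-form `Y ↦ Y f`. -/
theorem exists_hamiltonian {V : Opens X} {j : ZMod 2} {f : M.O V} (hf : HasParity 𝕜 j f) :
    ∃ Z : superDer 𝕜 (M.O V) j, M.form.IsHamiltonian f Z := by
  obtain ⟨Z, hZ, -⟩ := M.nondegenerate V j
    (fun i => { toFun := fun Y => Y.1 f, map_add' := fun _ _ => rfl, map_smul' := fun _ _ => rfl })
    (fun i Y => hf.der Y.2) (fun k i g hg Y => rfl)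
  exact ⟨Z, hZ⟩

variable {M}

/-- For homogeneous `f` both sides equal `Z g`, where `Z` is a Hamiltonian vector field of `f`, a
notion that refers to no chart. The general case splits `f` into even and odd parts. -/
theorem ham_eq {c c' : M.Chart (Fin n ⊕ Fin n) (a + b)} (hc : c.IsDarboux M.form) (hc' : c'.IsDarboux M.form)
    {V : Opens X} (hV : (V : Set X) ⊆ c.body.source) (hV' : (V : Set X) ⊆ c'.body.source) (f g : M.O V) :
    (c.frame hV).ham f g = (c'.frame hV').ham f g := by
  have h : ∀ {j : ZMod 2} {f : M.O V}, HasParity 𝕜 j f → (c.frame hV).ham f g = (c'.frame hV').ham f g := fun hf => by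
    obtain ⟨Z, hZ⟩ := M.exists_hamiltonian hf
    rw [← SuperSpace.Chart.hamiltonian_apply _ hc hV hZ, ← SuperSpace.Chart.hamiltonian_apply _ hc' hV' hZ]
  obtain ⟨f0, f1, hf0, hf1, rfl⟩ := exists_even_add_odd (𝕜 := 𝕜) f
  rw [Frame.ham_add, Frame.ham_add, h hf0, h hf1]

/-- Restriction of coefficients. -/
def resCoeff (M : SymplecticSupermanifold 𝕜 n a b X) {V V' : Opens X} (h : V' ≤ V) :
    FormalFun 𝕜 (M.O V) n (a + b) →ₐ[𝕜] FormalFun 𝕜 (M.O V') n (a + b) :=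
  mapCoeff (M.res h) (SuperSpace.isSuper_res h)

theorem coeff_resCoeff {V V' : Opens X} (h : V' ≤ V) (f : FormalFun 𝕜 (M.O V) n (a + b)) (S α) :
    coeff S α (M.resCoeff h f) = M.res h (coeff S α f) := rfl

variable (M) in
/-- A section of the group of formal symplectic automorphisms. -/
structure AutSection (U : Opens X) where
  aut : ∀ V ≤ U, formalAut 𝕜 (M.O V) n a b
  natural : ∀ V hV V' (h : V' ≤ V) f, M.resCoeff h ((aut V hV).1 f) = (aut V' (h.trans hV)).1 (M.resCoeff h f)

theorem taylor_res (c : M.Chart (Fin n ⊕ Fin n) (a + b)) {V V' : Opens X} (hV : (V : Set X) ⊆ c.body.source) (h : V' ≤ V) (f : M.O V) :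
    M.resCoeff h ((c.frame hV).taylor f) = (c.frame (Set.Subset.trans h hV)).taylor (M.res h f) :=
  Frame.taylor_natural _ _ _ _ (c.frame_res hV h) f

/-- The formal coordinates obtained from a Darboux chart and a section of the automorphism group. -/
def formalCoordinates {c : M.Chart (Fin n ⊕ Fin n) (a + b)} (hc : c.IsDarboux M.form) {U : Opens X} (hU : (U : Set X) ⊆ c.body.source)
    (s : M.AutSection U) : M.FormalCoordinates U where
  map V hV := (s.aut V hV).1.toAlgHom.comp (c.frame (Set.Subset.trans hV hU)).taylor
  map_parity V hV f := by
    change (s.aut V hV).1 (Frame.taylor _ _) = _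
    rw [Frame.taylor_parity, (s.aut V hV).2.2.1]
    rfl
  map_res V hV V' h f S α := by
    change coeff S α ((s.aut V' _).1 (Frame.taylor _ _)) = M.res h (coeff S α ((s.aut V hV).1 (Frame.taylor _ _)))
    rw [← taylor_res c (Set.Subset.trans hV hU) h, ← s.natural V hV V' h, coeff_resCoeff]
  coeff_zero V hV f := by
    change coeff ∅ 0 ((s.aut V hV).1 (Frame.taylor _ _)) = f
    rw [formalAut.coeff_zero, Frame.taylor_coeff_zero]
  map_bracket V hV j f g Z hZ := by
    change (s.aut V hV).1 (Frame.taylor _ _) = bracket a b ((s.aut V hV).1 (Frame.taylor _ _)) ((s.aut V hV).1 (Frame.taylor _ _))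
    rw [SuperSpace.Chart.hamiltonian_apply _ hc (Set.Subset.trans hV hU) hZ, ← (s.aut V hV).2.2.2.1, ← frame_ham]
    congr 1
    exact Frame.ham_map _ _ _ (Frame.taylor_parity _) (fun k f => (Frame.frame_taylor _ k f).symm) f g
  formal_injective V hV x hx k f hf := by
    rw [c.vanishing_eq (Set.Subset.trans hV hU) hx] at hf ⊢
    exact (c.isPoint (Set.Subset.trans hV hU) hx).formal_injective (s.aut V hV) k f hf
  formal_surjective V hV x hx k g := by
    rw [c.vanishing_eq (Set.Subset.trans hV hU) hx]
    exact (c.isPoint (Set.Subset.trans hV hU) hx).formal_surjective (s.aut V hV) k g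

end SymplecticSupermanifold
end

end SuperGeom
end

/-! ### Interpolation of local coordinate systems -/

noncomputable section
namespace SuperGeom
open FormalFun

section
variable {𝕜 A A' : Type*} [CommRing 𝕜] [Ring A] [Algebra 𝕜 A] [SuperAlgebra 𝕜 A] [Ring A'] [Algebra 𝕜 A'] [SuperAlgebra 𝕜 A'] {n a b : ℕ}

theorem FormalFun.mapCoeff_proj {r : ℕ} (ρ : A →ₐ[𝕜] A') (hρ : IsSuper ρ) (k : ℕ) (f : FormalFun 𝕜 A n r) :
    mapCoeff ρ hρ (proj k f) = proj k (mapCoeff ρ hρ f) := by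
  ext S α
  rw [coeff_mapCoeff, coeff_proj, coeff_proj, coeff_mapCoeff]
  split_ifs <;> simp

theorem IsSuper.map_even {ρ : A →ₐ[𝕜] A'} (hρ : IsSuper ρ) {t : A} (ht : SuperAlgebra.parity (𝕜 := 𝕜) t = t) :
    SuperAlgebra.parity (𝕜 := 𝕜) (ρ t) = ρ t := by rw [← hρ, ht]

/-- The coefficients of a contraction are polynomial in `t`, hence natural in the algebra of
coefficients. This makes contraction with a function as parameter compatible with restriction. -/
theorem mapCoeff_contractAut (ρ : A →ₐ[𝕜] A') (hρ : IsSuper ρ) {t : A} (ht : SuperAlgebra.parity (𝕜 := 𝕜) t = t)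
    {φ : formalAut 𝕜 A n a b} {φ' : formalAut 𝕜 A' n a b} (h : ∀ f, mapCoeff ρ hρ (φ.1 f) = φ'.1 (mapCoeff ρ hρ f))
    (f : FormalFun 𝕜 A n (a + b)) :
    mapCoeff ρ hρ ((contractAut t ht φ).1 f) = (contractAut (ρ t) (hρ.map_even ht) φ').1 (mapCoeff ρ hρ f) := by
  ext S α
  rw [coeff_mapCoeff, contractAut_apply, contractAut_apply, coeff_contract, coeff_contract, map_sum]
  refine Finset.sum_congr rfl fun k _ => ?_
  rw [map_mul, map_pow, ← coeff_mapCoeff ρ hρ, h, mapCoeff_proj]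

theorem contractAut_congr {t t' : A} (h : t = t') (ht : SuperAlgebra.parity (𝕜 := 𝕜) t = t)
    (ht' : SuperAlgebra.parity (𝕜 := 𝕜) t' = t') (φ : formalAut 𝕜 A n a b) : contractAut t ht φ = contractAut t' ht' φ := by
  subst h
  rfl

theorem formalAut.mul_apply (φ ψ : formalAut 𝕜 A n a b) (f) : (φ * ψ).1 f = φ.1 (ψ.1 f) := rfl

theorem formalAut.inv_apply_self (φ : formalAut 𝕜 A n a b) (f) : (φ⁻¹).1 (φ.1 f) = f := φ.1.symm_apply_apply f

theorem formalAut.apply_inv_self (φ : formalAut 𝕜 A n a b) (f) : φ.1 ((φ⁻¹).1 f) = f := φ.1.apply_symm_apply f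

end

namespace SymplecticSupermanifold
variable {𝕜 : Type*} [RCLike 𝕜] {X : Type*} [TopologicalSpace X] {n a b : ℕ} {M : SymplecticSupermanifold 𝕜 n a b X}

namespace AutSection
variable {U : Opens X}

/-- Restriction to a smaller open set. -/
def restrict (s : M.AutSection U) {U' : Opens X} (h : U' ≤ U) : M.AutSection U' where
  aut V hV := s.aut V (hV.trans h)
  natural V hV V' h' f := s.natural V _ V' h' f

instance : One (M.AutSection U) := ⟨⟨fun _ _ => 1, fun _ _ _ _ _ => rfl⟩⟩

instance : Mul (M.AutSection U) := ⟨fun s t => ⟨fun V hV => s.aut V hV * t.aut V hV, fun V hV V' h f => by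
  rw [formalAut.mul_apply, s.natural, t.natural, formalAut.mul_apply]⟩⟩

instance : Inv (M.AutSection U) := ⟨fun s => ⟨fun V hV => (s.aut V hV)⁻¹, fun V hV V' h f => by
  apply (s.aut V' (h.trans hV)).1.injective
  rw [← s.natural V hV V' h, formalAut.apply_inv_self, formalAut.apply_inv_self]⟩⟩

/-- The contraction with a function as parameter. -/
def contract (t : M.O U) (ht : SuperAlgebra.parity (𝕜 := 𝕜) t = t) (s : M.AutSection U) : M.AutSection U where
  aut V hV := contractAut (M.res hV t) ((SuperSpace.isSuper_res hV).map_even ht) (s.aut V hV)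
  natural V hV V' h f := by
    refine (mapCoeff_contractAut (M.res h) (SuperSpace.isSuper_res h) _ (s.natural V hV V' h) f).trans ?_
    exact congrArg (fun φ : formalAut 𝕜 (M.O V') n a b => φ.1 _) (contractAut_congr (M.res_res hV h t) _ _ _)

/-- The change of coordinates between two Darboux charts. -/
def trans {c c' : M.Chart (Fin n ⊕ Fin n) (a + b)} (hc : c.IsDarboux M.form) (hc' : c'.IsDarboux M.form)
    (hU : (U : Set X) ⊆ c.body.source) (hU' : (U : Set X) ⊆ c'.body.source) : M.AutSection U where
  aut V hV := (c.frame (Set.Subset.trans hV hU)).transAut (c'.frame (Set.Subset.trans hV hU')) (ham_eq hc hc' _ _)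
  natural V hV V' h f := by
    set g := (c.frame (Set.Subset.trans hV hU)).transAut (c'.frame (Set.Subset.trans hV hU')) (ham_eq hc hc' _ _) with hg
    set g' := (c.frame (Set.Subset.trans (h.trans hV) hU)).transAut (c'.frame (Set.Subset.trans (h.trans hV) hU')) (ham_eq hc hc' _ _) with hg'
    -- Both composites are filtered, so constants and variables suffice. A variable is an expanded
    -- coordinate minus a constant, and expansions commute with restriction.
    refine RingHom.congr_fun (ringHom_ext (Φ := ((M.resCoeff h).comp g.1.toAlgHom).toRingHom)
      (Ψ := (g'.1.toAlgHom.comp (M.resCoeff h)).toRingHom) ?_ ?_ ?_ ?_) f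
    · exact fun k f hf => mapCoeff_mem_filtration _ (SuperSpace.isSuper_res h) ((g.2.2.2.2 k f).2 hf)
    · exact fun k f hf => (g'.2.2.2.2 k _).2 (mapCoeff_mem_filtration _ (SuperSpace.isSuper_res h) hf)
    · intro t
      change M.resCoeff h (g.1 (const t)) = g'.1 (M.resCoeff h (const t))
      rw [g.2.1, resCoeff, mapCoeff_const, g'.2.1]
    · intro k
      change M.resCoeff h (g.1 (gen k)) = g'.1 (M.resCoeff h (gen k))
      rw [(c.frame (Set.Subset.trans hV hU)).gen_eq, map_sub, map_sub, map_sub, map_sub, CoordFrame.transAut_taylor, taylor_res, taylor_res,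
        CoordFrame.transAut_taylor, g.2.1, resCoeff, mapCoeff_const, g'.2.1]

end AutSection

variable (M) in
/-- Local formal coordinates, given by a Darboux chart and a section of the automorphism group. -/
structure LocalCoords where
  U : Opens X
  c : M.Chart (Fin n ⊕ Fin n) (a + b)
  darboux : c.IsDarboux M.form
  subset_source : (U : Set X) ⊆ c.body.source
  s : M.AutSection U

namespace LocalCoords

/-- The formal coordinates. -/
def coords (d : M.LocalCoords) : M.FormalCoordinates d.U := formalCoordinates d.darboux d.subset_source d.s

theorem coords_map (d : M.LocalCoords) {V : Opens X} (hV : V ≤ d.U) (f : M.O V) :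
    d.coords.map V hV f = (d.s.aut V hV).1 ((d.c.frame (Set.Subset.trans hV d.subset_source)).taylor f) := rfl

/-- On `V` the two systems of coordinates differ by a linear transformation. -/
def Rel (d d' : M.LocalCoords) {V : Opens X} (hV : V ≤ d.U) (hV' : V ≤ d'.U) : Prop :=
  ∃ g ∈ linearAut 𝕜 (M.O V) n a b, ∀ f, d'.coords.map V hV' f = g.1 (d.coords.map V hV f)

variable {d d' d'' : M.LocalCoords} {V : Opens X} {hV : V ≤ d.U} {hV' : V ≤ d'.U} {hV'' : V ≤ d''.U}

theorem Rel.of_eq (h : ∀ f, d'.coords.map V hV' f = d.coords.map V hV f) : Rel d d' hV hV' :=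
  ⟨1, one_mem _, h⟩

theorem Rel.symm (h : Rel d d' hV hV') : Rel d' d hV' hV := by
  obtain ⟨g, hg, h⟩ := h
  refine ⟨g⁻¹, inv_mem hg, fun f => ?_⟩
  rw [h, formalAut.inv_apply_self]

theorem Rel.trans (h : Rel d d' hV hV') (h' : Rel d' d'' hV' hV'') : Rel d d'' hV hV'' := by
  obtain ⟨g, hg, h⟩ := h
  obtain ⟨g', hg', h'⟩ := h'
  refine ⟨g' * g, mul_mem hg' hg, fun f => ?_⟩
  rw [h', h, formalAut.mul_apply]

/-- Restriction to a smaller open set. -/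
def restrict (d : M.LocalCoords) {V : Opens X} (h : V ≤ d.U) : M.LocalCoords :=
  ⟨V, d.c, d.darboux, Set.Subset.trans h d.subset_source, d.s.restrict h⟩

/-- The coordinates of a Darboux chart. -/
def ofChart {c : M.Chart (Fin n ⊕ Fin n) (a + b)} (hc : c.IsDarboux M.form) {U : Opens X} (hU : (U : Set X) ⊆ c.body.source) :
    M.LocalCoords := ⟨U, c, hc, hU, 1⟩

/-- The coordinates that interpolate between those of `d` and those of a Darboux chart, with parameter `t`. -/
def combine (d : M.LocalCoords) {c : M.Chart (Fin n ⊕ Fin n) (a + b)} (hc : c.IsDarboux M.form) {U : Opens X}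
    (hU : (U : Set X) ⊆ c.body.source) (t : M.O U) (ht : SuperAlgebra.parity (𝕜 := 𝕜) t = t) : M.LocalCoords where
  U := d.U ⊓ U
  c := d.c
  darboux := d.darboux
  subset_source := Set.Subset.trans Set.inter_subset_left d.subset_source
  -- The product in the contraction transforms the coordinates of `d` into those of the chart; after
  -- contraction it is applied to the coordinates of `d`.
  s := (AutSection.trans d.darboux hc (Set.Subset.trans Set.inter_subset_left d.subset_source) (Set.Subset.trans Set.inter_subset_right hU) *
    (d.s.restrict inf_le_left)⁻¹).contract (M.res inf_le_right t) ((SuperSpace.isSuper_res _).map_even ht) * d.s.restrict inf_le_left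

section
variable (d) {c : M.Chart (Fin n ⊕ Fin n) (a + b)} (hc : c.IsDarboux M.form) {U : Opens X}
    (hU : (U : Set X) ⊆ c.body.source) (t : M.O U) (ht : SuperAlgebra.parity (𝕜 := 𝕜) t = t) {V : Opens X} (hd : V ≤ d.U) (hV : V ≤ U)

/-- The transformation from the coordinates of `d` to those of a Darboux chart. -/
def toChart : formalAut 𝕜 (M.O V) n a b :=
  (d.c.frame (Set.Subset.trans hd d.subset_source)).transAut (c.frame (Set.Subset.trans hV hU)) (ham_eq d.darboux hc _ _) * (d.s.aut V hd)⁻¹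

theorem toChart_apply (f : M.O V) :
    (d.toChart hc hU hd hV).1 (d.coords.map V hd f) = (c.frame (Set.Subset.trans hV hU)).taylor f := by
  rw [toChart, formalAut.mul_apply, coords_map, formalAut.inv_apply_self, CoordFrame.transAut_taylor]

theorem combine_map (f : M.O V) : (d.combine hc hU t ht).coords.map V (le_inf hd hV) f =
    (contractAut (M.res hV t) ((SuperSpace.isSuper_res _).map_even ht) (d.toChart hc hU hd hV)).1 (d.coords.map V hd f) := by
  rw [← contractAut_congr (M.res_res inf_le_right (le_inf hd hV) t)]
  · rfl
  · exact (SuperSpace.isSuper_res _).map_even ((SuperSpace.isSuper_res _).map_even ht)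

/-- At `t = 0` the contracted transformation is linear. -/
theorem combine_rel_of_eq_zero (h : M.res hV t = 0) : Rel d (d.combine hc hU t ht) hd (le_inf hd hV) := by
  refine ⟨_, contractAut_zero_mem (d.toChart hc hU hd hV), fun f => ?_⟩
  rw [combine_map, contractAut_congr h _ (map_zero _)]

theorem combine_of_eq_one (h : M.res hV t = 1) (f : M.O V) :
    (d.combine hc hU t ht).coords.map V (le_inf hd hV) f = (ofChart hc hU).coords.map V hV f := by
  rw [combine_map d hc hU t ht hd hV, contractAut_congr h _ (map_one _), contractAut_one_left, toChart_apply]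
  rfl

/-- If `d'` is `d` followed by a linear `g`, then the transformation from `d` to the chart is the
one from `d'` composed with `g`. Contraction fixes `g`, so the interpolated coordinates coincide
exactly, not just modulo `Sp`. This is where the argument needs a contraction of the quotient. -/
theorem combine_of_rel {hd' : V ≤ d'.U} (h : Rel d d' hd hd') (f : M.O V) :
    (d'.combine hc hU t ht).coords.map V (le_inf hd' hV) f = (d.combine hc hU t ht).coords.map V (le_inf hd hV) f := by
  obtain ⟨g, hg, h⟩ := h
  have h1 : d.toChart hc hU hd hV = d'.toChart hc hU hd' hV * g := by
    have h2 : d.toChart hc hU hd hV * d.s.aut V hd = d'.toChart hc hU hd' hV * g * d.s.aut V hd := by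
      refine (d.c.frame (Set.Subset.trans hd d.subset_source)).aut_ext fun f => ?_
      rw [formalAut.mul_apply, formalAut.mul_apply, formalAut.mul_apply, ← coords_map, ← h, toChart_apply, toChart_apply]
    exact mul_right_cancel h2
  rw [combine_map, combine_map, h1, contractAut_mul, contractAut_of_linear _ _ hg, formalAut.mul_apply, h]

end

end LocalCoords
end SymplecticSupermanifold

end SuperGeom
end

/-! ### Successive extension of sections with cutoff functions -/

noncomputable section
namespace SuperGeom
open FormalFun

namespace SymplecticSupermanifold
variable {𝕜 : Type*} [RCLike 𝕜] {X : Type*} [TopologicalSpace X] {n a b : ℕ} {M : SymplecticSupermanifold 𝕜 n a b X}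

variable (M) in
/-- A Darboux chart with a function that is `1` on `W` and `0` outside of `K`. -/
structure Cutoff where
  c : M.Chart (Fin n ⊕ Fin n) (a + b)
  darboux : c.IsDarboux M.form
  t : M.O ⟨c.body.source, c.body.open_source⟩
  even : SuperAlgebra.parity (𝕜 := 𝕜) t = t
  K : Set X
  isClosed : IsClosed K
  subset_source : K ⊆ c.body.source
  W : Opens X
  W_subset : (W : Set X) ⊆ c.body.source
  eq_zero : ∀ (V : Opens X) (hV : V ≤ ⟨c.body.source, c.body.open_source⟩), Disjoint (V : Set X) K → M.res hV t = 0
  eq_one : ∀ (V : Opens X) (hV : V ≤ ⟨c.body.source, c.body.open_source⟩), V ≤ W → M.res hV t = 1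

/-- Any two of the local coordinates differ by linear transformations. -/
def Compatible (𝒟 : Set M.LocalCoords) : Prop :=
  ∀ d ∈ 𝒟, ∀ d' ∈ 𝒟, ∀ V (hV : V ≤ d.U) (hV' : V ≤ d'.U), LocalCoords.Rel d d' hV hV'

namespace Cutoff
variable (χ : M.Cutoff) (𝒟 : Set M.LocalCoords)

/-- Interpolation with a Darboux chart. -/
def combine (d : M.LocalCoords) : M.LocalCoords := d.combine χ.darboux le_rfl χ.t χ.even

/-- The extension of a section of `M^coor / Sp` over `W`, which changes it only on `K`. -/
def extend : Set M.LocalCoords :=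
  {e | (∃ d ∈ 𝒟, ∃ V, ∃ h : V ≤ d.U, Disjoint (V : Set X) χ.K ∧ e = d.restrict h) ∨ (∃ d ∈ 𝒟, e = χ.combine d) ∨
    e = LocalCoords.ofChart χ.darboux χ.W_subset}

variable {𝒟}

theorem restrict_mem_extend {d : M.LocalCoords} (hd : d ∈ 𝒟) {V : Opens X} (h : V ≤ d.U) (hV : Disjoint (V : Set X) χ.K) :
    d.restrict h ∈ χ.extend 𝒟 := Or.inl ⟨d, hd, V, h, hV, rfl⟩

/-- Over a point of `K` the interpolated coordinates serve, as `K` lies in the domain of the chart;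
off `K` the old ones do, restricted to the complement of `K`. -/
theorem exists_mem_extend {x : X} (h : (∃ d ∈ 𝒟, x ∈ d.U) ∨ x ∈ χ.W) : ∃ d ∈ χ.extend 𝒟, x ∈ d.U := by
  rcases h with ⟨d, hd, hx⟩ | hx
  · by_cases hK : x ∈ χ.K
    · exact ⟨_, Or.inr (Or.inl ⟨d, hd, rfl⟩), hx, χ.subset_source hK⟩
    · exact ⟨_, χ.restrict_mem_extend hd (V := d.U ⊓ ⟨χ.Kᶜ, χ.isClosed.isOpen_compl⟩) inf_le_left
        (Set.disjoint_left.2 fun y hy => hy.2), hx, hK⟩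
  · exact ⟨_, Or.inr (Or.inr rfl), hx⟩

theorem rel_combine_of_disjoint (d : M.LocalCoords) {V : Opens X} (hV : V ≤ d.U) (hV' : V ≤ (χ.combine d).U)
    (h : Disjoint (V : Set X) χ.K) : LocalCoords.Rel d (χ.combine d) hV hV' :=
  d.combine_rel_of_eq_zero _ _ _ _ hV (hV'.trans inf_le_right) (χ.eq_zero V _ h)

theorem combine_rel_chart (d : M.LocalCoords) {V : Opens X} (hV : V ≤ (χ.combine d).U) (hW : V ≤ χ.W) :
    LocalCoords.Rel (χ.combine d) (LocalCoords.ofChart χ.darboux χ.W_subset) hV hW :=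
  LocalCoords.Rel.of_eq fun f =>
    (d.combine_of_eq_one χ.darboux le_rfl χ.t χ.even (hV.trans inf_le_left) (hV.trans inf_le_right) (χ.eq_one V _ hW) f).symm

/-- Old coordinates are used only off `K`, where `t = 0`, and the chart's own only on `W`, where `t
= 1`. Two interpolated systems agree because interpolation is independent of the representative. The
nine cases reduce to these facts by symmetry and transitivity. -/
theorem compatible_extend (h : Compatible 𝒟) : Compatible (χ.extend 𝒟) := by
  have h22 : ∀ d ∈ 𝒟, ∀ d' ∈ 𝒟, ∀ V (hV : V ≤ (χ.combine d).U) (hV' : V ≤ (χ.combine d').U),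
      LocalCoords.Rel (χ.combine d) (χ.combine d') hV hV' := fun d hd d' hd' V hV hV' =>
    LocalCoords.Rel.of_eq fun f => LocalCoords.combine_of_rel d χ.darboux le_rfl χ.t χ.even _ (hV.trans inf_le_right)
      (h d hd d' hd' V (hV.trans inf_le_left) (hV'.trans inf_le_left)) f
  have h12 : ∀ d ∈ 𝒟, ∀ d' ∈ 𝒟, ∀ V (hV : V ≤ d.U) (hV' : V ≤ (χ.combine d').U), Disjoint (V : Set X) χ.K →
      LocalCoords.Rel d (χ.combine d') hV hV' := fun d hd d' hd' V hV hV' hK =>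
    (h d hd d' hd' V hV (hV'.trans inf_le_left)).trans (χ.rel_combine_of_disjoint d' _ hV' hK)
  -- The inclusion of `W` in `K` is not part of the data. On such a `V` the function `t` is both
  -- zero and one, and the comparison passes through the interpolated coordinates.
  have h13 : ∀ d ∈ 𝒟, ∀ V (hV : V ≤ d.U) (hV' : V ≤ χ.W), Disjoint (V : Set X) χ.K →
      LocalCoords.Rel d (LocalCoords.ofChart χ.darboux χ.W_subset) hV hV' := fun d hd V hV hV' hK =>
    (χ.rel_combine_of_disjoint d hV (le_inf hV (Set.Subset.trans hV' χ.W_subset)) hK).trans (χ.combine_rel_chart d _ hV')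
  rintro e (⟨d, hd, V₁, h₁, hK, rfl⟩ | ⟨d, hd, rfl⟩ | rfl) e' (⟨d', hd', V₂, h₂, hK', rfl⟩ | ⟨d', hd', rfl⟩ | rfl) V hV hV'
  · exact h d hd d' hd' V (hV.trans h₁) (hV'.trans h₂)
  · exact h12 d hd d' hd' V (hV.trans h₁) hV' (hK.mono_left hV)
  · exact h13 d hd V (hV.trans h₁) hV' (hK.mono_left hV)
  · exact (h12 d' hd' d hd V (hV'.trans h₂) hV (hK'.mono_left hV')).symm
  · exact h22 d hd d' hd' V hV hV'
  · exact χ.combine_rel_chart d hV hV'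
  · exact (h13 d' hd' V (hV'.trans h₂) hV (hK'.mono_left hV')).symm
  · exact (χ.combine_rel_chart d' hV' hV).symm
  · exact LocalCoords.Rel.of_eq fun f => rfl

end Cutoff

/-- The sections over the unions of the first `k` sets `W`. -/
def extendSeq (χ : ℕ → M.Cutoff) : ℕ → Set M.LocalCoords
  | 0 => ∅
  | k + 1 => (χ k).extend (extendSeq χ k)

theorem compatible_extendSeq (χ : ℕ → M.Cutoff) (k : ℕ) : Compatible (extendSeq χ k) := by
  induction k with
  | zero => exact fun d hd => absurd hd (Set.notMem_empty d)
  | succ k ih => exact (χ k).compatible_extend ih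

theorem exists_mem_extendSeq (χ : ℕ → M.Cutoff) {x : X} {i : ℕ} (hx : x ∈ (χ i).W) (k : ℕ) :
    ∃ d ∈ extendSeq χ (i + 1 + k), x ∈ d.U := by
  induction k with
  | zero => exact (χ i).exists_mem_extend (Or.inr hx)
  | succ k ih => exact (χ (i + 1 + k)).exists_mem_extend (Or.inl ih)

/-- Over an open set that avoids all later supports nothing is changed any more. The first step
restricts to `V`, the following ones restrict `V` to itself. -/
theorem restrict_mem_extendSeq (χ : ℕ → M.Cutoff) {N : ℕ} {d : M.LocalCoords} (hd : d ∈ extendSeq χ N) {V : Opens X} (h : V ≤ d.U)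
    (hV : ∀ k, N ≤ k → Disjoint (V : Set X) (χ k).K) (k : ℕ) : d.restrict h ∈ extendSeq χ (N + 1 + k) := by
  induction k with
  | zero => exact (χ N).restrict_mem_extend hd h (hV N le_rfl)
  | succ k ih => exact (χ (N + 1 + k)).restrict_mem_extend ih (V := V) le_rfl (hV _ (by omega))

/-- A global section of `M^coor / Sp`, from a locally finite sequence of cutoff functions. -/
theorem nonempty_formalExponential_of_cutoff (χ : ℕ → M.Cutoff) (hK : LocallyFinite fun k => (χ k).K) (hW : ∀ x, ∃ k, x ∈ (χ k).W) :
    Nonempty M.FormalExponential := by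
  have h : ∀ x : X, ∃ e : M.LocalCoords, x ∈ e.U ∧ ∃ N, ∀ k, e ∈ extendSeq χ (N + k) := by
    intro x
    obtain ⟨s, hs, hfin⟩ := hK x
    obtain ⟨i, hi⟩ := hW x
    -- `m` bounds the indices of the supports that meet the neighbourhood `s`. Representatives are
    -- taken at stage `i + 1 + m`, which lies beyond all of them, and restricted to the interior of
    -- `s`.
    obtain ⟨m, hm⟩ := hfin.bddAbove
    obtain ⟨d, hd, hx⟩ := exists_mem_extendSeq χ hi m
    refine ⟨d.restrict (V := d.U ⊓ ⟨interior s, isOpen_interior⟩) inf_le_left, ⟨hx, mem_interior_iff_mem_nhds.2 hs⟩, _,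
      restrict_mem_extendSeq χ hd _ fun k hk => ?_⟩
    rw [Set.disjoint_left]
    intro y hy hyK
    have : k ≤ m := hm ⟨y, hyK, interior_subset hy.2⟩
    omega
  choose e he N hN using h
  refine ⟨⟨fun x => (e x).U, he, fun x => (e x).coords, fun x y V hx hy => ?_⟩⟩
  -- The representatives near `x` and `y` both survive to the stage `N x + N y`, where all members
  -- are compatible.
  have h2 := hN y (N x)
  rw [add_comm] at h2
  exact compatible_extendSeq χ _ _ (hN x (N y)) _ h2 V hx hy

/-! ### Existence of cutoff functions -/

theorem eq_of_chart_apply {M : SuperSpace 𝕜 X} {r : ℕ} (c : M.Chart (Fin n ⊕ Fin n) r) {V : Opens X}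
    (hV : (V : Set X) ⊆ c.body.source) {f g : M.O V} (h : ∀ S x (hx : x ∈ V),
      (c.iso V hV f S).1 ⟨c.body x, Set.mem_image_of_mem c.body hx⟩ = (c.iso V hV g S).1 ⟨c.body x, Set.mem_image_of_mem c.body hx⟩) :
    f = g := by
  apply (c.iso V hV).injective
  refine Gr.ext fun S => smoothFun.ext ?_
  rintro ⟨_, x, hx, rfl⟩
  exact h S x hx

/-- The trivial cutoff function. -/
def Cutoff.trivial {c : M.Chart (Fin n ⊕ Fin n) (a + b)} (hc : c.IsDarboux M.form) : M.Cutoff where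
  c := c
  darboux := hc
  t := 0
  even := map_zero _
  K := ∅
  isClosed := isClosed_empty
  subset_source := Set.empty_subset _
  W := ⊥
  W_subset := Set.empty_subset _
  eq_zero V hV _ := map_zero _
  eq_one V hV hW := by
    refine eq_of_chart_apply c hV fun S x hx => ?_
    exact absurd (hW hx) (Set.notMem_empty x)

/-- The cutoff function of a ball in a chart. -/
def Cutoff.ofBall [T2Space X] {c : M.Chart (Fin n ⊕ Fin n) (a + b)} (hc : c.IsDarboux M.form) {y : (Fin n ⊕ Fin n) → ℝ}
    (χ : ContDiffBump y) (hy : Metric.closedBall y χ.rOut ⊆ c.body.target) : M.Cutoff where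
  c := c
  darboux := hc
  t := (c.iso ⟨c.body.source, c.body.open_source⟩ (Set.Subset.refl c.body.source)).symm (Gr.single ∅ (smoothFun.ofContDiffOn (fun z => ((χ z : ℝ) : 𝕜))
    ((RCLike.ofRealCLM (K := 𝕜)).contDiff.comp χ.contDiff).contDiffOn))
  even := by
    apply (c.iso ⟨c.body.source, c.body.open_source⟩ (Set.Subset.refl c.body.source)).injective
    rw [c.iso_parity, AlgEquiv.apply_symm_apply]
    refine Gr.ext fun S => ?_
    rw [Gr.parity_apply, Gr.single_apply]
    split_ifs with h
    · rw [h, Finset.card_empty, pow_zero, one_smul]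
      rfl
    · rw [map_zero, smul_zero]
  K := c.body.symm '' Metric.closedBall y χ.rOut
  isClosed := ((isCompact_closedBall y χ.rOut).image_of_continuousOn (c.body.symm.continuousOn.mono hy)).isClosed
  subset_source := by
    rintro _ ⟨z, hz, rfl⟩
    exact c.body.map_target (hy hz)
  W := ⟨_, c.body.isOpen_inter_preimage (Metric.isOpen_ball (x := y) (ε := χ.rIn))⟩
  W_subset := Set.inter_subset_left
  eq_zero V hV hK := by
    refine eq_of_chart_apply c hV fun S x hx => ?_
    rw [c.iso_res ⟨c.body.source, c.body.open_source⟩ (Set.Subset.refl c.body.source) V hV _ S x hx, AlgEquiv.apply_symm_apply, map_zero, Gr.zero_apply, Gr.single_apply]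
    split_ifs
    · have : χ (c.body x) = 0 := χ.zero_of_le_dist (by
        by_contra h
        exact Set.disjoint_left.1 hK hx ⟨c.body x, Metric.mem_closedBall.2 (not_le.1 h).le, c.body.left_inv (hV hx)⟩)
      change ((χ (c.body x) : ℝ) : 𝕜) = 0
      rw [this, RCLike.ofReal_zero]
    · rfl
  eq_one V hV hW := by
    refine eq_of_chart_apply c hV fun S x hx => ?_
    rw [c.iso_res ⟨c.body.source, c.body.open_source⟩ (Set.Subset.refl c.body.source) V hV _ S x hx, AlgEquiv.apply_symm_apply, map_one, Gr.one_apply, Gr.single_apply]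
    split_ifs
    · have : χ (c.body x) = 1 := χ.one_of_mem_closedBall (Metric.ball_subset_closedBall (hW hx).2)
      change ((χ (c.body x) : ℝ) : 𝕜) = 1
      rw [this, RCLike.ofReal_one]
    · rfl

/-- The closed ball is required to lie in the target of the chart so that its preimage is compact,
which later makes the supports of the cutoff functions closed in a Hausdorff space. -/
theorem hasBasis_nhds (e : OpenPartialHomeomorph X ((Fin n ⊕ Fin n) → ℝ)) {x : X} (hx : x ∈ e.source) :
    (nhds x).HasBasis (fun R : ℝ => 0 < R ∧ Metric.closedBall (e x) R ⊆ e.target) fun R => e.source ∩ e ⁻¹' Metric.ball (e x) R := by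
  refine ⟨fun s => ⟨fun hs => ?_, fun ⟨R, hR, hs⟩ => ?_⟩⟩
  · have h1 : e.symm ⁻¹' s ∈ nhds (e x) := (e.symm.continuousAt (e.map_source hx)).preimage_mem_nhds (by rwa [e.left_inv hx])
    have h2 := Filter.inter_mem h1 (e.open_target.mem_nhds (e.map_source hx))
    obtain ⟨R, hR, h⟩ := Metric.nhds_basis_closedBall.mem_iff.1 h2
    refine ⟨R, ⟨hR, fun z hz => (h hz).2⟩, fun z hz => ?_⟩
    have := (h (Metric.ball_subset_closedBall hz.2)).1
    rwa [Set.mem_preimage, e.left_inv hz.1] at this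
  · refine Filter.mem_of_superset ((e.isOpen_inter_preimage Metric.isOpen_ball).mem_nhds ⟨hx, ?_⟩) hs
    exact Metric.mem_ball_self hR.1

/-- A Hausdorff, second countable, locally Euclidean space has a countable locally finite cover by
coordinate balls. Shrinking these balls leaves room for bump functions that equal one on sets which
still cover. -/
theorem nonempty_formalExponential [T2Space X] [SecondCountableTopology X] (M : SymplecticSupermanifold 𝕜 n a b X) :
    Nonempty M.FormalExponential := by
  rcases isEmpty_or_nonempty X with hX | ⟨⟨x₀⟩⟩
  · exact ⟨⟨fun x => hX.elim x, fun x => hX.elim x, fun x => hX.elim x, fun x => hX.elim x⟩⟩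
  choose c hxc hc using M.darboux
  let _ : ChartedSpace ((Fin n ⊕ Fin n) → ℝ) X :=
    { atlas := Set.range fun x => (c x).body
      chartAt := fun x => (c x).body
      mem_chart_source := hxc
      chart_mem_atlas := fun x => ⟨x, rfl⟩ }
  have : LocallyCompactSpace X := ChartedSpace.locallyCompactSpace ((Fin n ⊕ Fin n) → ℝ) X
  obtain ⟨α, z, R, hR, hcov, hfin⟩ := refinement_of_locallyCompact_sigmaCompact_of_nhds_basis fun x => hasBasis_nhds (c x).body (hxc x)
  let B : α → Set X := fun i => (c (z i)).body.source ∩ (c (z i)).body ⁻¹' Metric.ball ((c (z i)).body (z i)) (R i)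
  have hBne : ∀ i, (B i).Nonempty := fun i => ⟨z i, hxc _, Metric.mem_ball_self (hR i).1⟩
  -- A locally finite family of nonempty sets is countable in a σ-compact space.
  have : Countable α := Set.countable_univ_iff.1 (hfin.countable_univ hBne)
  obtain ⟨C, hCcov, hCclosed, hCB⟩ := exists_iUnion_eq_closed_subset
    (fun i => (c (z i)).body.isOpen_inter_preimage (Metric.isOpen_ball)) (fun x => hfin.point_finite x) hcov
  -- The closed set `C i` lies in a compact coordinate ball, so its image in the chart is closed
  -- and, being inside the open ball of radius `R i`, already lies in a strictly smaller one.
  have hr : ∀ i, ∃ r, 0 < r ∧ r < R i ∧ C i ⊆ (c (z i)).body ⁻¹' Metric.ball ((c (z i)).body (z i)) r := by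
    intro i
    have ht := (hR i).2
    have hBK : B i ⊆ (c (z i)).body.symm '' Metric.closedBall ((c (z i)).body (z i)) (R i) := fun x hx =>
      ⟨_, Metric.ball_subset_closedBall hx.2, (c (z i)).body.left_inv hx.1⟩
    have hK := ((isCompact_closedBall ((c (z i)).body (z i)) (R i)).image_of_continuousOn
      ((c (z i)).body.symm.continuousOn.mono ht)).of_isClosed_subset (hCclosed i) ((hCB i).trans hBK)
    have hcl := (hK.image_of_continuousOn ((c (z i)).body.continuousOn.mono ((hCB i).trans Set.inter_subset_left))).isClosed
    obtain ⟨r, hr, h⟩ := exists_pos_lt_subset_ball (hR i).1 hcl (Set.image_subset_iff.2 ((hCB i).trans Set.inter_subset_right))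
    exact ⟨r, hr.1, hr.2, Set.image_subset_iff.1 h⟩
  choose r hr0 hrR hCr using hr
  -- The inner radius `r i` makes the set `W` contain `C i`; the midpoint as outer radius keeps the
  -- support inside `B i`, so that local finiteness is inherited.
  let χ : ∀ i, ContDiffBump ((c (z i)).body (z i)) := fun i => ⟨r i, (r i + R i) / 2, hr0 i, by linarith [hrR i]⟩
  let ψ : α → M.Cutoff := fun i => Cutoff.ofBall (hc (z i)) (χ i)
    ((Metric.closedBall_subset_closedBall (by change (r i + R i) / 2 ≤ R i; linarith [hrR i])).trans (hR i).2)
  have hψ : ∀ i, (ψ i).K ⊆ B i := by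
    rintro i _ ⟨y, hy, rfl⟩
    have hy' : y ∈ Metric.ball ((c (z i)).body (z i)) (R i) := Metric.closedBall_subset_ball (by change (r i + R i) / 2 < R i; linarith [hrR i]) hy
    have ht : y ∈ (c (z i)).body.target := (hR i).2 (Metric.ball_subset_closedBall hy')
    refine ⟨(c (z i)).body.map_target ht, ?_⟩
    rwa [Set.mem_preimage, (c (z i)).body.right_inv ht]
  have := Encodable.ofCountable α
  -- The index set is spread over `ℕ` by an encoding. Unused numbers get the trivial cutoff, which
  -- changes nothing because its support is empty.
  let φ : ℕ → M.Cutoff := fun k => (Encodable.decode₂ α k).elim (Cutoff.trivial (hc x₀)) ψ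
  refine nonempty_formalExponential_of_cutoff φ ?_ fun x => ?_
  · intro x
    obtain ⟨s, hs, hf⟩ := hfin x
    refine ⟨s, hs, (hf.image Encodable.encode).subset fun k hk => ?_⟩
    obtain ⟨y, hyK, hys⟩ := hk
    rcases hd : Encodable.decode₂ α k with _ | i
    · simp only [φ, hd] at hyK
      exact absurd hyK (Set.notMem_empty y)
    · simp only [φ, hd] at hyK
      exact ⟨i, ⟨y, hψ i hyK, hys⟩, (Encodable.mem_decode₂.1 hd)⟩
  · obtain ⟨i, hi⟩ := Set.mem_iUnion.1 (hCcov.symm ▸ Set.mem_univ x : x ∈ ⋃ i, C i)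
    refine ⟨Encodable.encode i, ?_⟩
    simp only [φ, Encodable.decode₂_encode]
    exact ⟨(hCB i hi).1, hCr i hi⟩

end SymplecticSupermanifold

end SuperGeom
end

open SuperGeom in
theorem mainTheorem8 {𝕜 : Type*} [RCLike 𝕜] (n a b : ℕ) :
    ContractibleSpace (formalAut 𝕜 𝕜 n a b ⧸ linearAut 𝕜 𝕜 n a b) ∧
    (∀ (A : Type*) [Ring A] [Algebra 𝕜 A] [SuperAlgebra 𝕜 A] [TopologicalSpace A]
        [IsTopologicalRing A] [ContinuousSMul 𝕜 A],
      ContractibleSpace (formalAut 𝕜 A n a b ⧸ linearAut 𝕜 A n a b)) ∧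
    ∀ (X : Type*) [TopologicalSpace X] [T2Space X] [SecondCountableTopology X]
      (M : SymplecticSupermanifold 𝕜 n a b X), Nonempty M.FormalExponential := by
  refine ⟨contractibleSpace_formalAut_quotient 𝕜 n a b, fun A => ?_, fun X => ?_⟩
  · intros
    exact contractibleSpace_formalAut_quotient A n a b
  · intro _ _ _ M
    exact M.nonempty_formalExponential
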